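/- Let $g\ge 2$ and let $D\subset\mathbb D$ be the regular hyperbolic $4g$-gon centred at $0$ with all angles $\pi/(2g)$. Label its sides, in $g$ groups of four consecutive sides, $a_j,b_j,a_j^{-1},b_j^{-1}$, and for each side $s$ let $\gamma_s$ be the orientation preserving disk automorphism which maps $s$ onto the corresponding side $s'$ with $D\cap\gamma_s(D)=s'$. Let $\Gamma_0$ be the group generated by the $\gamma_s$ and $\mathcal R$ the net formed by the translates $\gamma(D)$, $\gamma\in\Gamma_0$. Let $V$ be the set of vertices of $\mathcal R$ that are adjacent along an edge of $\mathcal R$ to a vertex of $D$ but are not vertices of $D$. Let $W\subset S^1$ be the finite set of endpoints at infinity of all geodesics of $\mathcal R$ passing through a point of $V$. For a side $s$, let $J_s$ be the smaller closed arc cut off from $S^1$ by the geodesic through $s$. For a vertex $v$ of $D$ with sides $s_1,s_2$ at $v$, let $\gamma(D)\neq D$ be the translate of $D$ with consecutive vertices $q,p,v,p',q'$ such that $p$ and $p'$ lie on the geodesics through $s_1$ and $s_2$, and let $J(v)$ be the arc inside $J_{s_1}\cap J_{s_2}$ bounded by the endpoints at infinity, lying in the interior of $J_{s_1}\cap J_{s_2}$,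 of the geodesics through $p,q$ and through $p',q'$. The standard Bowen–Series map $f_0:S^1\to S^1$ equals $\gamma_s$ on the arc $\tilde J_s\subset J_s$ which, going clockwise, starts after $J(v')$ and ends with $J(v)$, where $v',v$ are the endpoints of $s$ in clockwise order; these arcs tile $S^1$ (at a common endpoint, $f_0$ is given by the branch on the counterclockwise side). Let $\eta_{0,0}$ be the set of closed arcs into which $W$ cuts $S^1$. Let $X=\mathbb D/\Gamma_X$ be a closed hyperbolic Riemann surface ($\Gamma_X$ acting freely, properly discontinuously and cocompactly on $\mathbb D$), let $\phi:\Gamma_0\to\Gamma_X$ be a group isomorphism, and let $H:S^1\to S^1$ be its boundary correspondence, i.e. the homeomorphism with $H\circ\gamma=\phi(\gamma)\circ H$ on $S^1$ for all $\gamma\in\Gamma_0$. Put $f_X=H\circ f_0\circ H^{-1}$, $\eta_0=\{H(I): I\in\eta_{0,0}\}$ and $\eta_n=f_X^{-n}\eta_0$, that is, $\eta_n$ consists of the closures of the connected components of the sets $f_X^{-n}(\operatorname{int} I)$, $I\in\eta_0$. Then: 1. $f_X$ is a Markov map for $\Gamma_X$ with Markov partition $\eta_0$: the set $\eta_0$ consists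 of finitely many closed arcs with disjoint interiors covering $S^1$; for each $I\in\eta_0$ there is $\gamma_I\in\Gamma_X$ such that $f_X=\gamma_I$ on the interior of $I$ and $\gamma_I(I)$ is a union of arcs of $\eta_0$; and every $x\in S^1$ lies in some $I\in\eta_0$ with $f_X(x)=\gamma_I(x)$. 2. $f_X$ is expanding: there are $C>0$ and $\lambda>1$ such that for every $n\ge0$ and every $I\in\eta_n$ there is $\gamma\in\Gamma_X$ with $f_X^n=\gamma$ on the interior of $I$ and $|\gamma'(x)|\ge C\lambda^n$ for all $x\in I$ (so $|(f_X^n)'(x)|\ge C\lambda^n$, with one-sided derivatives of the branches at the endpoints of $I$). 3. The sequence $(\eta_n)_{n\ge0}$ has bounded geometry: there is $C>0$ such that $|J|/|I|\ge C$ for all $n\ge0$, $I\in\eta_n$, $J\in\eta_{n+1}$ with $J\subset I$, where $|\cdot|$ is arc length. -/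

import Mathlib

namespace BowenSeries

open Set Real

/-! ## Conformal automorphisms of the closed unit disk -/

/-- The closed unit disk. -/
abbrev ClosedDisc : Type := Metric.closedBall (0 : ℂ) 1

/-- `m` is the Möbius transformation `z ↦ (a z + b) / (conj b z + conj a)`, `|a|² - |b|² = 1`. -/
def IsDiscMobius (m : Equiv.Perm ClosedDisc) : Prop :=
  ∃ a b : ℂ, Complex.normSq a - Complex.normSq b = 1 ∧
    ∀ z : ClosedDisc, (m z : ℂ) =
      (a * z + b) / ((starRingEnd ℂ) b * z + (starRingEnd ℂ) a)

theorem denom_ne_zero {a b z : ℂ} (h : Complex.normSq a - Complex.normSq b = 1)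
    (hz : ‖z‖ ≤ 1) : (starRingEnd ℂ) b * z + (starRingEnd ℂ) a ≠ 0 := by
  intro h0
  have h1 : ‖(starRingEnd ℂ) b * z‖ = ‖(starRingEnd ℂ) a‖ := by
    rw [eq_neg_of_add_eq_zero_left h0, norm_neg]
  rw [norm_mul, RCLike.norm_conj, RCLike.norm_conj] at h1
  rw [Complex.normSq_eq_norm_sq, Complex.normSq_eq_norm_sq] at h
  have h2 : ‖a‖ ≤ ‖b‖ := by
    rw [← h1]; exact mul_le_of_le_one_right (norm_nonneg _) hz
  nlinarith [norm_nonneg a, norm_nonneg b]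

theorem normSq_eq_one_cast {a b : ℂ} (h : Complex.normSq a - Complex.normSq b = 1) :
    a * (starRingEnd ℂ) a - b * (starRingEnd ℂ) b = 1 := by
  rw [Complex.mul_conj, Complex.mul_conj]; exact_mod_cast h

theorem closedDisc_norm_le (z : ClosedDisc) : ‖(z : ℂ)‖ ≤ 1 :=
  mem_closedBall_zero_iff.1 z.2

/-- The group of conformal automorphisms of the unit disk, acting on the closed disk
(as a group of transformations, so it is `PSU(1,1)`). -/
def DiscAut : Subgroup (Equiv.Perm ClosedDisc) where
  carrier := {m | IsDiscMobius m}
  one_mem' := ⟨1, 0, by simp, fun z => by simp⟩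
  mul_mem' := by
    rintro m n ⟨a, b, h, hm⟩ ⟨c, d, k, hn⟩
    refine ⟨a * c + b * (starRingEnd ℂ) d, a * d + b * (starRingEnd ℂ) c, ?_, fun z => ?_⟩
    · have e1 := normSq_eq_one_cast h
      have e2 := normSq_eq_one_cast k
      have : ((Complex.normSq (a * c + b * (starRingEnd ℂ) d) -
          Complex.normSq (a * d + b * (starRingEnd ℂ) c) : ℝ) : ℂ) = 1 := by
        push_cast
        rw [← Complex.mul_conj, ← Complex.mul_conj]
        simp only [map_add, map_mul, Complex.conj_conj]
        linear_combination (c * (starRingEnd ℂ) c - d * (starRingEnd ℂ) d) * e1 + e2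
      exact_mod_cast this
    · have d1 := denom_ne_zero k (closedDisc_norm_le z)
      have d2 := denom_ne_zero h (closedDisc_norm_le (n z))
      have e1 := hn z
      rw [Equiv.Perm.mul_apply, hm (n z)]
      rw [eq_div_iff d1] at e1
      simp only [map_add, map_mul, Complex.conj_conj]
      have d3 : ((starRingEnd ℂ) b * (n z : ℂ) + (starRingEnd ℂ) a) *
          ((starRingEnd ℂ) d * z + (starRingEnd ℂ) c) =
          ((starRingEnd ℂ) a * (starRingEnd ℂ) d + (starRingEnd ℂ) b * c) * z +
            ((starRingEnd ℂ) a * (starRingEnd ℂ) c + (starRingEnd ℂ) b * d) := by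
        linear_combination (starRingEnd ℂ) b * e1
      rw [div_eq_div_iff d2 (d3 ▸ mul_ne_zero d2 d1), ← d3]
      linear_combination (a * ((starRingEnd ℂ) b * (n z : ℂ) + (starRingEnd ℂ) a)) * e1
  inv_mem' := by
    rintro m ⟨a, b, h, hm⟩
    have h' : Complex.normSq ((starRingEnd ℂ) a) - Complex.normSq (-b) = 1 := by
      simpa using h
    refine ⟨(starRingEnd ℂ) a, -b, h', fun w => ?_⟩
    have d1 := denom_ne_zero h (closedDisc_norm_le (m⁻¹ w))
    have d2 := denom_ne_zero h' (closedDisc_norm_le w)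
    have e := hm (m⁻¹ w)
    rw [show m (m⁻¹ w) = w from m.apply_symm_apply w] at e
    rw [eq_div_iff d2]
    rw [eq_div_iff d1] at e
    simp only [map_neg, Complex.conj_conj]
    linear_combination -e

/-- A point of the unit circle as a point of the closed disk. -/
def circlePt (x : Circle) : ClosedDisc :=
  ⟨x, mem_closedBall_zero_iff.2 (Circle.norm_coe x).le⟩

theorem norm_apply_circlePt (m : DiscAut) (x : Circle) :
    ‖((m : Equiv.Perm ClosedDisc) (circlePt x) : ℂ)‖ = 1 := by
  obtain ⟨a, b, h, hm⟩ := m.2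
  rw [hm, norm_div, div_eq_one_iff_eq (norm_ne_zero_iff.2
    (denom_ne_zero h (closedDisc_norm_le (circlePt x))))]
  have hx : (x : ℂ) * (starRingEnd ℂ) (x : ℂ) = 1 := by
    rw [Complex.mul_conj, Circle.normSq_coe]; simp
  have : a * (x : ℂ) + b =
      x * (starRingEnd ℂ) ((starRingEnd ℂ) b * (x : ℂ) + (starRingEnd ℂ) a) := by
    simp only [map_add, map_mul, Complex.conj_conj]
    linear_combination -b * hx
  change ‖a * (x : ℂ) + b‖ = _
  rw [this, norm_mul, Circle.norm_coe, one_mul, RCLike.norm_conj]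
  rfl

/-- The action of a disk automorphism on the unit circle. -/
def boundaryMap (m : DiscAut) (x : Circle) : Circle :=
  ⟨(m : Equiv.Perm ClosedDisc) (circlePt x), mem_sphere_zero_iff_norm.2 (norm_apply_circlePt m x)⟩

/-- `Γ` acts freely, properly discontinuously and cocompactly on the open unit disk, i.e. `𝔻 / Γ`
is a closed hyperbolic Riemann surface with covering group `Γ`. -/
structure IsClosedSurfaceGroup (Γ : Subgroup DiscAut) : Prop where
  free : ∀ γ ∈ Γ, ∀ z : ClosedDisc, ‖(z : ℂ)‖ < 1 → (γ : Equiv.Perm ClosedDisc) z = z → γ = 1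
  properlyDiscontinuous : ∀ r : ℝ, r < 1 →
    {γ : DiscAut | γ ∈ Γ ∧ ∃ z : ClosedDisc, ‖(z : ℂ)‖ ≤ r ∧
      ‖((γ : Equiv.Perm ClosedDisc) z : ℂ)‖ ≤ r}.Finite
  cocompact : ∃ r : ℝ, r < 1 ∧ ∀ z : ClosedDisc, ‖(z : ℂ)‖ < 1 →
    ∃ γ ∈ Γ, ‖((γ : Equiv.Perm ClosedDisc) z : ℂ)‖ ≤ r

/-! ## Hyperbolic geodesics -/

/-- `z` satisfies the equation `d (1 + |z|²) = 2 Re (conj c · z)`. For `|d| < |c|` the solutions in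
the open disk form a hyperbolic geodesic (part of the Euclidean circle or line orthogonal to the
unit circle), the solutions on the unit circle are its two endpoints at infinity, and every
geodesic arises in this way. -/
def SatisfiesGeodesicEq (c : ℂ) (d : ℝ) (z : ℂ) : Prop :=
  d * (1 + ‖z‖ ^ 2) = 2 * ((starRingEnd ℂ) c * z).re

/-- `z`, a point of the open disk or of the unit circle, lies on the complete hyperbolic geodesic
through the distinct points `p` and `q` of the open disk, or is one of its endpoints. -/
def OnGeodesic (p q z : ℂ) : Prop :=
  ∃ (c : ℂ) (d : ℝ), |d| < ‖c‖ ∧ SatisfiesGeodesicEq c d p ∧ SatisfiesGeodesicEq c d q ∧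
    SatisfiesGeodesicEq c d z

/-! ## The standard surface of genus `g` and its net -/

/-- The vertices, counterclockwise and indexed modulo `4g`, of the regular hyperbolic `4g`-gon `D`
centred at `0` with all angles equal to `π / (2g)`; its Euclidean circumradius is
`√(cos (π / (2g)))`. -/
noncomputable def vertex (g : ℕ) (k : ℤ) : ClosedDisc :=
  ⟨(√(cos (π / (2 * g))) : ℝ) * (Circle.exp (2 * π * k / (4 * g)) : ℂ), by
    rw [mem_closedBall_zero_iff, norm_mul, Circle.norm_coe, mul_one, Complex.norm_real,
      Real.norm_of_nonneg (Real.sqrt_nonneg _), Real.sqrt_le_one]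
    exact Real.cos_le_one _⟩

/-- Side `k` joins `vertex g k` to `vertex g (k + 1)`. The sides are labelled, in consecutive groups
of four, `a, b, a⁻¹, b⁻¹`; this is the index of the side corresponding to side `k`. -/
def pairedSide (k : ℤ) : ℤ := if k % 4 = 0 ∨ k % 4 = 1 then k + 2 else k - 2

/-- `γ` is the side pairing `γ_s` of side `s = k`: it maps side `k` onto the corresponding side and
`D` onto the neighbour of `D` across that side (so it reverses the boundary orientation). -/
def IsSidePairing (g : ℕ) (k : ℤ) (γ : DiscAut) : Prop :=
  (γ : Equiv.Perm ClosedDisc) (vertex g k) = vertex g (pairedSide k + 1) ∧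
    (γ : Equiv.Perm ClosedDisc) (vertex g (k + 1)) = vertex g (pairedSide k)

/-- The Fuchsian group `Γ₀` of the standard Riemann surface of genus `g`. -/
def standardGroup (g : ℕ) : Subgroup DiscAut :=
  Subgroup.closure {γ | ∃ k : ℤ, IsSidePairing g k γ}

/-- `p` and `q` are joined by an edge of the net formed by the `Γ₀`-translates of `D`. -/
def NetAdj (g : ℕ) (p q : ClosedDisc) : Prop :=
  ∃ γ ∈ standardGroup g, ∃ k : ℤ,
    (p = (γ : Equiv.Perm ClosedDisc) (vertex g k) ∧
      q = (γ : Equiv.Perm ClosedDisc) (vertex g (k + 1))) ∨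
    (q = (γ : Equiv.Perm ClosedDisc) (vertex g k) ∧
      p = (γ : Equiv.Perm ClosedDisc) (vertex g (k + 1)))

/-- `V`: the vertices of the net which are not vertices of `D` but adjacent to a vertex of `D`. -/
def outerVertices (g : ℕ) : Set ClosedDisc :=
  {p | (∀ k : ℤ, p ≠ vertex g k) ∧ ∃ k : ℤ, NetAdj g p (vertex g k)}

/-- `W_p`: the endpoints at infinity of the geodesics of the net passing through its vertex `p`. -/
def geodesicEnds (g : ℕ) (p : ClosedDisc) : Set Circle :=
  {x | ∃ q : ClosedDisc, NetAdj g p q ∧ OnGeodesic p q x}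

/-- `W`, the union of the `W_p` over `p ∈ V`. -/
def cutPoints (g : ℕ) : Set Circle := ⋃ p ∈ outerVertices g, geodesicEnds g p

/-! ## The standard Bowen–Series map -/

/-- `J_s`: the smaller of the two closed arcs into which the geodesic through side `k` cuts the
circle, i.e. the one not on the side of the centre `0`. -/
def sideArc (g : ℕ) (k : ℤ) : Set Circle :=
  {x | ∃ (c : ℂ) (d : ℝ), 0 < d ∧ d < ‖c‖ ∧ SatisfiesGeodesicEq c d (vertex g k) ∧
    SatisfiesGeodesicEq c d (vertex g (k + 1)) ∧ d ≤ ((starRingEnd ℂ) c * (x : ℂ)).re}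

/-- `x` is the clockwise endpoint `w(v)` of the arc `J(v)`, `v = vertex g k`. Here `γ D` is the
translate of `D`, other than `D`, having as consecutive vertices `q', p', v, p, q` (counterclockwise)
with `p'` on the geodesic through side `k - 1` and `p` on the geodesic through side `k`; the
point `x` is the endpoint at infinity, inside `J_s ∩ J_s'`, of the geodesic through `p` and `q`.
(The other endpoint of `J(v)` comes from `p'` and `q'` in the same way.) -/
def IsClockwiseEnd (g : ℕ) (k : ℤ) (x : Circle) : Prop :=
  ∃ γ ∈ standardGroup g, γ ≠ 1 ∧ ∃ j : ℤ,
    (γ : Equiv.Perm ClosedDisc) (vertex g j) = vertex g k ∧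
    OnGeodesic (vertex g (k - 1)) (vertex g k) ((γ : Equiv.Perm ClosedDisc) (vertex g (j - 1))) ∧
    OnGeodesic (vertex g k) (vertex g (k + 1)) ((γ : Equiv.Perm ClosedDisc) (vertex g (j + 1))) ∧
    OnGeodesic ((γ : Equiv.Perm ClosedDisc) (vertex g (j + 1)))
      ((γ : Equiv.Perm ClosedDisc) (vertex g (j + 2))) x ∧
    x ∈ interior (sideArc g (k - 1) ∩ sideArc g k)

/-- The half-open counterclockwise arc `[a, b)` of the circle. -/
def ccwIco (a b : Circle) : Set Circle :=
  {x | ∃ s t : ℝ, 0 ≤ s ∧ s < t ∧ t < 2 * π ∧ x = a * Circle.exp s ∧ b = a * Circle.exp t}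

/-- The arc on which the standard map equals `γ_s`, `s` being side `k`: going clockwise, it starts
after `J(v')`, `v' = vertex g (k + 1)`, and ends with `J(v)`, `v = vertex g k`. These arcs tile the
circle; half-open arcs fix the values of the map at the finitely many common endpoints. -/
def branchArc (g : ℕ) (k : ℤ) : Set Circle :=
  {x | ∃ a b : Circle, IsClockwiseEnd g k a ∧ IsClockwiseEnd g (k + 1) b ∧ x ∈ ccwIco a b}

open Classical in
/-- The standard Bowen–Series map `f₀`: it equals `γ_s` on the arc `branchArc g k` of side `s = k`.
(The default value `x` is never used, as these arcs cover the circle.) -/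
noncomputable def standardMap (g : ℕ) (x : Circle) : Circle :=
  if h : ∃ γ : DiscAut, ∃ k : ℤ, IsSidePairing g k γ ∧ x ∈ branchArc g k then
    boundaryMap h.choose x
  else x

/-- The Markov partition of `f₀`: the closed arcs into which `W` cuts the circle. -/
def standardPartition (g : ℕ) : Set (Set Circle) :=
  {I | ∃ x ∉ cutPoints g, I = closure (connectedComponentIn (cutPoints g)ᶜ x)}

/-! ## Markov maps of the circle -/

/-- Nondegenerate closed arcs, different from the whole circle. -/
def IsClosedArc (I : Set Circle) : Prop :=
  ∃ a b : ℝ, a < b ∧ b < a + 2 * π ∧ I = Circle.exp '' Icc a b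

/-- `f` is a Markov map for `Γ` with Markov partition `η`: finitely many closed arcs with disjoint
interiors cover the circle, on each of them `f` is an element of `Γ`, and the image of
each of them under this element is a union of arcs of the partition. At a common endpoint of two
arcs, `f` takes the value given by one of the two. -/
def IsMarkovMap (Γ : Subgroup DiscAut) (f : Circle → Circle) (η : Set (Set Circle)) : Prop :=
  η.Finite ∧ (∀ I ∈ η, IsClosedArc I) ∧ ⋃₀ η = univ ∧
    (∀ I ∈ η, ∀ J ∈ η, I ≠ J → Disjoint (interior I) (interior J)) ∧
    ∃ γ : Set Circle → DiscAut,
      (∀ I ∈ η, γ I ∈ Γ ∧ (∀ x ∈ interior I, f x = boundaryMap (γ I) x) ∧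
        ∃ θ ⊆ η, boundaryMap (γ I) '' I = ⋃₀ θ) ∧
      ∀ x, ∃ I ∈ η, x ∈ I ∧ f x = boundaryMap (γ I) x

/-- `η_n = f⁻ⁿ η`: the closures of the connected components of the sets `f⁻ⁿ (int I)`, `I ∈ η`. -/
def pullbackPartition (f : Circle → Circle) (η : Set (Set Circle)) (n : ℕ) : Set (Set Circle) :=
  {J | ∃ I ∈ η, ∃ x, f^[n] x ∈ interior I ∧
    J = closure (connectedComponentIn (f^[n] ⁻¹' interior I) x)}

/-- The absolute value of the derivative of a circle map at `x` with respect to arc length. -/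
noncomputable def absDeriv (m : Circle → Circle) (x : Circle) : ℝ :=
  ‖deriv (fun t : ℝ => (m (x * Circle.exp t) : ℂ)) 0‖

/-- The Markov map `f` for `Γ` with Markov partition `η` is expanding: `|(fⁿ)'| ≥ C λⁿ`. On an arc
`I` of `η_n` the iterate `fⁿ` is an element `γ` of `Γ`; at the endpoints of `I`, where `fⁿ` may
be discontinuous, the derivative is that of the branch `γ`. -/
def IsExpanding (Γ : Subgroup DiscAut) (f : Circle → Circle) (η : Set (Set Circle)) : Prop :=
  ∃ C > 0, ∃ l > 1, ∀ n : ℕ, ∀ I ∈ pullbackPartition f η n, ∃ γ ∈ Γ,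
    (∀ x ∈ interior I, f^[n] x = boundaryMap γ x) ∧
    ∀ x ∈ I, C * l ^ n ≤ absDeriv (boundaryMap γ) x

/-- Arc length of a subset of the circle. -/
noncomputable def arcLength (I : Set Circle) : ℝ :=
  (MeasureTheory.volume {t : ℝ | t ∈ Ioc (-π) π ∧ Circle.exp t ∈ I}).toReal

/-- The sequence of partitions `η_n = f⁻ⁿ η` has bounded geometry. -/
def HasBoundedGeometry (f : Circle → Circle) (η : Set (Set Circle)) : Prop :=
  ∃ C > 0, ∀ n : ℕ, ∀ I ∈ pullbackPartition f η n, ∀ J ∈ pullbackPartition f η (n + 1),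
    J ⊆ I → C ≤ arcLength J / arcLength I

/-! ## The Markov map of a marked surface -/

/-- `H` is the boundary correspondence of the isomorphism `φ : Γ₀ → Γ_X`. -/
def IsBoundaryCorrespondence {g : ℕ} {Γ : Subgroup DiscAut} (φ : standardGroup g ≃* Γ)
    (H : Circle ≃ₜ Circle) : Prop :=
  ∀ (γ : standardGroup g) (x : Circle),
    H (boundaryMap (γ : DiscAut) x) = boundaryMap (φ γ : DiscAut) (H x)

/-- `f_X = H ∘ f₀ ∘ H⁻¹`. -/
noncomputable def surfaceMap (g : ℕ) (H : Circle ≃ₜ Circle) : Circle → Circle :=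
  H ∘ standardMap g ∘ H.symm

/-- The Markov partition `η₀` of `f_X`: the images under `H` of the arcs of that of `f₀`. -/
def surfacePartition (g : ℕ) (H : Circle ≃ₜ Circle) : Set (Set Circle) :=
  (fun I => H '' I) '' standardPartition g

end BowenSeries

/-!
The theorem is true because the standard map is a piecewise Möbius map with finitely many branches,
all expanding, which maps the finite set `W` into itself (`isBranchSystem_standardMap`), and because
these properties alone pass to every closed surface group with the same boundary dynamics.

**The standard map.** Let `r` be the rotation of the polygon by one side, `A_k` the automorphism
which carries `0` and the positive real axis to vertex `k` and the direction of side `k` (`frame`),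
and `h` the half-turn which exchanges `0` with an adjacent vertex when the polygon is moved by
`A_k⁻¹`. They satisfy `A_{k+1} = A_k h r⁻¹` (`frame_succ`), and the side pairing of side `k` is
`A_{k'} h A_k⁻¹`, `k'` being the corresponding side. The standard group acts freely on the disk:
an element with a fixed point in the disk has none on the circle, hence neither has its image in
`Γ`, which therefore has one in the disk and is trivial (`free_of_boundary_conj`). So all frames of
the net at one vertex differ by powers of `r` (`eq_mul_rot_of_smul_center_eq`), and `W` consists of
the points `A_k r^i h r^m (1)` (`mem_cutPoints_iff`). The side pairing `k` replaces `A_k` by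
`A_{k'+1} r` and `A_{k+1}` by `A_{k'} r⁻¹`, so it maps those points of `W` which are given relative
to the endpoints of side `k` into `W`; by an estimate of the angles under which the net is seen from
a vertex, the points of `W` in the closed branch arc of side `k` are of this kind
(`sidePairing_mem_cutPoints`). The side pairing expands on the part of the circle cut off by the
geodesic through side `k`, and this part contains the branch arc (`im_frame_inv_neg`,
`one_lt_dil_sidePairing`).

**Transport.** For a branch `m` of the `n`-th iterate of the standard map, let `b` be the image of
`0` under the corresponding element `M` of `Γ`. The dilatation of `M⁻¹` at a point `y` of the circle
is the Poisson kernel `(1 - |b|²) / |y - b|²` (`dil_inv_eq`). By proper discontinuity `|b|` tends to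
`1` uniformly. Moreover `b` stays away from the image under `M` of the transported partition arc of
level `n` (`exists_le_norm_sub`). Otherwise `M⁻¹` would map the complement of a small neighbourhood
of `b` to a small set, while the small neighbourhood itself is mapped to a small set since `m⁻¹`
contracts near the arc and the boundary correspondence is uniformly continuous; two small sets do
not cover the circle. So on the arc of level `n` the dilatation of `M⁻¹` is comparable to
`1 - |b|²`, which gives the expansion, after passing to a power (`exists_expandsBy`), and the
bounded geometry (`IsBranchSystem.hasBoundedGeometry`).
-/

namespace BowenSeries

open Set Real

local notation "conj" => starRingEnd ℂ

/-! ### Disk automorphisms and their boundary maps -/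

theorem normSq_denom_sub_normSq_numer (a b z : ℂ) :
    Complex.normSq (conj b * z + conj a) - Complex.normSq (a * z + b) =
      (Complex.normSq a - Complex.normSq b) * (1 - Complex.normSq z) := by
  simp [Complex.normSq_apply]; ring

theorem norm_mobius_le_one {a b z : ℂ} (h : Complex.normSq a - Complex.normSq b = 1)
    (hz : ‖z‖ ≤ 1) : ‖(a * z + b) / (conj b * z + conj a)‖ ≤ 1 := by
  rw [norm_div]
  refine div_le_one_of_le₀ ?_ (norm_nonneg _)
  have h1 := normSq_denom_sub_normSq_numer a b z
  rw [h, one_mul] at h1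
  simp only [Complex.normSq_eq_norm_sq] at h1
  refine abs_le_of_sq_le_sq' ?_ (norm_nonneg _) |>.2
  nlinarith [norm_nonneg z]

/-- The disk automorphism `z ↦ (a z + b) / (conj b z + conj a)` as a self-map of the disk. -/
noncomputable def mobiusMap (a b : ℂ) (h : Complex.normSq a - Complex.normSq b = 1)
    (z : ClosedDisc) : ClosedDisc :=
  ⟨(a * z + b) / (conj b * z + conj a),
    mem_closedBall_zero_iff.2 (norm_mobius_le_one h (closedDisc_norm_le z))⟩

theorem mobiusMap_inverse {a b : ℂ} (h : Complex.normSq a - Complex.normSq b = 1)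
    (h' : Complex.normSq (conj a) - Complex.normSq (-b) = 1) (z : ClosedDisc) :
    mobiusMap (conj a) (-b) h' (mobiusMap a b h z) = z := by
  apply Subtype.ext
  have d1 := denom_ne_zero h (closedDisc_norm_le z)
  have d2 := denom_ne_zero h' (closedDisc_norm_le (mobiusMap a b h z))
  have e := normSq_eq_one_cast h
  change (conj a * (mobiusMap a b h z : ℂ) + -b) / _ = (z : ℂ)
  rw [div_eq_iff d2]
  have e2 : (mobiusMap a b h z : ℂ) * (conj b * z + conj a) = a * z + b := div_mul_cancel₀ _ d1
  simp only [map_neg, Complex.conj_conj]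
  linear_combination e2

/-- The disk automorphism `z ↦ (a z + b) / (conj b z + conj a)`, where `|a|² - |b|² = 1`. -/
noncomputable def discAut (a b : ℂ) (h : Complex.normSq a - Complex.normSq b = 1) : DiscAut :=
  ⟨{ toFun := mobiusMap a b h
     invFun := mobiusMap (conj a) (-b) (by simpa using h)
     left_inv := mobiusMap_inverse h _
     right_inv := fun z => by
      have := mobiusMap_inverse (a := conj a) (b := -b) (by simpa using h) (by simpa using h) z
      simpa using this }, a, b, h, fun _ => rfl⟩

theorem discAut_apply (a b : ℂ) (h : Complex.normSq a - Complex.normSq b = 1) (z : ClosedDisc) :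
    (((discAut a b h : DiscAut) : Equiv.Perm ClosedDisc) z : ℂ) =
      (a * z + b) / (conj b * z + conj a) := rfl

theorem boundaryMap_coe (m : DiscAut) (x : Circle) :
    (boundaryMap m x : ℂ) = ((m : Equiv.Perm ClosedDisc) (circlePt x) : ℂ) := rfl

theorem circlePt_boundaryMap (m : DiscAut) (x : Circle) :
    circlePt (boundaryMap m x) = (m : Equiv.Perm ClosedDisc) (circlePt x) :=
  Subtype.ext rfl

theorem boundaryMap_mul (m n : DiscAut) (x : Circle) :
    boundaryMap (m * n) x = boundaryMap m (boundaryMap n x) := by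
  apply Circle.ext
  rw [boundaryMap_coe, boundaryMap_coe, circlePt_boundaryMap]
  rfl

theorem boundaryMap_one (x : Circle) : boundaryMap 1 x = x := Circle.ext rfl

theorem boundaryMap_inv_apply (m : DiscAut) (x : Circle) :
    boundaryMap m⁻¹ (boundaryMap m x) = x := by
  rw [← boundaryMap_mul, inv_mul_cancel, boundaryMap_one]

theorem boundaryMap_apply_inv (m : DiscAut) (x : Circle) :
    boundaryMap m (boundaryMap m⁻¹ x) = x := by
  rw [← boundaryMap_mul, mul_inv_cancel, boundaryMap_one]

theorem exists_coeff (m : DiscAut) : ∃ a b : ℂ, ∃ h : Complex.normSq a - Complex.normSq b = 1,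
    m = discAut a b h := by
  obtain ⟨a, b, h, hm⟩ := m.2
  refine ⟨a, b, h, Subtype.ext (Equiv.ext fun z => Subtype.ext ?_)⟩
  rw [hm, discAut_apply]

theorem boundaryMap_discAut (a b : ℂ) (h : Complex.normSq a - Complex.normSq b = 1) (x : Circle) :
    (boundaryMap (discAut a b h) x : ℂ) = (a * x + b) / (conj b * x + conj a) := rfl

theorem circle_denom_ne_zero {a b : ℂ} (h : Complex.normSq a - Complex.normSq b = 1)
    (x : Circle) :
    conj b * (x : ℂ) + conj a ≠ 0 := denom_ne_zero h (Circle.norm_coe x).le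

theorem circle_mul_conj (x : Circle) : (x : ℂ) * conj (x : ℂ) = 1 := by
  rw [Complex.mul_conj, Circle.normSq_coe]; simp

theorem circle_dist_eq (x y : Circle) : dist x y = ‖(x : ℂ) - y‖ := Complex.dist_eq _ _

theorem circle_isInducing_coe : Topology.IsInducing (fun x : Circle => (x : ℂ)) := ⟨rfl⟩

theorem continuous_boundaryMap (m : DiscAut) : Continuous (boundaryMap m) := by
  obtain ⟨a, b, h, rfl⟩ := exists_coeff m
  rw [circle_isInducing_coe.continuous_iff]
  have : ((fun x : Circle => (x : ℂ)) ∘ boundaryMap (discAut a b h)) =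
      fun x : Circle => (a * x + b) / (conj b * x + conj a) := rfl
  rw [this]
  refine Continuous.div ?_ ?_ fun x => circle_denom_ne_zero h x
  · fun_prop
  · fun_prop

/-- The boundary map of a disk automorphism as a homeomorphism of the circle. -/
noncomputable def boundaryHomeo (m : DiscAut) : Circle ≃ₜ Circle where
  toFun := boundaryMap m
  invFun := boundaryMap m⁻¹
  left_inv := boundaryMap_inv_apply m
  right_inv := boundaryMap_apply_inv m
  continuous_toFun := continuous_boundaryMap m
  continuous_invFun := continuous_boundaryMap m⁻¹

@[simp] theorem boundaryHomeo_apply (m : DiscAut) (x : Circle) :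
    boundaryHomeo m x = boundaryMap m x := rfl

theorem boundaryMap_inv_eq_iff {m : DiscAut} {x y : Circle} :
    boundaryMap m⁻¹ x = y ↔ x = boundaryMap m y :=
  (boundaryHomeo m).toEquiv.symm_apply_eq

theorem boundaryMap_injective (m : DiscAut) : Function.Injective (boundaryMap m) :=
  (boundaryHomeo m).injective

/-! ### The dilatation of a disk automorphism on the circle -/

theorem hasDerivAt_mobius_exp {a b : ℂ} (h : Complex.normSq a - Complex.normSq b = 1)
    (x : Circle) :
    HasDerivAt (fun t : ℝ => (boundaryMap (discAut a b h) (x * Circle.exp t) : ℂ))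
      (x * Complex.I / (conj b * x + conj a) ^ 2) 0 := by
  have h1 : HasDerivAt (fun t : ℝ => (x : ℂ) * Complex.exp (t * Complex.I))
      ((x : ℂ) * Complex.I) 0 := by
    have := ((hasDerivAt_id (0 : ℝ)).ofReal_comp.mul_const Complex.I).cexp.const_mul (x : ℂ)
    simpa using this
  have hd := circle_denom_ne_zero h x
  have h2 := ((h1.const_mul a).add_const b).div ((h1.const_mul (conj b)).add_const (conj a))
    (by simpa using hd)
  have e := normSq_eq_one_cast h
  simp only [Complex.ofReal_zero, zero_mul, Complex.exp_zero, mul_one] at h2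
  have e3 : (x : ℂ) * Complex.I = a * (x * Complex.I) * (conj b * x + conj a) -
      (a * x + b) * (conj b * (x * Complex.I)) := by
    linear_combination (-(x : ℂ) * Complex.I) * e
  rw [e3]
  refine h2.congr_of_eventuallyEq (Filter.Eventually.of_forall fun t => ?_)
  simp [boundaryMap_discAut]

theorem absDeriv_discAut {a b : ℂ} (h : Complex.normSq a - Complex.normSq b = 1)
    (x : Circle) : absDeriv (boundaryMap (discAut a b h)) x =
      1 / Complex.normSq (conj b * x + conj a) := by
  rw [absDeriv, (hasDerivAt_mobius_exp h x).deriv, norm_div, norm_mul, Circle.norm_coe,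
    Complex.norm_I, norm_pow, Complex.normSq_eq_norm_sq]
  simp

/-- The dilatation `|m'(x)|` of a disk automorphism at a point of the circle. -/
noncomputable def dil (m : DiscAut) (x : Circle) : ℝ := absDeriv (boundaryMap m) x

theorem dil_discAut {a b : ℂ} (h : Complex.normSq a - Complex.normSq b = 1)
    (x : Circle) : dil (discAut a b h) x = 1 / Complex.normSq (conj b * x + conj a) :=
  absDeriv_discAut h x

theorem dil_pos (m : DiscAut) (x : Circle) : 0 < dil m x := by
  obtain ⟨a, b, h, rfl⟩ := exists_coeff m
  rw [dil_discAut]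
  exact one_div_pos.2 (Complex.normSq_pos.2 (circle_denom_ne_zero h x))

theorem continuous_dil (m : DiscAut) : Continuous (dil m) := by
  obtain ⟨a, b, h, rfl⟩ := exists_coeff m
  have : dil (discAut a b h) = fun x : Circle => 1 / Complex.normSq (conj b * x + conj a) :=
    funext fun x => dil_discAut h x
  rw [this]
  refine Continuous.div continuous_const ?_ fun x =>
    (Complex.normSq_pos.2 (circle_denom_ne_zero h x)).ne'
  exact Complex.continuous_normSq.comp (by fun_prop)

/-- The chord formula: Möbius maps scale chords by the geometric mean of the dilatations. -/
theorem dist_boundaryMap_sq (m : DiscAut) (x y : Circle) :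
    dist (boundaryMap m x) (boundaryMap m y) ^ 2 = dil m x * dil m y * dist x y ^ 2 := by
  obtain ⟨a, b, h, rfl⟩ := exists_coeff m
  have hx := circle_denom_ne_zero h x
  have hy := circle_denom_ne_zero h y
  have e := normSq_eq_one_cast h
  rw [dil_discAut, dil_discAut, circle_dist_eq, circle_dist_eq]
  have : (boundaryMap (discAut a b h) x : ℂ) - boundaryMap (discAut a b h) y =
      ((x : ℂ) - y) / ((conj b * x + conj a) * (conj b * y + conj a)) := by
    rw [boundaryMap_discAut, boundaryMap_discAut, div_sub_div _ _ hx hy]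
    congr 1
    linear_combination ((x : ℂ) - y) * e
  rw [this]
  simp only [← Complex.normSq_eq_norm_sq, map_div₀, map_mul]
  field_simp

theorem discAut_ext {m n : DiscAut} (h : ∀ z : ClosedDisc,
    ((m : Equiv.Perm ClosedDisc) z : ℂ) = (n : Equiv.Perm ClosedDisc) z) : m = n :=
  Subtype.ext (Equiv.ext fun z => Subtype.ext (h z))

theorem discAut_mul {a b c d : ℂ} (h : Complex.normSq a - Complex.normSq b = 1)
    (k : Complex.normSq c - Complex.normSq d = 1) :
    ∃ l, discAut a b h * discAut c d k = discAut (a * c + b * conj d) (a * d + b * conj c) l := by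
  have hl : Complex.normSq (a * c + b * conj d) - Complex.normSq (a * d + b * conj c) = 1 := by
    have : Complex.normSq (a * c + b * conj d) - Complex.normSq (a * d + b * conj c) =
        (Complex.normSq a - Complex.normSq b) * (Complex.normSq c - Complex.normSq d) := by
      simp [Complex.normSq_apply]; ring
    rw [this, h, k, one_mul]
  refine ⟨hl, discAut_ext fun z => ?_⟩
  have d1 := denom_ne_zero k (closedDisc_norm_le z)
  have d2 := denom_ne_zero h (closedDisc_norm_le ((discAut c d k : Equiv.Perm ClosedDisc) z))
  have d3 := denom_ne_zero hl (closedDisc_norm_le z)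
  have e := (eq_div_iff d1).1 (discAut_apply c d k z)
  change ((discAut a b h : Equiv.Perm ClosedDisc)
    ((discAut c d k : Equiv.Perm ClosedDisc) z) : ℂ) = _
  rw [discAut_apply a b h, discAut_apply _ _ hl, div_eq_div_iff d2 d3]
  simp only [map_add, map_mul, Complex.conj_conj] at *
  generalize ((discAut c d k : Equiv.Perm ClosedDisc) z : ℂ) = w at *
  linear_combination (a * conj a - b * conj b) * e

theorem dil_mul (m n : DiscAut) (x : Circle) :
    dil (m * n) x = dil m (boundaryMap n x) * dil n x := by
  obtain ⟨a, b, h, rfl⟩ := exists_coeff m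
  obtain ⟨c, d, k, rfl⟩ := exists_coeff n
  obtain ⟨l, hl⟩ := discAut_mul h k
  have d1 := circle_denom_ne_zero k x
  have d2 := circle_denom_ne_zero h (boundaryMap (discAut c d k) x)
  have e := (eq_div_iff d1).1 (boundaryMap_discAut c d k x)
  rw [hl, dil_discAut, dil_discAut, dil_discAut, one_div_mul_one_div, ← map_mul]
  congr 2
  simp only [map_add, map_mul, Complex.conj_conj]
  linear_combination -conj b * e

theorem dil_one (x : Circle) : dil 1 x = 1 := by
  have h := dil_mul 1 1 x
  rw [one_mul, boundaryMap_one] at h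
  have := dil_pos 1 x
  nlinarith [mul_right_cancel₀ this.ne' (h.symm.trans (one_mul (dil 1 x)).symm)]

theorem dil_inv (m : DiscAut) (x : Circle) : dil m⁻¹ x = 1 / dil m (boundaryMap m⁻¹ x) := by
  have h := dil_mul m m⁻¹ x
  rw [mul_inv_cancel, dil_one] at h
  rw [eq_div_iff (dil_pos _ _).ne', mul_comm, ← h]

/-- The centre of the closed disk. -/
def discCenter : ClosedDisc := ⟨0, by simp⟩

theorem apply_discCenter (a b : ℂ) (h : Complex.normSq a - Complex.normSq b = 1) :
    ((discAut a b h : Equiv.Perm ClosedDisc) discCenter : ℂ) = b / conj a := by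
  rw [discAut_apply]; simp [discCenter]

/-- The dilatation of the inverse is the Poisson kernel of the image of the centre. -/
theorem dil_inv_eq (m : DiscAut) (y : Circle) :
    dil m⁻¹ y = (1 - ‖((m : Equiv.Perm ClosedDisc) discCenter : ℂ)‖ ^ 2) /
      ‖(y : ℂ) - (m : Equiv.Perm ClosedDisc) discCenter‖ ^ 2 := by
  obtain ⟨a, b, h, rfl⟩ := exists_coeff m
  have hy := circle_mul_conj y
  have d := circle_denom_ne_zero h (boundaryMap (discAut a b h)⁻¹ y)
  set x := boundaryMap (discAut a b h)⁻¹ y with hx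
  have hxy : y = boundaryMap (discAut a b h) x := (boundaryMap_apply_inv _ y).symm
  have e := (eq_div_iff d).1 (hxy ▸ boundaryMap_discAut a b h x)
  have hc := normSq_eq_one_cast h
  have ha : conj a ≠ 0 := by
    intro h0
    have : a = 0 := by simpa using h0
    rw [this] at h
    simp only [map_zero, zero_sub] at h
    linarith [Complex.normSq_nonneg b]
  rw [dil_inv, ← hx, dil_discAut, apply_discCenter, one_div_one_div]
  have e1 : (y : ℂ) - b / conj a = x / (conj a * (conj b * x + conj a)) := by
    rw [sub_eq_iff_eq_add, div_add_div _ _ (mul_ne_zero ha d) ha, eq_div_iff (by simp [ha, d])]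
    linear_combination (conj a * conj a) * e + x * conj a * hc
  rw [e1, ← Complex.normSq_eq_norm_sq, ← Complex.normSq_eq_norm_sq]
  have hna : Complex.normSq a ≠ 0 := by simpa using ha
  have hnd := (Complex.normSq_pos.2 d).ne'
  simp only [map_div₀, map_mul, Complex.normSq_conj, Circle.normSq_coe]
  field_simp
  linarith

theorem norm_apply_lt_one (m : DiscAut) {z : ClosedDisc} (hz : ‖(z : ℂ)‖ < 1) :
    ‖((m : Equiv.Perm ClosedDisc) z : ℂ)‖ < 1 := by
  obtain ⟨a, b, h, rfl⟩ := exists_coeff m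
  have d := denom_ne_zero h (closedDisc_norm_le z)
  rw [discAut_apply, norm_div, div_lt_one (norm_pos_iff.2 d)]
  have h1 := normSq_denom_sub_normSq_numer a b z
  rw [h, one_mul] at h1
  simp only [Complex.normSq_eq_norm_sq] at h1
  refine lt_of_pow_lt_pow_left₀ 2 (norm_nonneg _) ?_
  nlinarith [norm_nonneg (z : ℂ)]

theorem norm_apply_center_lt (m : DiscAut) :
    ‖((m : Equiv.Perm ClosedDisc) discCenter : ℂ)‖ < 1 :=
  norm_apply_lt_one m (by simp [discCenter])

theorem dil_inv_le {m : DiscAut} {δ : ℝ} (hδ : 0 < δ) {y : Circle}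
    (hy : δ ≤ ‖(y : ℂ) - (m : Equiv.Perm ClosedDisc) discCenter‖) :
    dil m⁻¹ y ≤ (1 - ‖((m : Equiv.Perm ClosedDisc) discCenter : ℂ)‖ ^ 2) / δ ^ 2 := by
  rw [dil_inv_eq]
  have h := norm_apply_center_lt m
  exact div_le_div_of_nonneg_left
    (by nlinarith [norm_nonneg ((m : Equiv.Perm ClosedDisc) discCenter : ℂ)])
    (by positivity) (pow_le_pow_left₀ hδ.le hy 2)

theorem le_dil_inv (m : DiscAut) (y : Circle) :
    (1 - ‖((m : Equiv.Perm ClosedDisc) discCenter : ℂ)‖ ^ 2) / 4 ≤ dil m⁻¹ y := by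
  have h := norm_apply_center_lt m
  have h2 : ‖(y : ℂ) - (m : Equiv.Perm ClosedDisc) discCenter‖ ≤ 2 := by
    refine (norm_sub_le _ _).trans ?_
    rw [Circle.norm_coe]; linarith
  have h3 : 0 < ‖(y : ℂ) - (m : Equiv.Perm ClosedDisc) discCenter‖ := by
    have := norm_sub_norm_le (y : ℂ) ((m : Equiv.Perm ClosedDisc) discCenter)
    rw [Circle.norm_coe] at this
    linarith
  rw [dil_inv_eq]
  refine div_le_div_of_nonneg_left
    (by nlinarith [norm_nonneg ((m : Equiv.Perm ClosedDisc) discCenter : ℂ)]) (by positivity) ?_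
  nlinarith

theorem dist_le_of_dil_le {m : DiscAut} {l : ℝ} {x y : Circle} (hl : 0 ≤ l) (hx : dil m x ≤ l)
    (hy : dil m y ≤ l) : dist (boundaryMap m x) (boundaryMap m y) ≤ l * dist x y := by
  refine abs_le_of_sq_le_sq' ?_ (by positivity) |>.2
  rw [dist_boundaryMap_sq, mul_pow]
  refine mul_le_mul_of_nonneg_right ?_ (by positivity)
  rw [sq]
  exact mul_le_mul hx hy (dil_pos m y).le hl

theorem le_dist_of_le_dil {m : DiscAut} {l : ℝ} {x y : Circle} (hl : 0 ≤ l) (hx : l ≤ dil m x)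
    (hy : l ≤ dil m y) : l * dist x y ≤ dist (boundaryMap m x) (boundaryMap m y) := by
  refine abs_le_of_sq_le_sq' ?_ (by positivity) |>.2
  rw [dist_boundaryMap_sq, mul_pow]
  refine mul_le_mul_of_nonneg_right ?_ (by positivity)
  rw [sq]
  exact mul_le_mul hx hy hl (dil_pos m x).le

/-! ### Arcs of the circle -/

theorem isOpen_exp_Ioo (l u : ℝ) : IsOpen (Circle.exp '' Ioo l u) :=
  isLocalHomeomorph_circleExp.isOpenMap _ isOpen_Ioo

theorem isClosed_exp_Icc (l u : ℝ) : IsClosed (Circle.exp '' Icc l u) :=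
  (isCompact_Icc.image Circle.exp.continuous).isClosed

theorem closure_exp_Ioo {l u : ℝ} (h : l < u) :
    closure (Circle.exp '' Ioo l u) = Circle.exp '' Icc l u := by
  refine Subset.antisymm ((isClosed_exp_Icc l u).closure_subset_iff.2
    (image_mono Ioo_subset_Icc_self)) ?_
  rw [← closure_Ioo h.ne]
  exact image_closure_subset_closure_image Circle.exp.continuous

theorem compl_exp_Icc {l u : ℝ} (h : l ≤ u) (h' : u < l + 2 * π) :
    (Circle.exp '' Icc l u)ᶜ = Circle.exp '' Ioo u (l + 2 * π) := by
  have hinj := Circle.exp_injOn_Ico (a := l) (b := l + 2 * π) (by simp)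
  apply Subset.antisymm
  · intro x hx
    obtain ⟨t, rfl⟩ := Circle.exp_surjective x
    obtain ⟨s, hs, hst⟩ := Circle.periodic_exp.exists_mem_Ico (by positivity) t l
    rw [hst] at hx ⊢
    refine ⟨s, ⟨?_, hs.2⟩, rfl⟩
    by_contra hsu
    exact hx ⟨s, ⟨hs.1, not_lt.1 hsu⟩, rfl⟩
  · rintro _ ⟨t, ht, rfl⟩ ⟨s, hs, hst⟩
    have := hinj ⟨hs.1, hs.2.trans_lt h'⟩ ⟨h.trans ht.1.le, ht.2⟩ hst
    linarith [hs.2, ht.1]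

theorem interior_exp_Icc {l u : ℝ} (h : l ≤ u) (h' : u < l + 2 * π) :
    interior (Circle.exp '' Icc l u) = Circle.exp '' Ioo l u := by
  have h3 : (Circle.exp '' Icc u (l + 2 * π))ᶜ = Circle.exp '' Ioo l u := by
    have h0 : l + 2 * π < u + 2 * π ∨ l = u := by
      rcases h.lt_or_eq with h | h
      · left; linarith
      · exact Or.inr h
    rcases h0 with h0 | rfl
    · rw [compl_exp_Icc h'.le h0]
      apply Subset.antisymm
      · rintro _ ⟨t, ht, rfl⟩
        exact ⟨t - 2 * π, ⟨by linarith [ht.1], by linarith [ht.2]⟩, Circle.exp_sub_two_pi t⟩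
      · rintro _ ⟨t, ht, rfl⟩
        exact ⟨t + 2 * π, ⟨by linarith [ht.1], by linarith [ht.2]⟩, Circle.exp_add_two_pi t⟩
    · rw [Ioo_self, image_empty, compl_empty_iff, eq_univ_iff_forall]
      intro x
      obtain ⟨t, rfl⟩ := Circle.exp_surjective x
      obtain ⟨s, hs, hst⟩ := Circle.periodic_exp.exists_mem_Ico (by positivity) t l
      exact ⟨s, Ico_subset_Icc_self hs, hst.symm⟩
  rw [← compl_compl (Circle.exp '' Icc l u), interior_compl, compl_exp_Icc h h',
    closure_exp_Ioo h', h3]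

/-- A nondegenerate continuum in the circle, other than the circle, is an arc. -/
theorem exists_exp_Icc_of_isConnected {K : Set Circle} (hc : IsCompact K) (hK : IsConnected K)
    (hn : K.Nontrivial) (hu : K ≠ univ) : IsClosedArc K := by
  obtain ⟨p, hp⟩ := (ne_univ_iff_exists_notMem K).1 hu
  obtain ⟨c, hcp⟩ := Circle.exp_surjective (-p)
  -- `-p` is turned to `1`, so that the argument is continuous on the turned copy of `K`
  let F : Circle → ℝ := fun x => Complex.arg ((x * Circle.exp (-c) : Circle) : ℂ)
  have hF : ∀ x, Circle.exp (c + F x) = x := by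
    intro x
    rw [Circle.exp_add, Circle.exp_arg, mul_left_comm, ← Circle.exp_add]; simp
  have hslit : ∀ x ∈ K, ((x * Circle.exp (-c) : Circle) : ℂ) ∈ Complex.slitPlane := by
    intro x hx
    rw [Complex.mem_slitPlane_iff_arg]
    refine ⟨fun h => hp ?_, by simp⟩
    have h1 := hF x
    rw [show F x = π from h, Circle.exp_add, hcp] at h1
    have h2 : Circle.exp π = -1 := by
      ext; simp
    rw [h2] at h1
    have : x = p := by rw [← h1]; simp
    rwa [← this]
  have hFc : ContinuousOn F K := by
    intro x hx
    refine ContinuousAt.continuousWithinAt ?_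
    refine ContinuousAt.comp (g := Complex.arg)
      (f := fun x : Circle => ((x * Circle.exp (-c) : Circle) : ℂ))
      (Complex.continuousAt_arg (hslit x hx)) ?_
    exact (by fun_prop : Continuous fun x : Circle =>
      ((x * Circle.exp (-c) : Circle) : ℂ)).continuousAt
  have hI := eq_Icc_of_connected_compact (hK.image F hFc) (hc.image_of_continuousOn hFc)
  set a := sInf (F '' K)
  set b := sSup (F '' K)
  have hKe : K = (fun t => Circle.exp (c + t)) '' Icc a b := by
    rw [← hI, image_image]
    simp only [hF, image_id']
  have hab : a < b := by
    by_contra hab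
    obtain ⟨x, hx, y, hy, hxy⟩ := hn
    have hx' : F x ∈ Icc a b := hI ▸ mem_image_of_mem F hx
    have hy' : F y ∈ Icc a b := hI ▸ mem_image_of_mem F hy
    apply hxy
    rw [← hF x, ← hF y, show F x = F y by linarith [hx'.1, hx'.2, hy'.1, hy'.2]]
  have hbd : ∀ t ∈ Icc a b, -π < t ∧ t < π := by
    rw [← hI]
    rintro _ ⟨x, hx, rfl⟩
    refine ⟨Complex.neg_pi_lt_arg _, lt_of_le_of_ne (Complex.arg_le_pi _) ?_⟩
    exact ((Complex.mem_slitPlane_iff_arg.1 (hslit x hx)).1)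
  have h1 := hbd a ⟨le_rfl, hab.le⟩
  have h2 := hbd b ⟨hab.le, le_rfl⟩
  refine ⟨c + a, c + b, by linarith, by linarith, ?_⟩
  rw [hKe, ← image_const_add_Icc c a b, image_image]

theorem IsClosedArc.image {K : Set Circle} (h : IsClosedArc K) (H : Circle ≃ₜ Circle) :
    IsClosedArc (H '' K) := by
  obtain ⟨a, b, hab, hb, rfl⟩ := h
  have hK : IsCompact (Circle.exp '' Icc a b) := isCompact_Icc.image Circle.exp.continuous
  refine exists_exp_Icc_of_isConnected (hK.image H.continuous)
    (((isConnected_Icc hab.le).image _ Circle.exp.continuous.continuousOn).image _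
      H.continuous.continuousOn) ?_ ?_
  · refine Nontrivial.image ?_ H.injective
    refine ⟨_, ⟨a, ⟨le_rfl, hab.le⟩, rfl⟩, _, ⟨b, ⟨hab.le, le_rfl⟩, rfl⟩, fun h => ?_⟩
    exact hab.ne (Circle.exp_injOn_Icc (by linarith) ⟨le_rfl, hab.le⟩ ⟨hab.le, le_rfl⟩ h)
  · intro h
    have h1 : Circle.exp '' Icc a b = univ := by
      rw [← H.injective.image_injective.eq_iff, h, image_univ, H.surjective.range_eq]
    have h2 := compl_exp_Icc hab.le hb
    rw [h1, compl_univ] at h2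
    exact (nonempty_Ioo.2 hb).image Circle.exp |>.ne_empty h2.symm

theorem dist_exp (s t : ℝ) :
    dist (Circle.exp s) (Circle.exp t) = 2 * |sin ((s - t) / 2)| := by
  have h : (Circle.exp s : ℂ) - Circle.exp t =
      Circle.exp t * (Complex.exp (Complex.I * (s - t : ℝ)) - 1) := by
    rw [mul_sub, mul_one, Circle.coe_exp, Circle.coe_exp, ← Complex.exp_add]
    congr 2
    push_cast; ring
  rw [circle_dist_eq, h, norm_mul, Circle.norm_coe, one_mul,
    Complex.norm_exp_I_mul_ofReal_sub_one, norm_mul, Real.norm_eq_abs, Real.norm_eq_abs]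
  norm_num

/-- In every colouring of the circle with two colours, two points of the same colour are far apart:
consider three equidistant points. -/
theorem exists_dist_lt (f : Circle → Bool) : ∃ x y, f x = f y ∧ 1 < dist x y := by
  have h : ∀ s t : ℝ, dist (Circle.exp s) (Circle.exp t) = 2 * |sin ((s - t) / 2)| := dist_exp
  have hs : 1 / 2 < sin (π / 3) := by
    rw [sin_pi_div_three]
    have : (1 : ℝ) < √3 := by rw [Real.lt_sqrt] <;> norm_num
    linarith
  have h1 : 1 < dist (Circle.exp (2 * π / 3)) (Circle.exp 0) := by
    rw [h, show (2 * π / 3 - 0) / 2 = π / 3 by ring]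
    linarith [le_abs_self (sin (π / 3))]
  have h2 : 1 < dist (Circle.exp 0) (Circle.exp (-(2 * π / 3))) := by
    rw [h, show (0 - -(2 * π / 3)) / 2 = π / 3 by ring]
    linarith [le_abs_self (sin (π / 3))]
  have h3 : 1 < dist (Circle.exp (2 * π / 3)) (Circle.exp (-(2 * π / 3))) := by
    rw [h, show (2 * π / 3 - -(2 * π / 3)) / 2 = π - π / 3 by ring, sin_pi_sub]
    linarith [le_abs_self (sin (π / 3))]
  cases ha : f (Circle.exp (2 * π / 3)) <;> cases hb : f (Circle.exp 0) <;>
    cases hc : f (Circle.exp (-(2 * π / 3))) <;>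
    first
    | exact ⟨_, _, ha.trans hb.symm, h1⟩
    | exact ⟨_, _, hb.trans hc.symm, h2⟩
    | exact ⟨_, _, ha.trans hc.symm, h3⟩

theorem arcLength_exp_Icc {a b : ℝ} (hab : a < b) (hb : b < a + 2 * π) :
    arcLength (Circle.exp '' Icc a b) = b - a := by
  -- the length of the arc can be measured in any period, in particular in `(a, a + 2π]`
  have hmeas : ∀ c : ℝ, MeasurableSet {t : ℝ | t ∈ Ioc c (c + 2 * π) ∧
      Circle.exp t ∈ Circle.exp '' Icc a b} := fun c =>
    measurableSet_Ioc.inter ((isClosed_exp_Icc a b).preimage Circle.exp.continuous).measurableSet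
  have key : ∀ c : ℝ, (MeasureTheory.volume {t : ℝ | t ∈ Ioc c (c + 2 * π) ∧
      Circle.exp t ∈ Circle.exp '' Icc a b}).toReal =
      ∫ t in c..c + 2 * π, indicator (Circle.exp ⁻¹' (Circle.exp '' Icc a b)) 1 t := by
    intro c
    rw [intervalIntegral.integral_of_le (by linarith [pi_pos]),
      MeasureTheory.integral_indicator_one
        ((isClosed_exp_Icc a b).preimage Circle.exp.continuous).measurableSet,
      MeasureTheory.measureReal_def, MeasureTheory.Measure.restrict_apply
        ((isClosed_exp_Icc a b).preimage Circle.exp.continuous).measurableSet, inter_comm]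
    rfl
  have hper : Function.Periodic (indicator (Circle.exp ⁻¹' (Circle.exp '' Icc a b))
      (1 : ℝ → ℝ)) (2 * π) := by
    intro t
    by_cases h : Circle.exp t ∈ Circle.exp '' Icc a b
    · rw [indicator_of_mem (by simpa using h), indicator_of_mem (by simpa using h)]; rfl
    · rw [indicator_of_notMem (by simpa using h), indicator_of_notMem (by simpa using h)]
  have h1 : arcLength (Circle.exp '' Icc a b) = (MeasureTheory.volume {t : ℝ |
      t ∈ Ioc a (a + 2 * π) ∧ Circle.exp t ∈ Circle.exp '' Icc a b}).toReal := by
    rw [key a, hper.intervalIntegral_add_eq a (-π), ← key, arcLength,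
      show -π + 2 * π = π by ring]
  have h2 : {t : ℝ | t ∈ Ioc a (a + 2 * π) ∧ Circle.exp t ∈ Circle.exp '' Icc a b} =
      insert (a + 2 * π) (Ioc a b) := by
    ext t
    constructor
    · rintro ⟨ht, s, hs, hst⟩
      rcases ht.2.eq_or_lt with h | h
      · exact Or.inl h
      · have := Circle.exp_injOn_Ico (a := a) (b := a + 2 * π) (by simp)
          ⟨hs.1, hs.2.trans_lt hb⟩ ⟨ht.1.le, h⟩ hst
        exact Or.inr ⟨ht.1, this ▸ hs.2⟩
    · rintro (rfl | ht)
      · exact ⟨⟨by linarith [pi_pos], le_rfl⟩, a, ⟨le_rfl, hab.le⟩,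
          (Circle.exp_add_two_pi a).symm⟩
      · exact ⟨⟨ht.1, ht.2.trans hb.le⟩, t, ⟨ht.1.le, ht.2⟩, rfl⟩
  rw [h1, h2, MeasureTheory.measure_congr (MeasureTheory.insert_ae_eq_self _ _), Real.volume_Ioc,
    ENNReal.toReal_ofReal (by linarith)]

theorem IsClosedArc.dist_le_arcLength {K : Set Circle} (h : IsClosedArc K) {x y : Circle}
    (hx : x ∈ K) (hy : y ∈ K) : dist x y ≤ arcLength K := by
  obtain ⟨a, b, hab, hb, rfl⟩ := h
  rw [arcLength_exp_Icc hab hb]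
  obtain ⟨s, hs, rfl⟩ := hx
  obtain ⟨t, ht, rfl⟩ := hy
  rw [dist_exp]
  have h1 : |sin ((s - t) / 2)| ≤ |(s - t) / 2| := abs_sin_le_abs
  have h2 : |(s - t) / 2| ≤ (b - a) / 2 :=
    abs_le.2 ⟨by linarith [hs.1, ht.2], by linarith [hs.2, ht.1]⟩
  linarith

theorem IsClosedArc.exists_arcLength_le {K : Set Circle} (h : IsClosedArc K) :
    ∃ x ∈ K, ∃ y ∈ K, arcLength K ≤ π * dist x y := by
  obtain ⟨a, b, hab, hb, rfl⟩ := h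
  rw [arcLength_exp_Icc hab hb]
  rcases le_total (b - a) π with h | h
  · refine ⟨_, ⟨b, ⟨hab.le, le_rfl⟩, rfl⟩, _, ⟨a, ⟨le_rfl, hab.le⟩, rfl⟩, ?_⟩
    rw [dist_exp]
    have h1 := mul_le_sin (x := (b - a) / 2) (by linarith) (by linarith)
    have h2 := le_abs_self (sin ((b - a) / 2))
    have h3 : b - a = π * (2 / π * ((b - a) / 2)) := by field_simp
    have h4 : π * (2 / π * ((b - a) / 2)) ≤ π * (2 * |sin ((b - a) / 2)|) :=
      mul_le_mul_of_nonneg_left (by linarith [abs_nonneg (sin ((b - a) / 2))]) pi_pos.le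
    linarith
  · refine ⟨_, ⟨a + π, ⟨by linarith [pi_pos], by linarith⟩, rfl⟩, _, ⟨a, ⟨le_rfl, hab.le⟩, rfl⟩, ?_⟩
    rw [dist_exp, add_sub_cancel_left, sin_pi_div_two]
    norm_num
    linarith

theorem IsClosedArc.arcLength_pos {K : Set Circle} (h : IsClosedArc K) : 0 < arcLength K := by
  obtain ⟨a, b, hab, hb, rfl⟩ := h
  rw [arcLength_exp_Icc hab hb]
  linarith

theorem IsClosedArc.nontrivial {K : Set Circle} (h : IsClosedArc K) : K.Nontrivial := by
  obtain ⟨a, b, hab, hb, rfl⟩ := h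
  refine ⟨_, ⟨a, ⟨le_rfl, hab.le⟩, rfl⟩, _, ⟨b, ⟨hab.le, le_rfl⟩, rfl⟩, fun h => ?_⟩
  exact hab.ne (Circle.exp_injOn_Icc (by linarith) ⟨le_rfl, hab.le⟩ ⟨hab.le, le_rfl⟩ h)

/-! ### The arcs cut out by a finite set -/

/-- A preconnected set which meets an open set, but not its frontier, lies in it. -/
theorem subset_of_isPreconnected {X : Type*} [TopologicalSpace X] {C O : Set X}
    (hC : IsPreconnected C) (hO : IsOpen O) (hne : (C ∩ O).Nonempty)
    (hd : ∀ x ∈ C, x ∈ closure O → x ∈ O) : C ⊆ O := by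
  refine hC.subset_left_of_subset_union hO (isClosed_closure (s := O)).isOpen_compl
    (disjoint_left.2 fun x hx hx' => hx' (subset_closure hx)) (fun x hx => ?_) hne
  by_cases h : x ∈ closure O
  · exact Or.inl (hd x hx h)
  · exact Or.inr h

/-- `exp` maps the interval `(l, u)` onto a component of the complement of the subset `W` of the
circle. -/
structure IsGap (W : Set Circle) (l u : ℝ) : Prop where
  lt : l < u
  lt_two_pi : u < l + 2 * π
  left_mem : Circle.exp l ∈ W
  right_mem : Circle.exp u ∈ W
  notMem : ∀ s ∈ Ioo l u, Circle.exp s ∉ W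

theorem exists_isGap {W : Set Circle} (hW : W.Finite) (hn : W.Nontrivial) {x : Circle}
    (hx : x ∉ W) : ∃ l u : ℝ, IsGap W l u ∧ x ∈ Circle.exp '' Ioo l u := by
  obtain ⟨t, rfl⟩ := Circle.exp_surjective x
  have hS : IsClosed (Circle.exp ⁻¹' W) := hW.isClosed.preimage Circle.exp.continuous
  have hpi : 0 < 2 * π := by positivity
  have hper := Circle.periodic_exp
  have hex : ∀ w : Circle, ∀ c : ℝ, ∃ s ∈ Ico c (c + 2 * π), Circle.exp s = w := by
    intro w c
    obtain ⟨s, rfl⟩ := Circle.exp_surjective w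
    obtain ⟨s', hs', h⟩ := hper.exists_mem_Ico hpi s c
    exact ⟨s', hs', h.symm⟩
  obtain ⟨w, hw⟩ := hn.nonempty
  have hl := (hS.inter isClosed_Iic).csSup_mem (s := Circle.exp ⁻¹' W ∩ Iic t) (by
    obtain ⟨s, hs, h⟩ := hex w (t - 2 * π)
    exact ⟨s, by rw [mem_preimage, h]; exact hw, by have := hs.2; simp at this; exact this.le⟩)
    ⟨t, fun s hs => hs.2⟩
  have hu := (hS.inter isClosed_Ici).csInf_mem (s := Circle.exp ⁻¹' W ∩ Ici t) (by
    obtain ⟨s, hs, h⟩ := hex w t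
    exact ⟨s, by rw [mem_preimage, h]; exact hw, hs.1⟩) ⟨t, fun s hs => hs.2⟩
  have hl2 : ∀ s, Circle.exp s ∈ W → s ≤ t → s ≤ sSup (Circle.exp ⁻¹' W ∩ Iic t) :=
    fun s hs hst => le_csSup ⟨t, fun s hs => hs.2⟩ ⟨hs, hst⟩
  have hu2 : ∀ s, Circle.exp s ∈ W → t ≤ s → sInf (Circle.exp ⁻¹' W ∩ Ici t) ≤ s :=
    fun s hs hst => csInf_le ⟨t, fun s hs => hs.2⟩ ⟨hs, hst⟩
  generalize sSup (Circle.exp ⁻¹' W ∩ Iic t) = l at *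
  generalize sInf (Circle.exp ⁻¹' W ∩ Ici t) = u at *
  have hlt : l < t := lt_of_le_of_ne hl.2 (by rintro rfl; exact hx hl.1)
  have htu : t < u := lt_of_le_of_ne hu.2 (by rintro rfl; exact hx hu.1)
  have hgap : ∀ s ∈ Ioo l u, Circle.exp s ∉ W := by
    intro s hs h
    rcases le_total s t with h' | h'
    · exact (hl2 s h h').not_gt hs.1
    · exact (hu2 s h h').not_gt hs.2
  refine ⟨l, u, ⟨hlt.trans htu, ?_, hl.1, hu.1, hgap⟩, t, ⟨hlt, htu⟩, rfl⟩
  obtain ⟨w', hw', hne⟩ := hn.exists_ne (Circle.exp l)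
  obtain ⟨s, hs, h⟩ := hex w' l
  have hsl : s ≠ l := by rintro rfl; exact hne h.symm
  by_contra hcon
  exact hgap s ⟨lt_of_le_of_ne hs.1 hsl.symm, by linarith [hs.2]⟩ (h ▸ hw')

theorem IsGap.connectedComponentIn_eq {W : Set Circle} {l u : ℝ} (h : IsGap W l u) {x : Circle}
    (hx : x ∈ Circle.exp '' Ioo l u) :
    connectedComponentIn Wᶜ x = Circle.exp '' Ioo l u := by
  have hsub : Circle.exp '' Ioo l u ⊆ Wᶜ := by
    rintro _ ⟨s, hs, rfl⟩; exact h.notMem s hs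
  refine Subset.antisymm ?_ ((isPreconnected_Ioo.image _
    Circle.exp.continuous.continuousOn).subset_connectedComponentIn hx hsub)
  refine subset_of_isPreconnected isPreconnected_connectedComponentIn (isOpen_exp_Ioo l u)
    ⟨x, mem_connectedComponentIn (hsub hx), hx⟩ fun y hy hy' => ?_
  have hyW := connectedComponentIn_subset _ _ hy
  rw [closure_exp_Ioo h.lt] at hy'
  obtain ⟨s, hs, rfl⟩ := hy'
  refine ⟨s, ⟨lt_of_le_of_ne hs.1 ?_, lt_of_le_of_ne hs.2 ?_⟩, rfl⟩
  · rintro rfl; exact hyW h.left_mem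
  · rintro rfl; exact hyW h.right_mem

theorem IsGap.right_eq {W : Set Circle} {l u u' : ℝ} (h : IsGap W l u) (h' : IsGap W l u') :
    u = u' := by
  by_contra hne
  rcases lt_or_gt_of_ne hne with hlt | hlt
  · exact h'.notMem u ⟨h.lt, hlt⟩ h.right_mem
  · exact h.notMem u' ⟨h'.lt, hlt⟩ h'.right_mem

theorem IsGap.add_int_mul {W : Set Circle} {l u : ℝ} (h : IsGap W l u) (m : ℤ) :
    IsGap W (l + m * (2 * π)) (u + m * (2 * π)) where
  lt := by linarith [h.lt]
  lt_two_pi := by linarith [h.lt_two_pi]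
  left_mem := by rw [Circle.exp_eq_exp.2 ⟨m, rfl⟩]; exact h.left_mem
  right_mem := by rw [Circle.exp_eq_exp.2 ⟨m, rfl⟩]; exact h.right_mem
  notMem s hs := by
    rw [Circle.exp_eq_exp.2 ⟨m, (sub_add_cancel s (m * (2 * π))).symm⟩]
    exact h.notMem _ ⟨by linarith [hs.1], by linarith [hs.2]⟩

/-- The closed arcs into which a set `W` cuts the circle. -/
def cutArcs (W : Set Circle) : Set (Set Circle) :=
  {I | ∃ x ∉ W, I = closure (connectedComponentIn Wᶜ x)}

theorem exists_isGap_of_mem_cutArcs {W : Set Circle} (hW : W.Finite) (hn : W.Nontrivial)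
    {I : Set Circle} (hI : I ∈ cutArcs W) :
    ∃ l u : ℝ, IsGap W l u ∧ I = Circle.exp '' Icc l u := by
  obtain ⟨x, hx, rfl⟩ := hI
  obtain ⟨l, u, h, hxl⟩ := exists_isGap hW hn hx
  exact ⟨l, u, h, by rw [h.connectedComponentIn_eq hxl, closure_exp_Ioo h.lt]⟩

theorem isClosedArc_of_mem_cutArcs {W : Set Circle} (hW : W.Finite) (hn : W.Nontrivial)
    {I : Set Circle} (hI : I ∈ cutArcs W) : IsClosedArc I := by
  obtain ⟨l, u, h, rfl⟩ := exists_isGap_of_mem_cutArcs hW hn hI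
  exact ⟨l, u, h.lt, h.lt_two_pi, rfl⟩

theorem finite_cutArcs {W : Set Circle} (hW : W.Finite) (hn : W.Nontrivial) :
    (cutArcs W).Finite := by
  choose! l u h hI using fun I (hI : I ∈ cutArcs W) => exists_isGap_of_mem_cutArcs hW hn hI
  -- an arc is determined by its clockwise endpoint
  refine Finite.of_injOn (f := fun I => Circle.exp (l I)) (fun I hI' => (h I hI').left_mem) ?_ hW
  intro I hI1 J hJ hIJ
  obtain ⟨m, hm⟩ := Circle.exp_eq_exp.1 hIJ
  have h1 := (h J hJ).add_int_mul m
  rw [← hm] at h1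
  have h2 := (h I hI1).right_eq h1
  rw [hI I hI1, hI J hJ, h2, hm, ← image_add_const_Icc, image_image]
  exact image_congr fun s _ => Circle.exp_eq_exp.2 ⟨m, rfl⟩

theorem interior_closure_connectedComponentIn {W : Set Circle} (hW : W.Finite)
    (hn : W.Nontrivial) {x : Circle} (hx : x ∉ W) :
    interior (closure (connectedComponentIn Wᶜ x)) = connectedComponentIn Wᶜ x := by
  obtain ⟨l, u, h, hxl⟩ := exists_isGap hW hn hx
  rw [h.connectedComponentIn_eq hxl, closure_exp_Ioo h.lt,
    interior_exp_Icc h.lt.le h.lt_two_pi]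

theorem isOpen_component {W : Set Circle} (hW : W.Finite)
    (hn : W.Nontrivial) {x : Circle} (hx : x ∉ W) : IsOpen (connectedComponentIn Wᶜ x) := by
  rw [← interior_closure_connectedComponentIn hW hn hx]
  exact isOpen_interior

/-- The points of a closed complementary arc of `W` which are not in `W` lie in the open arc. -/
theorem mem_component_of_mem_closure {W : Set Circle} {x y : Circle}
    (hW : W.Finite) (hn : W.Nontrivial)
    (hy : y ∈ closure (connectedComponentIn Wᶜ x)) (hyW : y ∉ W) :
    y ∈ connectedComponentIn Wᶜ x := by
  have ho := isOpen_component hW hn hyW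
  obtain ⟨z, hz, hz'⟩ := mem_closure_iff.1 hy _ ho (mem_connectedComponentIn hyW)
  rw [connectedComponentIn_eq hz', ← connectedComponentIn_eq hz]
  exact mem_connectedComponentIn hyW

theorem dense_compl_of_finite {W : Set Circle} (hW : W.Finite) : Dense Wᶜ := by
  have : Nontrivial Circle := ⟨1, -1, (Circle.neg_ne_self 1).symm⟩
  rw [compl_eq_univ_sdiff]
  exact dense_univ.sdiff_finite hW

theorem exists_component_of_mem_closure {W : Set Circle} (hW : W.Finite) (hn : W.Nontrivial)
    {S : Set Circle} (hS : IsOpen S) {x : Circle} (hx : x ∈ closure S) :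
    ∃ y ∈ S, y ∉ W ∧ x ∈ closure (connectedComponentIn Wᶜ y) := by
  have h1 : S ∩ Wᶜ ⊆ ⋃ I ∈ {I ∈ cutArcs W | ∃ y ∈ S, y ∉ W ∧
      I = closure (connectedComponentIn Wᶜ y)}, I := by
    rintro y ⟨hy, hyW⟩
    exact mem_biUnion (x := closure (connectedComponentIn Wᶜ y)) ⟨⟨y, hyW, rfl⟩, y, hy, hyW, rfl⟩
      (subset_closure (mem_connectedComponentIn hyW))
  have h2 : IsClosed (⋃ I ∈ {I ∈ cutArcs W | ∃ y ∈ S, y ∉ W ∧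
      I = closure (connectedComponentIn Wᶜ y)}, I) := by
    refine ((finite_cutArcs hW hn).subset (sep_subset _ _)).isClosed_biUnion ?_
    rintro I ⟨⟨z, _, rfl⟩, -⟩
    exact isClosed_closure
  have h3 := (h2.closure_subset_iff.2 h1) (closure_minimal
    ((dense_compl_of_finite hW).open_subset_closure_inter hS) isClosed_closure hx)
  simp only [mem_iUnion] at h3
  obtain ⟨I, ⟨-, y, hy, hyW, rfl⟩, hxI⟩ := h3
  exact ⟨y, hy, hyW, hxI⟩

theorem sUnion_cutArcs {W : Set Circle} (hW : W.Finite) (hn : W.Nontrivial) :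
    ⋃₀ cutArcs W = univ := by
  refine eq_univ_of_forall fun x => ?_
  obtain ⟨y, -, hy, h⟩ := exists_component_of_mem_closure hW hn isOpen_univ
    (subset_closure (mem_univ x))
  exact ⟨_, ⟨y, hy, rfl⟩, h⟩

theorem disjoint_interior_cutArcs {W : Set Circle} (hW : W.Finite) (hn : W.Nontrivial)
    {I J : Set Circle} (hI : I ∈ cutArcs W) (hJ : J ∈ cutArcs W) (hIJ : I ≠ J) :
    Disjoint (interior I) (interior J) := by
  obtain ⟨x, hx, rfl⟩ := hI
  obtain ⟨y, hy, rfl⟩ := hJ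
  rw [interior_closure_connectedComponentIn hW hn hx,
    interior_closure_connectedComponentIn hW hn hy, disjoint_left]
  intro z hz hz'
  exact hIJ (by rw [connectedComponentIn_eq hz, connectedComponentIn_eq hz'])

/-- The closure of an open set with frontier in `W` is a union of arcs cut out by `W`. -/
theorem exists_sUnion_cutArcs {W : Set Circle} (hW : W.Finite) (hn : W.Nontrivial)
    {O : Set Circle} (hO : IsOpen O) (hfr : ∀ x ∈ closure O, x ∉ O → x ∈ W) :
    ∃ θ ⊆ cutArcs W, closure O = ⋃₀ θ := by
  refine ⟨{I ∈ cutArcs W | I ⊆ closure O}, sep_subset _ _, Subset.antisymm ?_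
    (sUnion_subset fun I hI => hI.2)⟩
  intro x hx
  obtain ⟨y, hy, hyW, h⟩ := exists_component_of_mem_closure hW hn hO hx
  refine ⟨_, ⟨⟨y, hyW, rfl⟩, closure_mono ?_⟩, h⟩
  refine subset_of_isPreconnected isPreconnected_connectedComponentIn hO
    ⟨y, mem_connectedComponentIn hyW, hy⟩ fun z hz hz' => ?_
  by_contra hzO
  exact connectedComponentIn_subset _ _ hz (hfr z hz' hzO)

/-! ### Piecewise Möbius maps with a Markov partition -/

/-- A circle map `f` which is given by an element `γ i` of a group `G` on each of a family
of disjoint open sets `U i`, is expanding there, and maps the finite set `W` into itself, also under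
the continuous extension of `f` from `U i` to its closure. The sets `U i` cover the complement
of `W`, and at every other point `f` takes the value of one of the adjacent branches. -/
structure IsBranchSystem {ι : Type*} {G : Subgroup DiscAut} (f : Circle → Circle)
    (W : Set Circle) (U : ι → Set Circle) (γ : ι → G) : Prop where
  finite : W.Finite
  nontrivial : W.Nontrivial
  isOpen : ∀ i, IsOpen (U i)
  disjoint : ∀ i j, i ≠ j → Disjoint (U i) (U j)
  cover : ∀ x ∉ W, ∃ i, x ∈ U i
  eq_on : ∀ i, ∀ x ∈ U i, f x = boundaryMap (γ i) x
  exists_branch : ∀ x, ∃ i, x ∈ closure (U i) ∧ f x = boundaryMap (γ i) x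
  mapsTo : ∀ i, ∀ x ∈ W, x ∈ closure (U i) → boundaryMap (γ i) x ∈ W
  expanding : ∀ i, ∀ x ∈ closure (U i), 1 < dil (γ i) x

open Classical in
/-- The branch of a piecewise Möbius map at a point; off the union of the sets `U i`, where it is
not determined, it is the identity. -/
noncomputable def branchAt {ι : Type*} {G : Subgroup DiscAut} (U : ι → Set Circle) (γ : ι → G)
    (x : Circle) : G :=
  if h : ∃ i, x ∈ U i then γ h.choose else 1

/-- The branch of the `n`-th iterate of a piecewise Möbius map at a point. -/
noncomputable def iterBranch {ι : Type*} {G : Subgroup DiscAut} (f : Circle → Circle)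
    (U : ι → Set Circle) (γ : ι → G) : ℕ → Circle → G
  | 0, _ => 1
  | n + 1, x => iterBranch f U γ n (f x) * branchAt U γ x

/-- The cylinder of level `n` around `x`: the set on which the first `n` iterates have the same
branches as at `x`, and which the `n`-th iterate maps onto a component of the complement of `W`. -/
noncomputable def cylinder {ι : Type*} {G : Subgroup DiscAut} (f : Circle → Circle)
    (W : Set Circle) (U : ι → Set Circle) (γ : ι → G) (n : ℕ) (x : Circle) : Set Circle :=
  boundaryMap (iterBranch f U γ n x : DiscAut) ⁻¹' connectedComponentIn Wᶜ (f^[n] x)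

namespace IsBranchSystem

variable {ι : Type*} {G : Subgroup DiscAut} {f : Circle → Circle}
    {W : Set Circle} {U : ι → Set Circle} {γ : ι → G}

theorem branchAt_eq (S : IsBranchSystem f W U γ) {i : ι} {x : Circle} (hx : x ∈ U i) :
    branchAt U γ x = γ i := by
  have h : ∃ i, x ∈ U i := ⟨i, hx⟩
  rw [branchAt, dif_pos h]
  by_contra hne
  have : h.choose ≠ i := fun h' => hne (by rw [h'])
  exact disjoint_left.1 (S.disjoint _ _ this) h.choose_spec hx

theorem apply_mem (S : IsBranchSystem f W U γ) {x : Circle} (hx : x ∈ W) : f x ∈ W := by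
  obtain ⟨i, hi, h⟩ := S.exists_branch x
  rw [h]
  exact S.mapsTo i x hx hi

theorem notMem_of_iterate (S : IsBranchSystem f W U γ) {n : ℕ} :
    ∀ {x : Circle}, f^[n] x ∉ W → x ∉ W := by
  induction n with
  | zero => intro x h; exact h
  | succ n ih =>
    intro x h hx
    rw [Function.iterate_succ_apply] at h
    exact ih h (S.apply_mem hx)

theorem component_subset (S : IsBranchSystem f W U γ) {i : ι} {x : Circle} (hx : x ∈ U i) :
    connectedComponentIn Wᶜ x ⊆ U i := by
  by_cases hxW : x ∈ W
  · rw [connectedComponentIn_eq_empty (by simpa using hxW)]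
    exact empty_subset _
  · refine isPreconnected_connectedComponentIn.subset_left_of_subset_union (S.isOpen i)
      (isOpen_biUnion (s := {j | j ≠ i}) fun j _ => S.isOpen j) ?_ ?_
      ⟨x, mem_connectedComponentIn hxW, hx⟩
    · rw [disjoint_iUnion₂_right]
      exact fun j hj => S.disjoint i j (Ne.symm hj)
    · intro y hy
      obtain ⟨j, hj⟩ := S.cover y (connectedComponentIn_subset _ _ hy)
      by_cases hji : j = i
      · exact Or.inl (hji ▸ hj)
      · exact Or.inr (mem_biUnion (x := j) hji hj)

theorem branchAt_eq_of_mem (S : IsBranchSystem f W U γ) {x y : Circle}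
    (hy : y ∈ connectedComponentIn Wᶜ x) : branchAt U γ y = branchAt U γ x := by
  have hx : x ∉ W := by
    by_contra h
    rw [connectedComponentIn_eq_empty (by simpa using h)] at hy
    exact hy
  obtain ⟨i, hi⟩ := S.cover x hx
  rw [S.branchAt_eq hi, S.branchAt_eq (S.component_subset hi hy)]

theorem apply_eq (S : IsBranchSystem f W U γ) {x y : Circle}
    (hy : y ∈ connectedComponentIn Wᶜ x) : f y = boundaryMap (branchAt U γ x : DiscAut) y := by
  have hyW : y ∉ W := connectedComponentIn_subset _ _ hy
  obtain ⟨i, hi⟩ := S.cover y hyW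
  rw [← S.branchAt_eq_of_mem hy, S.branchAt_eq hi, S.eq_on i y hi]

theorem exists_branchAt_eq (S : IsBranchSystem f W U γ) {x : Circle} (hx : x ∉ W) :
    ∃ i, branchAt U γ x = γ i ∧ connectedComponentIn Wᶜ x ⊆ U i := by
  obtain ⟨i, hi⟩ := S.cover x hx
  exact ⟨i, S.branchAt_eq hi, S.component_subset hi⟩

/-- The frontier of the image of a component of the complement of `W` under its branch lies in
`W`; this is the Markov property. -/
theorem frontier_image_component (S : IsBranchSystem f W U γ) {x : Circle} (hx : x ∉ W)
    {y : Circle}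
    (hy : y ∈ closure (boundaryHomeo (branchAt U γ x) '' connectedComponentIn Wᶜ x))
    (hy' : y ∉ boundaryHomeo (branchAt U γ x) '' connectedComponentIn Wᶜ x) : y ∈ W := by
  obtain ⟨i, hi, hU⟩ := S.exists_branchAt_eq hx
  rw [← Homeomorph.image_closure] at hy
  obtain ⟨z, hz, rfl⟩ := hy
  have hzW : z ∈ W := by
    by_contra h
    exact hy' ⟨z, mem_component_of_mem_closure S.finite S.nontrivial hz h, rfl⟩
  rw [boundaryHomeo_apply, hi]
  exact S.mapsTo i z hzW (closure_mono hU hz)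

/-- By the Markov property, the image of an arc under its branch contains every arc that it
meets. -/
theorem component_apply_subset (S : IsBranchSystem f W U γ) {x : Circle} (hx : x ∉ W)
    (hfx : f x ∉ W) : connectedComponentIn Wᶜ (f x) ⊆
      boundaryHomeo (branchAt U γ x) '' connectedComponentIn Wᶜ x := by
  refine subset_of_isPreconnected isPreconnected_connectedComponentIn
    ((boundaryHomeo _).isOpenMap _ (isOpen_component S.finite S.nontrivial hx))
    ⟨f x, mem_connectedComponentIn hfx, x, mem_connectedComponentIn hx,
      (S.apply_eq (mem_connectedComponentIn hx)).symm⟩ fun y hy hy' => ?_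
  by_contra h
  exact connectedComponentIn_subset _ _ hy (S.frontier_image_component hx hy' h)

theorem cylinder_succ (n : ℕ) (x : Circle) : cylinder f W U γ (n + 1) x =
    boundaryMap (branchAt U γ x : DiscAut) ⁻¹' cylinder f W U γ n (f x) := by
  ext y
  simp only [cylinder, iterBranch, Subgroup.coe_mul, mem_preimage, boundaryMap_mul,
    Function.iterate_succ_apply]

theorem cylinder_zero (x : Circle) : cylinder f W U γ 0 x = connectedComponentIn Wᶜ x := by
  ext y
  simp [cylinder, iterBranch, boundaryMap_one]

theorem cylinder_subset (S : IsBranchSystem f W U γ) {n : ℕ} :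
    ∀ {x : Circle}, f^[n] x ∉ W → cylinder f W U γ n x ⊆ connectedComponentIn Wᶜ x := by
  induction n with
  | zero => intro x _; rw [cylinder_zero]
  | succ n ih =>
    intro x hx y hy
    rw [cylinder_succ] at hy
    have hfx : f^[n] (f x) ∉ W := by rwa [Function.iterate_succ_apply] at hx
    obtain ⟨z, hz, hzy⟩ := S.component_apply_subset (S.notMem_of_iterate hx)
      (S.notMem_of_iterate hfx) (ih hfx hy)
    rwa [← (boundaryMap_injective _ hzy)]

theorem mem_cylinder (S : IsBranchSystem f W U γ) {n : ℕ} :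
    ∀ {x : Circle}, f^[n] x ∉ W → x ∈ cylinder f W U γ n x := by
  induction n with
  | zero => intro x hx; rw [cylinder_zero]; exact mem_connectedComponentIn hx
  | succ n ih =>
    intro x hx
    have hfx : f^[n] (f x) ∉ W := by rwa [Function.iterate_succ_apply] at hx
    rw [cylinder_succ, mem_preimage,
      ← S.apply_eq (mem_connectedComponentIn (S.notMem_of_iterate hx))]
    exact ih hfx

theorem iterBranch_eq_of_mem (S : IsBranchSystem f W U γ) {n : ℕ} :
    ∀ {x y : Circle}, f^[n] x ∉ W → y ∈ cylinder f W U γ n x →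
      iterBranch f U γ n y = iterBranch f U γ n x ∧
      f^[n] y = boundaryMap (iterBranch f U γ n x : DiscAut) y := by
  induction n with
  | zero => intro x y _ _; exact ⟨rfl, (boundaryMap_one y).symm⟩
  | succ n ih =>
    intro x y hx hy
    have hfx : f^[n] (f x) ∉ W := by rwa [Function.iterate_succ_apply] at hx
    have hyc := S.cylinder_subset hx hy
    have e1 := S.apply_eq hyc
    have hy2 : f y ∈ cylinder f W U γ n (f x) := by
      rw [cylinder_succ, mem_preimage, ← e1] at hy; exact hy
    obtain ⟨e2, e3⟩ := ih hfx hy2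
    refine ⟨?_, ?_⟩
    · rw [iterBranch, iterBranch, e2, S.branchAt_eq_of_mem hyc]
    · rw [Function.iterate_succ_apply, e3, iterBranch, Subgroup.coe_mul, boundaryMap_mul, e1]

theorem iterate_mem (S : IsBranchSystem f W U γ) {n : ℕ} {x y : Circle} (hx : f^[n] x ∉ W)
    (hy : y ∈ cylinder f W U γ n x) : f^[n] y ∈ connectedComponentIn Wᶜ (f^[n] x) := by
  rw [(S.iterBranch_eq_of_mem hx hy).2]; exact hy

theorem isPreconnected_cylinder (n : ℕ) (x : Circle) :
    IsPreconnected (cylinder f W U γ n x) :=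
  (boundaryHomeo (iterBranch f U γ n x : DiscAut)).isPreconnected_preimage.2
    isPreconnected_connectedComponentIn

/-- The components of the preimages of the partition arcs are the cylinders. -/
theorem connectedComponentIn_iterate (S : IsBranchSystem f W U γ) {n : ℕ} :
    ∀ {x z : Circle}, z ∉ W → f^[n] x ∈ connectedComponentIn Wᶜ z →
      connectedComponentIn (f^[n] ⁻¹' connectedComponentIn Wᶜ z) x = cylinder f W U γ n x := by
  induction n with
  | zero =>
    intro x z _ h
    rw [Function.iterate_zero, preimage_id, cylinder_zero, connectedComponentIn_eq h]
    exact isPreconnected_connectedComponentIn.connectedComponentIn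
      (mem_connectedComponentIn (connectedComponentIn_subset _ _ h))
  | succ n ih =>
    intro x z hz h
    have hx : f^[n + 1] x ∉ W := connectedComponentIn_subset _ _ h
    have hxW := S.notMem_of_iterate hx
    refine Subset.antisymm ?_ ?_
    · set C := connectedComponentIn (f^[n + 1] ⁻¹' connectedComponentIn Wᶜ z) x
      have hCW : C ⊆ connectedComponentIn Wᶜ x := by
        refine isPreconnected_connectedComponentIn.subset_connectedComponentIn
          (mem_connectedComponentIn h) fun y hy => ?_
        have h3 : f^[n + 1] y ∈ connectedComponentIn Wᶜ z :=
          connectedComponentIn_subset (f^[n + 1] ⁻¹' connectedComponentIn Wᶜ z) x hy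
        exact S.notMem_of_iterate (connectedComponentIn_subset _ _ h3)
      have him : boundaryMap (branchAt U γ x : DiscAut) '' C ⊆
          connectedComponentIn (f^[n] ⁻¹' connectedComponentIn Wᶜ z) (f x) := by
        refine (isPreconnected_connectedComponentIn.image _
          (continuous_boundaryMap _).continuousOn).subset_connectedComponentIn
            ⟨x, mem_connectedComponentIn h, ?_⟩ ?_
        · rw [← S.apply_eq (mem_connectedComponentIn hxW)]
        · rintro _ ⟨y, hy, rfl⟩
          have h3 : f^[n + 1] y ∈ connectedComponentIn Wᶜ z :=
          connectedComponentIn_subset (f^[n + 1] ⁻¹' connectedComponentIn Wᶜ z) x hy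
          rw [← S.apply_eq (hCW hy), mem_preimage, ← Function.iterate_succ_apply]
          exact h3
      rw [ih hz (by rwa [← Function.iterate_succ_apply])] at him
      rw [cylinder_succ]
      exact fun y hy => him (mem_image_of_mem _ hy)
    · refine (isPreconnected_cylinder _ _).subset_connectedComponentIn (S.mem_cylinder hx)
        fun y hy => ?_
      rw [mem_preimage, connectedComponentIn_eq h]
      exact S.iterate_mem hx hy

theorem exists_cylinder_of_mem_pullbackPartition (S : IsBranchSystem f W U γ) {n : ℕ}
    {J : Set Circle} (hJ : J ∈ pullbackPartition f (cutArcs W) n) :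
    ∃ x, f^[n] x ∉ W ∧ J = closure (cylinder f W U γ n x) := by
  obtain ⟨_, ⟨z, hz, rfl⟩, x, hx, rfl⟩ := hJ
  rw [interior_closure_connectedComponentIn S.finite S.nontrivial hz] at hx ⊢
  exact ⟨x, connectedComponentIn_subset _ _ hx, by rw [S.connectedComponentIn_iterate hz hx]⟩

theorem closure_cylinder (n : ℕ) (x : Circle) : closure (cylinder f W U γ n x) =
    boundaryMap (iterBranch f U γ n x : DiscAut) ⁻¹'
      closure (connectedComponentIn Wᶜ (f^[n] x)) :=
  ((boundaryHomeo (iterBranch f U γ n x : DiscAut)).preimage_closure _).symm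

theorem interior_closure_cylinder (S : IsBranchSystem f W U γ) {n : ℕ} {x : Circle}
    (hx : f^[n] x ∉ W) : interior (closure (cylinder f W U γ n x)) = cylinder f W U γ n x := by
  rw [closure_cylinder]
  have := (boundaryHomeo (iterBranch f U γ n x : DiscAut)).preimage_interior
    (closure (connectedComponentIn Wᶜ (f^[n] x)))
  rw [interior_closure_connectedComponentIn S.finite S.nontrivial hx] at this
  exact this.symm

theorem iterBranch_add (m n : ℕ) : ∀ x : Circle, iterBranch f U γ (m + n) x =
    iterBranch f U γ m (f^[n] x) * iterBranch f U γ n x := by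
  induction n with
  | zero => intro x; simp [iterBranch]
  | succ n ih =>
    intro x
    rw [← add_assoc, iterBranch, ih, iterBranch, mul_assoc, Function.iterate_succ_apply]

theorem cylinder_add (m n : ℕ) (x : Circle) : cylinder f W U γ (m + n) x =
    boundaryMap (iterBranch f U γ n x : DiscAut) ⁻¹' cylinder f W U γ m (f^[n] x) := by
  ext y
  simp only [cylinder, iterBranch_add, Subgroup.coe_mul, mem_preimage, boundaryMap_mul,
    Function.iterate_add_apply]

theorem cylinder_add_subset (S : IsBranchSystem f W U γ) {m n : ℕ} {x : Circle}
    (hx : f^[m + n] x ∉ W) : cylinder f W U γ (m + n) x ⊆ cylinder f W U γ n x := by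
  rw [cylinder_add]
  rw [Function.iterate_add_apply] at hx
  exact preimage_mono (S.cylinder_subset hx)

theorem finite_range_iterBranch [Finite ι] (n : ℕ) :
    {g : G | ∃ x, g = iterBranch f U γ n x}.Finite := by
  have hb : {g : G | ∃ x, g = branchAt U γ x}.Finite := by
    refine ((finite_range γ).union (finite_singleton 1)).subset ?_
    rintro _ ⟨x, rfl⟩
    unfold branchAt
    split_ifs with h
    · exact Or.inl (mem_range_self _)
    · exact Or.inr rfl
  induction n with
  | zero => exact (finite_singleton 1).subset (by rintro _ ⟨x, rfl⟩; rfl)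
  | succ n ih =>
    refine (ih.mul hb).subset ?_
    rintro _ ⟨x, rfl⟩
    exact mul_mem_mul ⟨f x, rfl⟩ ⟨x, rfl⟩

/-! ### Contraction of the inverse branches -/

/-- The inverses of the expanding branches contract at all points within a fixed distance of the
images of the branches, by compactness. -/
theorem exists_contraction [Finite ι] (S : IsBranchSystem f W U γ) : ∃ ε > 0, ∃ l > 0, l < 1 ∧
    ∀ i, ∀ y, ∀ z ∈ closure (U i), dist y (boundaryMap (γ i) z) < ε →
      dil (γ i : DiscAut)⁻¹ y ≤ l := by
  have key : ∀ i, ∀ᶠ ε in nhdsWithin (0 : ℝ) (Ioi 0), ∀ᶠ l in nhdsWithin (1 : ℝ) (Iio 1),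
      ∀ y, ∀ z ∈ closure (U i), dist y (boundaryMap (γ i) z) < ε →
      dil (γ i : DiscAut)⁻¹ y ≤ l := by
    intro i
    have hK : IsCompact (boundaryMap (γ i) '' closure (U i)) :=
      isClosed_closure.isCompact.image (continuous_boundaryMap _)
    have hO : IsOpen {y | dil (γ i : DiscAut)⁻¹ y < 1} :=
      isOpen_lt (continuous_dil _) continuous_const
    obtain ⟨δ, hδ, hsub⟩ := hK.exists_cthickening_subset_open hO (by
      rintro _ ⟨z, hz, rfl⟩
      change dil _ _ < 1
      rw [dil_inv, boundaryMap_inv_apply, div_lt_one (dil_pos _ _)]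
      exact S.expanding i z hz)
    have hex : ∃ l₀ < 1, ∀ y ∈ Metric.cthickening δ (boundaryMap (γ i) '' closure (U i)),
        dil (γ i : DiscAut)⁻¹ y ≤ l₀ := by
      rcases (Metric.cthickening δ (boundaryMap (γ i) '' closure (U i))).eq_empty_or_nonempty
        with h | h
      · exact ⟨0, one_pos, by simp [h]⟩
      · obtain ⟨y₀, hy₀, hmax⟩ := (Metric.isClosed_cthickening.isCompact).exists_isMaxOn h
          (continuous_dil (γ i : DiscAut)⁻¹).continuousOn
        exact ⟨_, hsub hy₀, hmax⟩
    obtain ⟨l₀, hl₀, hle⟩ := hex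
    filter_upwards [Ioo_mem_nhdsGT hδ] with ε hε
    filter_upwards [Ioo_mem_nhdsLT hl₀] with l hl y z hz hyz
    exact (hle y (Metric.mem_cthickening_of_dist_le y _ δ _ (mem_image_of_mem _ hz)
      (hyz.trans hε.2).le)).trans hl.1.le
  have h1 := Filter.eventually_all.2 key
  have h2 := (h1.mono fun ε h => Filter.eventually_all.2 h).and self_mem_nhdsWithin
  obtain ⟨ε, h3, hε⟩ := h2.exists
  obtain ⟨l, hl, hl0, hl1⟩ := (h3.and (Ioo_mem_nhdsLT one_pos)).exists
  exact ⟨ε, hε, l, hl0, hl1, hl⟩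

/-- The inverse branches of the iterates contract uniformly, and they do so on a neighbourhood of
fixed size of the partition arcs. -/
theorem exists_iterate_contraction [Finite ι] (S : IsBranchSystem f W U γ) :
    ∃ ε > 0, ∃ l > 0, l < 1 ∧ ∀ n x, f^[n] x ∉ W →
      ∀ z ∈ closure (connectedComponentIn Wᶜ (f^[n] x)),
        (∀ y, dist y z < ε → dist (boundaryMap (iterBranch f U γ n x : DiscAut)⁻¹ y)
          (boundaryMap (iterBranch f U γ n x : DiscAut)⁻¹ z) ≤ l ^ n * dist y z) ∧
        (∀ y ∈ closure (connectedComponentIn Wᶜ (f^[n] x)),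
          dist (boundaryMap (iterBranch f U γ n x : DiscAut)⁻¹ y)
          (boundaryMap (iterBranch f U γ n x : DiscAut)⁻¹ z) ≤ l ^ n * dist y z) := by
  obtain ⟨ε, hε, l, hl0, hl1, hc⟩ := S.exists_contraction
  refine ⟨ε, hε, l, hl0, hl1, fun n => ?_⟩
  induction n with
  | zero => intro x _ z _; simp [iterBranch, boundaryMap_one]
  | succ n ih =>
    intro x hx z hz
    have hfx : f^[n] (f x) ∉ W := by rwa [Function.iterate_succ_apply] at hx
    have hxW := S.notMem_of_iterate hx
    obtain ⟨i, hi, hU⟩ := S.exists_branchAt_eq hxW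
    rw [Function.iterate_succ_apply] at hz
    simp only [iterBranch, Subgroup.coe_mul, mul_inv_rev, boundaryMap_mul,
      Function.iterate_succ_apply]
    set g := (iterBranch f U γ n (f x) : DiscAut)
    have hmem : ∀ y ∈ closure (connectedComponentIn Wᶜ (f^[n] (f x))),
        ∃ w ∈ closure (U i), boundaryMap (γ i) w = boundaryMap g⁻¹ y := by
      intro y hy
      have h1 : boundaryMap g⁻¹ y ∈ closure (cylinder f W U γ n (f x)) := by
        rw [closure_cylinder, mem_preimage, boundaryMap_apply_inv]; exact hy
      have h2 := closure_mono ((S.cylinder_subset hfx).trans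
        (S.component_apply_subset hxW (S.notMem_of_iterate hfx))) h1
      rw [← Homeomorph.image_closure] at h2
      obtain ⟨w, hw, hwe⟩ := h2
      refine ⟨w, closure_mono hU hw, ?_⟩
      rw [← hwe, hi]; rfl
    obtain ⟨w, hw, hwz⟩ := hmem z hz
    obtain ⟨ih1, ih2⟩ := ih (f x) hfx z hz
    have hz1 := hc i (boundaryMap g⁻¹ z) w hw (by rw [hwz, dist_self]; exact hε)
    rw [hi]
    refine ⟨fun y hy => ?_, fun y hy => ?_⟩
    · have h1 := ih1 y hy
      have h2 : dist (boundaryMap g⁻¹ y) (boundaryMap g⁻¹ z) < ε :=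
        (h1.trans (mul_le_of_le_one_left dist_nonneg (pow_le_one₀ hl0.le hl1.le))).trans_lt hy
      have hy1 := hc i (boundaryMap g⁻¹ y) w hw (by rw [hwz]; exact h2)
      calc _ ≤ l * dist (boundaryMap g⁻¹ y) (boundaryMap g⁻¹ z) :=
            dist_le_of_dil_le hl0.le hy1 hz1
        _ ≤ l * (l ^ n * dist y z) := mul_le_mul_of_nonneg_left h1 hl0.le
        _ = _ := by ring
    · obtain ⟨v, hv, hvy⟩ := hmem y hy
      have hy1 := hc i (boundaryMap g⁻¹ y) v hv (by rw [hvy, dist_self]; exact hε)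
      calc _ ≤ l * dist (boundaryMap g⁻¹ y) (boundaryMap g⁻¹ z) :=
            dist_le_of_dil_le hl0.le hy1 hz1
        _ ≤ l * (l ^ n * dist y z) := mul_le_mul_of_nonneg_left (ih2 y hy) hl0.le
        _ = _ := by ring

/-! ### Transport to another surface group -/

theorem isClosedArc_closure_component (S : IsBranchSystem f W U γ) {x : Circle} (hx : x ∉ W) :
    IsClosedArc (closure (connectedComponentIn Wᶜ x)) :=
  isClosedArc_of_mem_cutArcs S.finite S.nontrivial ⟨x, hx, rfl⟩

theorem isClosedArc_closure_cylinder (S : IsBranchSystem f W U γ) {n : ℕ} {x : Circle}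
    (hx : f^[n] x ∉ W) : IsClosedArc (closure (cylinder f W U γ n x)) := by
  rw [closure_cylinder]
  have := (S.isClosedArc_closure_component hx).image
    (boundaryHomeo (iterBranch f U γ n x : DiscAut)).symm
  rwa [Homeomorph.image_symm] at this

theorem closure_cylinder_add (m n : ℕ) (x : Circle) : closure (cylinder f W U γ (m + n) x) =
    boundaryMap (iterBranch f U γ n x : DiscAut) ⁻¹' closure (cylinder f W U γ m (f^[n] x)) := by
  rw [cylinder_add]
  exact ((boundaryHomeo (iterBranch f U γ n x : DiscAut)).preimage_closure _).symm

/-- The branches of high iterates leave every finite set of group elements, since their inverses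
contract. -/
theorem eventually_iterBranch_ne [Finite ι] (S : IsBranchSystem f W U γ) (g : G) :
    ∀ᶠ n in Filter.atTop, ∀ x, f^[n] x ∉ W → iterBranch f U γ n x ≠ g := by
  obtain ⟨ε, -, l, hl0, hl1, hc⟩ := S.exists_iterate_contraction
  obtain ⟨y₀, -, hmin⟩ := isCompact_univ.exists_isMinOn (univ_nonempty (α := Circle))
    (continuous_dil (g : DiscAut)⁻¹).continuousOn
  have hm := dil_pos (g : DiscAut)⁻¹ y₀
  filter_upwards [(tendsto_pow_atTop_nhds_zero_of_lt_one hl0.le hl1).eventually_lt_const hm]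
    with n hn x hx hg
  obtain ⟨y, hy, z, hz, hyz⟩ := (S.isClosedArc_closure_component hx).nontrivial
  have h1 := (hc n x hx z hz).2 y hy
  rw [hg] at h1
  have h2 := le_dist_of_le_dil (m := (g : DiscAut)⁻¹) (x := y) (y := z) hm.le
    (hmin (mem_univ y)) (hmin (mem_univ z))
  have h3 := dist_pos.2 hyz
  nlinarith

section Transport

variable {Γ : Subgroup DiscAut} {φ : G ≃* Γ} {H : Circle ≃ₜ Circle}

/-- By proper discontinuity, the transported branches of high iterates map the centre close to the
circle. -/
theorem eventually_lt_norm [Finite ι] (S : IsBranchSystem f W U γ) (hΓ : IsClosedSurfaceGroup Γ)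
    (φ : G ≃* Γ) {r : ℝ} (hr : r < 1) :
    ∀ᶠ n in Filter.atTop, ∀ x, f^[n] x ∉ W →
      r < ‖(((φ (iterBranch f U γ n x) : DiscAut) : Equiv.Perm ClosedDisc) discCenter : ℂ)‖ := by
  have hfin := hΓ.properlyDiscontinuous (max r 0) (max_lt hr one_pos)
  have hfin' := hfin.preimage (f := fun g : G => (φ g : DiscAut))
    (Subtype.val_injective.comp φ.injective).injOn
  have hall := (Filter.eventually_all_finite hfin').2 fun g _ => S.eventually_iterBranch_ne g
  filter_upwards [hall] with n hn x hx
  by_contra hle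
  refine hn (iterBranch f U γ n x) ⟨(φ (iterBranch f U γ n x)).2, discCenter, ?_, ?_⟩ x hx rfl
  · simp [discCenter]
  · exact (not_lt.1 hle).trans (le_max_left _ _)

theorem transport_inv (hH : ∀ (g : G) (x : Circle),
      H (boundaryMap (g : DiscAut) x) = boundaryMap (φ g : DiscAut) (H x)) (g : G) (x : Circle) :
    H (boundaryMap (g : DiscAut)⁻¹ x) = boundaryMap (φ g : DiscAut)⁻¹ (H x) := by
  have := hH g⁻¹ x
  rwa [map_inv, Subgroup.coe_inv, Subgroup.coe_inv] at this

/-- The images of the centre under the transported branches stay away from the transported arcs: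
otherwise the circle would be covered by two small sets, namely the image of a neighbourhood of
the arc, which is small since the original branches contract it, and the image of the complement
of the neighbourhood, which is small since the transported branch maps the centre close to the
circle. -/
theorem eventually_le_norm_sub [Finite ι] (S : IsBranchSystem f W U γ)
    (hΓ : IsClosedSurfaceGroup Γ) (hH : ∀ (g : G) (x : Circle),
      H (boundaryMap (g : DiscAut) x) = boundaryMap (φ g : DiscAut) (H x)) :
    ∃ δ > 0, ∀ᶠ n in Filter.atTop, ∀ x, f^[n] x ∉ W →
      ∀ y ∈ closure (connectedComponentIn Wᶜ (f^[n] x)), δ ≤ ‖(H y : ℂ) -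
        ((φ (iterBranch f U γ n x) : DiscAut) : Equiv.Perm ClosedDisc) discCenter‖ := by
  obtain ⟨ε, hε, l, hl0, hl1, hc⟩ := S.exists_iterate_contraction
  obtain ⟨δ, hδ, hHε⟩ := Metric.uniformContinuous_iff.1
    (CompactSpace.uniformContinuous_of_continuous H.symm.continuous) ε hε
  obtain ⟨τ, hτ, hHτ⟩ := Metric.uniformContinuous_iff.1
    (CompactSpace.uniformContinuous_of_continuous H.continuous) (1 / 2) (by norm_num)
  have hδ2 : 0 < δ / 2 := by positivity
  have hr : ∃ r < 1, 0 ≤ r ∧ (1 - r ^ 2) / (δ / 2) ^ 2 * 2 ≤ 1 := by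
    set K := 2 / (δ / 2) ^ 2
    have hK : 0 < K := by positivity
    refine ⟨√(1 - 1 / (1 + K)), ?_, sqrt_nonneg _, ?_⟩
    · rw [Real.sqrt_lt' one_pos, one_pow]
      linarith [show 0 < 1 / (1 + K) by positivity]
    · have h1 : 1 / (1 + K) ≤ 1 := by rw [div_le_one (by positivity)]; linarith
      rw [Real.sq_sqrt (by linarith), sub_sub_cancel, div_mul_eq_mul_div, mul_div_assoc,
        div_mul_eq_mul_div, one_mul, div_le_one (by positivity)]
      linarith
  obtain ⟨r, hr1, hr0, hrK⟩ := hr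
  refine ⟨δ / 2, hδ2, ?_⟩
  filter_upwards [S.eventually_lt_norm hΓ φ hr1,
    ((tendsto_pow_atTop_nhds_zero_of_lt_one hl0.le hl1).mul_const ε).eventually_lt_const
      (show 0 * ε < τ by rwa [zero_mul])] with n hn1 hn2 x hx y hy
  by_contra hlt
  rw [not_le] at hlt
  set g := iterBranch f U γ n x
  have hb := hn1 x hx
  have hnear : ∀ u : Circle, dist u (H y) < δ →
      dist (boundaryMap (φ g : DiscAut)⁻¹ u) (boundaryMap (φ g : DiscAut)⁻¹ (H y)) < 1 / 2 := by
    intro u hu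
    have h1 : dist (H.symm u) y < ε := by simpa using hHε hu
    have h2 := (hc n x hx y hy).1 _ h1
    have h3 : dist (boundaryMap (g : DiscAut)⁻¹ (H.symm u)) (boundaryMap (g : DiscAut)⁻¹ y) < τ :=
      (h2.trans (mul_le_mul_of_nonneg_left h1.le (by positivity))).trans_lt hn2
    have h4 := hHτ h3
    rwa [transport_inv hH, transport_inv hH, H.apply_symm_apply] at h4
  have hfar : ∀ u : Circle, δ ≤ dist u (H y) → dil (φ g : DiscAut)⁻¹ u ≤ 1 / 2 := by
    intro u hu
    refine (dil_inv_le hδ2 ?_).trans ?_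
    · rw [circle_dist_eq] at hu
      have := norm_sub_le_norm_sub_add_norm_sub (u : ℂ)
        (((φ g : DiscAut) : Equiv.Perm ClosedDisc) discCenter) (H y)
      rw [norm_sub_rev (((φ g : DiscAut) : Equiv.Perm ClosedDisc) discCenter : ℂ)] at this
      linarith
    · have h2 : (1 - ‖(((φ g : DiscAut) : Equiv.Perm ClosedDisc) discCenter : ℂ)‖ ^ 2) /
          (δ / 2) ^ 2 ≤ (1 - r ^ 2) / (δ / 2) ^ 2 :=
        div_le_div_of_nonneg_right (by nlinarith) (by positivity)
      linarith
  classical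
  obtain ⟨p, q, hpq, hd⟩ := exists_dist_lt fun p =>
    decide (dist (boundaryMap (φ g : DiscAut) p) (H y) < δ)
  by_cases hp : dist (boundaryMap (φ g : DiscAut) p) (H y) < δ
  · have hq : dist (boundaryMap (φ g : DiscAut) q) (H y) < δ := by simpa [hp] using hpq
    have h1 := hnear _ hp
    have h2 := hnear _ hq
    rw [boundaryMap_inv_apply] at h1 h2
    have := dist_triangle_right p q (boundaryMap (φ g : DiscAut)⁻¹ (H y))
    linarith
  · have hq : ¬ dist (boundaryMap (φ g : DiscAut) q) (H y) < δ := by simpa [hp] using hpq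
    have h1 := dist_le_of_dil_le (by norm_num) (hfar _ (not_lt.1 hp)) (hfar _ (not_lt.1 hq))
    rw [boundaryMap_inv_apply, boundaryMap_inv_apply] at h1
    have h2 : dist (boundaryMap (φ g : DiscAut) p) (boundaryMap (φ g : DiscAut) q) ≤ 2 := by
      rw [circle_dist_eq]
      refine (norm_sub_le _ _).trans ?_
      rw [Circle.norm_coe, Circle.norm_coe]; norm_num
    linarith

/-- The uniform form of `eventually_le_norm_sub`: the finitely many branches of the low iterates
map the centre into a compact part of the open disk. -/
theorem exists_le_norm_sub [Finite ι] (S : IsBranchSystem f W U γ)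
    (hΓ : IsClosedSurfaceGroup Γ) (hH : ∀ (g : G) (x : Circle),
      H (boundaryMap (g : DiscAut) x) = boundaryMap (φ g : DiscAut) (H x)) :
    ∃ δ > 0, ∀ n x, f^[n] x ∉ W →
      ∀ y ∈ closure (connectedComponentIn Wᶜ (f^[n] x)), δ ≤ ‖(H y : ℂ) -
        ((φ (iterBranch f U γ n x) : DiscAut) : Equiv.Perm ClosedDisc) discCenter‖ := by
  obtain ⟨δ, hδ, h⟩ := S.eventually_le_norm_sub hΓ hH
  obtain ⟨N, hN⟩ := Filter.eventually_atTop.1 h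
  have h2 : ∀ᶠ c in nhdsWithin (0 : ℝ) (Ioi 0), ∀ n ∈ Iio N,
      ∀ g ∈ {g : G | ∃ x, g = iterBranch f U γ n x},
        c ≤ 1 - ‖(((φ g : DiscAut) : Equiv.Perm ClosedDisc) discCenter : ℂ)‖ := by
    refine (Filter.eventually_all_finite (finite_Iio N)).2 fun n _ =>
      (Filter.eventually_all_finite (finite_range_iterBranch n)).2 fun g _ => ?_
    filter_upwards [Ioo_mem_nhdsGT (sub_pos.2 (norm_apply_center_lt (φ g : DiscAut)))] with c hc
    exact hc.2.le
  obtain ⟨c, hc, hc0⟩ := (h2.and self_mem_nhdsWithin).exists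
  refine ⟨min δ c, lt_min hδ hc0, fun n x hx y hy => ?_⟩
  rcases le_or_gt N n with hn | hn
  · exact (min_le_left _ _).trans (hN n hn x hx y hy)
  · have h3 := hc n hn _ ⟨x, rfl⟩
    have h4 := norm_sub_norm_le (H y : ℂ)
      (((φ (iterBranch f U γ n x) : DiscAut) : Equiv.Perm ClosedDisc) discCenter)
    rw [Circle.norm_coe] at h4
    exact (min_le_right _ _).trans (h3.trans h4)

/-- Level `n` expands at least by the factor `c` on the transported cylinders. -/
def ExpandsBy (f : Circle → Circle) (W : Set Circle) (U : ι → Set Circle) (γ : ι → G)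
    (φ : G ≃* Γ) (H : Circle ≃ₜ Circle) (n : ℕ) (c : ℝ) : Prop :=
  ∀ x, f^[n] x ∉ W → ∀ y ∈ closure (cylinder f W U γ n x),
    c ≤ dil (φ (iterBranch f U γ n x) : DiscAut) (H y)

/-- Expansion is multiplicative under composition. -/
theorem ExpandsBy.add (S : IsBranchSystem f W U γ) (hH : ∀ (g : G) (x : Circle),
      H (boundaryMap (g : DiscAut) x) = boundaryMap (φ g : DiscAut) (H x)) {m n : ℕ} {c d : ℝ}
    (hd : 0 ≤ d) (h : ExpandsBy f W U γ φ H m c) (h' : ExpandsBy f W U γ φ H n d) :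
    ExpandsBy f W U γ φ H (m + n) (c * d) := by
  intro x hx y hy
  have hx' : f^[m] (f^[n] x) ∉ W := by rwa [← Function.iterate_add_apply]
  have hxn : f^[n] x ∉ W := S.notMem_of_iterate hx'
  rw [iterBranch_add, map_mul, Subgroup.coe_mul, dil_mul, ← hH]
  refine mul_le_mul (h _ hx' _ ?_) (h' x hxn y (closure_mono (S.cylinder_add_subset hx) hy)) hd
    (dil_pos _ _).le
  rwa [closure_cylinder_add] at hy

/-- If a transported branch maps the centre to `b`, its dilatation on the cylinder is at least
`δ ^ 2 / (1 - ‖b‖ ^ 2)`. Since `‖b‖` tends to `1`, some iterate expands by the factor `2`. -/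
theorem exists_expandsBy [Finite ι] (S : IsBranchSystem f W U γ)
    (hΓ : IsClosedSurfaceGroup Γ) (hH : ∀ (g : G) (x : Circle),
      H (boundaryMap (g : DiscAut) x) = boundaryMap (φ g : DiscAut) (H x)) :
    ∃ C > 0, ∃ l > 1, ∀ n, ExpandsBy f W U γ φ H n (C * l ^ n) := by
  obtain ⟨δ, hδ, h⟩ := S.exists_le_norm_sub hΓ hH
  have hdil : ∀ n x, f^[n] x ∉ W → ∀ y ∈ closure (cylinder f W U γ n x),
      δ ^ 2 ≤ dil (φ (iterBranch f U γ n x) : DiscAut) (H y) *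
      (1 - ‖(((φ (iterBranch f U γ n x) : DiscAut) : Equiv.Perm ClosedDisc) discCenter : ℂ)‖ ^ 2)
      := by
    intro n x hx y hy
    rw [closure_cylinder] at hy
    have h1 := dil_inv_le hδ (h n x hx _ hy)
    rw [hH, dil_inv, boundaryMap_inv_apply, le_div_iff₀ (by positivity),
      div_mul_eq_mul_div, div_le_iff₀ (dil_pos _ _), one_mul] at h1
    linarith
  have hone : ∀ n, ExpandsBy f W U γ φ H n (δ ^ 2) := by
    intro n x hx y hy
    refine (hdil n x hx y hy).trans (mul_le_of_le_one_right (dil_pos _ _).le ?_)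
    linarith [sq_nonneg ‖(((φ (iterBranch f U γ n x) : DiscAut) : Equiv.Perm ClosedDisc)
      discCenter : ℂ)‖]
  have htwo : ∃ N, 0 < N ∧ ExpandsBy f W U γ φ H N 2 := by
    have hr : √(1 - min (δ ^ 2 / 2) 1) < 1 := by
      rw [Real.sqrt_lt' one_pos, one_pow]
      linarith [show 0 < min (δ ^ 2 / 2) 1 from lt_min (by positivity) one_pos]
    obtain ⟨N, hN, hN0⟩ := ((S.eventually_lt_norm hΓ φ hr).and
      (Filter.eventually_gt_atTop 0)).exists
    refine ⟨N, hN0, fun x hx y hy => ?_⟩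
    have h1 := hdil N x hx y hy
    have h2 := (Real.sqrt_lt' ((Real.sqrt_nonneg _).trans_lt (hN x hx))).1 (hN x hx)
    have h3 := min_le_left (δ ^ 2 / 2) 1
    have h4 := dil_pos (φ (iterBranch f U γ N x) : DiscAut) (H y)
    by_contra hcon
    rw [not_le] at hcon
    have h5 := norm_apply_center_lt (φ (iterBranch f U γ N x) : DiscAut)
    have h6 : 0 < 1 - ‖(((φ (iterBranch f U γ N x) : DiscAut) : Equiv.Perm ClosedDisc)
      discCenter : ℂ)‖ ^ 2 := by
      nlinarith [norm_nonneg (((φ (iterBranch f U γ N x) : DiscAut) : Equiv.Perm ClosedDisc)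
        discCenter : ℂ)]
    nlinarith
  obtain ⟨N, hN0, hN⟩ := htwo
  have hmul : ∀ q r, ExpandsBy f W U γ φ H (N * q + r) (2 ^ q * δ ^ 2) := by
    intro q r
    induction q with
    | zero => simpa using hone r
    | succ q ih =>
      have := ExpandsBy.add S hH (by positivity) hN ih
      rwa [← mul_assoc, ← pow_succ', ← add_assoc, add_comm N, ← Nat.mul_succ] at this
  -- `n = N q + r` with `r < N`, and `l ^ N = 2`, so that `2 ^ q` is at least `l ^ n / 2`
  refine ⟨δ ^ 2 / 2, by positivity, (2 : ℝ) ^ ((N : ℝ)⁻¹), Real.one_lt_rpow one_lt_two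
    (by positivity), fun n x hx y hy => ?_⟩
  have h1 := hmul (n / N) (n % N)
  rw [Nat.div_add_mod] at h1
  refine le_trans ?_ (h1 x hx y hy)
  set l := (2 : ℝ) ^ ((N : ℝ)⁻¹)
  have hl : l ^ N = 2 := Real.rpow_inv_natCast_pow (by norm_num) hN0.ne'
  have hl1 : 1 ≤ l := Real.one_le_rpow one_le_two (by positivity)
  have h2 : l ^ n ≤ 2 ^ (n / N) * 2 := by
    conv_lhs => rw [← Nat.div_add_mod n N, pow_add, pow_mul, hl]
    refine mul_le_mul_of_nonneg_left ?_ (by positivity)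
    rw [← hl]
    exact pow_le_pow_right₀ hl1 (Nat.mod_lt n hN0).le
  nlinarith [sq_nonneg δ]

theorem iterate_conj (f : Circle → Circle) (H : Circle ≃ₜ Circle) (n : ℕ) (x : Circle) :
    (H ∘ f ∘ H.symm)^[n] (H x) = H (f^[n] x) := by
  have : Function.Semiconj H f (H ∘ f ∘ H.symm) := fun x => by simp
  exact ((this.iterate_right n) x).symm

theorem exists_of_mem_pullbackPartition_image {n : ℕ} {η : Set (Set Circle)} {J : Set Circle}
    (hJ : J ∈ pullbackPartition (H ∘ f ∘ H.symm) ((fun I => H '' I) '' η) n) :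
    ∃ K ∈ pullbackPartition f η n, J = H '' K := by
  obtain ⟨_, ⟨I, hI, rfl⟩, x, hx, rfl⟩ := hJ
  obtain ⟨x, rfl⟩ := H.surjective x
  have hset : (H ∘ f ∘ H.symm)^[n] ⁻¹' interior (H '' I) = H '' (f^[n] ⁻¹' interior I) := by
    ext y
    obtain ⟨y, rfl⟩ := H.surjective y
    rw [mem_preimage, iterate_conj, ← H.image_interior, H.injective.mem_set_image,
      H.injective.mem_set_image, mem_preimage]
  have hx' : x ∈ f^[n] ⁻¹' interior I := by
    have : H x ∈ (H ∘ f ∘ H.symm)^[n] ⁻¹' interior (H '' I) := hx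
    rwa [hset, H.injective.mem_set_image] at this
  refine ⟨_, ⟨I, hI, x, hx', rfl⟩, ?_⟩
  simp only
  rw [hset, ← H.image_connectedComponentIn hx', H.image_closure]

theorem isExpanding [Finite ι] (S : IsBranchSystem f W U γ)
    (hΓ : IsClosedSurfaceGroup Γ) (hH : ∀ (g : G) (x : Circle),
      H (boundaryMap (g : DiscAut) x) = boundaryMap (φ g : DiscAut) (H x)) :
    IsExpanding Γ (H ∘ f ∘ H.symm) ((fun I => H '' I) '' cutArcs W) := by
  obtain ⟨C, hC, l, hl, h⟩ := S.exists_expandsBy hΓ hH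
  refine ⟨C, hC, l, hl, fun n J hJ => ?_⟩
  obtain ⟨K, hK, rfl⟩ := exists_of_mem_pullbackPartition_image hJ
  obtain ⟨x, hx, rfl⟩ := S.exists_cylinder_of_mem_pullbackPartition hK
  refine ⟨φ (iterBranch f U γ n x), (φ _).2, ?_, ?_⟩
  · rw [← H.image_interior, S.interior_closure_cylinder hx]
    rintro _ ⟨y, hy, rfl⟩
    rw [iterate_conj, (S.iterBranch_eq_of_mem hx hy).2, hH]
  · rintro _ ⟨y, hy, rfl⟩
    exact h n x hx y hy

/-- On a transported cylinder of level `n`, the dilatations of the inverse branch at any two points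
are comparable, so the cylinder is subdivided in the proportions of finitely many model arcs. -/
theorem hasBoundedGeometry [Finite ι] (S : IsBranchSystem f W U γ)
    (hΓ : IsClosedSurfaceGroup Γ) (hH : ∀ (g : G) (x : Circle),
      H (boundaryMap (g : DiscAut) x) = boundaryMap (φ g : DiscAut) (H x)) :
    HasBoundedGeometry (H ∘ f ∘ H.symm) ((fun I => H '' I) '' cutArcs W) := by
  obtain ⟨δ, hδ, h⟩ := S.exists_le_norm_sub hΓ hH
  -- there are only finitely many cylinders of level one
  have hfin : {K : Set Circle | ∃ w, f w ∉ W ∧ K = closure (cylinder f W U γ 1 w)}.Finite := by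
    refine ((finite_range_iterBranch (f := f) (U := U) (γ := γ) 1).image2
      (fun (g : G) (I : Set Circle) => boundaryMap (g : DiscAut) ⁻¹' I)
      (finite_cutArcs S.finite S.nontrivial)).subset ?_
    rintro _ ⟨w, hw, rfl⟩
    exact ⟨_, ⟨w, rfl⟩, _, ⟨f w, hw, rfl⟩, (closure_cylinder 1 w).symm⟩
  have hev : ∀ᶠ c in nhdsWithin (0 : ℝ) (Ioi 0),
      ∀ K ∈ {K : Set Circle | ∃ w, f w ∉ W ∧ K = closure (cylinder f W U γ 1 w)},
        ∃ u ∈ K, ∃ v ∈ K, c ≤ dist (H u) (H v) := by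
    refine (Filter.eventually_all_finite hfin).2 ?_
    rintro K ⟨w, hw, rfl⟩
    obtain ⟨u, hu, v, hv, huv⟩ := (S.isClosedArc_closure_cylinder (n := 1) (x := w) hw).nontrivial
    filter_upwards [Ioo_mem_nhdsGT (dist_pos.2 (H.injective.ne huv))] with c hc
    exact ⟨u, hu, v, hv, hc.2.le⟩
  obtain ⟨c, hc, hc0⟩ := (hev.and self_mem_nhdsWithin).exists
  have hc0 : 0 < c := hc0
  refine ⟨c * δ ^ 2 / (8 * π), by positivity, fun n I hI J hJ hJI => ?_⟩
  obtain ⟨I, hI', rfl⟩ := exists_of_mem_pullbackPartition_image hI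
  obtain ⟨J, hJ', rfl⟩ := exists_of_mem_pullbackPartition_image hJ
  obtain ⟨x, hx, rfl⟩ := S.exists_cylinder_of_mem_pullbackPartition hI'
  obtain ⟨y, hy, rfl⟩ := S.exists_cylinder_of_mem_pullbackPartition hJ'
  rw [image_subset_image_iff H.injective] at hJI
  have hyx : y ∈ cylinder f W U γ n x := by
    have := interior_mono hJI
    rw [S.interior_closure_cylinder hx, S.interior_closure_cylinder hy] at this
    exact this (S.mem_cylinder hy)
  have hcyl : cylinder f W U γ n x = cylinder f W U γ n y := by
    rw [cylinder, cylinder, (S.iterBranch_eq_of_mem hx hyx).1,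
      connectedComponentIn_eq (S.iterate_mem hx hyx)]
  rw [hcyl]
  have hyn : f^[n] y ∉ W := by
    rw [add_comm, Function.iterate_add_apply] at hy
    exact S.notMem_of_iterate hy
  have hy1 : f (f^[n] y) ∉ W := by rwa [← Function.iterate_succ_apply' f n y]
  set g := iterBranch f U γ n y
  have harc := (S.isClosedArc_closure_cylinder hy).image H
  have harc' := (S.isClosedArc_closure_cylinder hyn).image H
  obtain ⟨u, hu, v, hv, huv⟩ := hc _ ⟨f^[n] y, hy1, rfl⟩
  set b := ‖(((φ g : DiscAut) : Equiv.Perm ClosedDisc) discCenter : ℂ)‖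
  have hb : b < 1 := norm_apply_center_lt _
  have hb0 : 0 ≤ b := norm_nonneg _
  have hb1 : 0 < 1 - b ^ 2 := by nlinarith
  have hmem : ∀ w ∈ closure (cylinder f W U γ 1 (f^[n] y)),
      boundaryMap (φ g : DiscAut)⁻¹ (H w) ∈ H '' closure (cylinder f W U γ (n + 1) y) := by
    intro w hw
    rw [← transport_inv hH]
    refine mem_image_of_mem _ ?_
    rwa [add_comm n 1, closure_cylinder_add, mem_preimage, boundaryMap_apply_inv]
  -- the inverse branch has dilatation at least `(1 - b ^ 2) / 4` everywhere, and at most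
  -- `(1 - b ^ 2) / δ ^ 2` on the arc of level zero
  have hJlen : (1 - b ^ 2) / 4 * c ≤ arcLength (H '' closure (cylinder f W U γ (n + 1) y)) :=
    calc _ ≤ (1 - b ^ 2) / 4 * dist (H u) (H v) :=
          mul_le_mul_of_nonneg_left huv (by positivity)
      _ ≤ _ := le_dist_of_le_dil (by positivity) (le_dil_inv _ _) (le_dil_inv _ _)
      _ ≤ _ := harc.dist_le_arcLength (hmem u hu) (hmem v hv)
  have hIlen : arcLength (H '' closure (cylinder f W U γ n y)) ≤
      π * ((1 - b ^ 2) / δ ^ 2 * 2) := by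
    obtain ⟨_, ⟨p, hp, rfl⟩, _, ⟨q, hq, rfl⟩, hle⟩ := harc'.exists_arcLength_le
    refine hle.trans (mul_le_mul_of_nonneg_left ?_ pi_pos.le)
    rw [closure_cylinder] at hp hq
    have h1 := dist_le_of_dil_le (by positivity) (dil_inv_le hδ (h n y hyn _ hp))
      (dil_inv_le hδ (h n y hyn _ hq))
    rw [hH, hH, boundaryMap_inv_apply, boundaryMap_inv_apply] at h1
    refine h1.trans (mul_le_mul_of_nonneg_left ?_ (by positivity))
    rw [circle_dist_eq]
    refine (norm_sub_le _ _).trans ?_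
    rw [Circle.norm_coe, Circle.norm_coe]; norm_num
  rw [le_div_iff₀ harc'.arcLength_pos]
  refine le_trans (mul_le_mul_of_nonneg_left hIlen (by positivity)) (le_trans (le_of_eq ?_) hJlen)
  field_simp
  ring

theorem isMarkovMap (S : IsBranchSystem f W U γ) (hH : ∀ (g : G) (x : Circle),
      H (boundaryMap (g : DiscAut) x) = boundaryMap (φ g : DiscAut) (H x)) :
    IsMarkovMap Γ (H ∘ f ∘ H.symm) ((fun I => H '' I) '' cutArcs W) := by
  have hfW := S.finite
  have hnW := S.nontrivial
  refine ⟨(finite_cutArcs hfW hnW).image _, ?_, ?_, ?_, ?_⟩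
  · rintro _ ⟨I, hI, rfl⟩
    exact (isClosedArc_of_mem_cutArcs hfW hnW hI).image H
  · rw [sUnion_image, ← image_iUnion₂, ← sUnion_eq_biUnion, sUnion_cutArcs hfW hnW, image_univ,
      H.surjective.range_eq]
  · rintro _ ⟨I, hI, rfl⟩ _ ⟨J, hJ, rfl⟩ hIJ
    simp only [← H.image_interior]
    exact (disjoint_image_iff H.injective).2
      (disjoint_interior_cutArcs hfW hnW hI hJ fun h => hIJ (by rw [h]))
  · have hex : ∀ I ∈ cutArcs W, ∃ g : G, ∀ x ∉ W, I = closure (connectedComponentIn Wᶜ x) →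
        g = branchAt U γ x := by
      rintro I ⟨x, hx, rfl⟩
      refine ⟨branchAt U γ x, fun y hy h => ?_⟩
      refine S.branchAt_eq_of_mem ?_
      rw [← interior_closure_connectedComponentIn hfW hnW hy, ← h,
        interior_closure_connectedComponentIn hfW hnW hx]
      exact mem_connectedComponentIn hx
    choose! g hg using hex
    have hg' : ∀ x ∉ W, g (H.symm '' (H '' closure (connectedComponentIn Wᶜ x))) =
        branchAt U γ x := fun x hx => by
      rw [← image_comp, H.symm_comp_self, image_id]
      exact hg _ ⟨x, hx, rfl⟩ x hx rfl
    refine ⟨fun J => φ (g (H.symm '' J)), ?_, ?_⟩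
    · rintro _ ⟨I, ⟨x, hx, rfl⟩, rfl⟩
      refine ⟨(φ _).2, ?_, ?_⟩
      · simp only [← H.image_interior]
        rw [interior_closure_connectedComponentIn hfW hnW hx]
        rintro _ ⟨y, hy, rfl⟩
        simp only [Function.comp_apply, H.symm_apply_apply]
        rw [hg' x hx, S.apply_eq hy, hH]
      · obtain ⟨θ, hθ, hO⟩ := exists_sUnion_cutArcs hfW hnW
          ((boundaryHomeo (branchAt U γ x : DiscAut)).isOpenMap _ (isOpen_component hfW hnW hx))
          fun y hy hy' => S.frontier_image_component hx hy hy'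
        refine ⟨(fun I => H '' I) '' θ, image_mono hθ, ?_⟩
        rw [sUnion_image, ← image_iUnion₂, ← sUnion_eq_biUnion, ← hO, ← Homeomorph.image_closure]
        simp only
        rw [hg' x hx, ← image_comp, ← image_comp]
        exact image_congr fun y _ => (hH _ y).symm
    · intro x
      obtain ⟨x, rfl⟩ := H.surjective x
      obtain ⟨i, hi, hfx⟩ := S.exists_branch x
      obtain ⟨y, hyU, hyW, hxy⟩ := exists_component_of_mem_closure hfW hnW (S.isOpen i) hi
      refine ⟨_, ⟨_, ⟨y, hyW, rfl⟩, rfl⟩, mem_image_of_mem _ hxy, ?_⟩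
      simp only [Function.comp_apply, H.symm_apply_apply]
      rw [hg' y hyW, S.branchAt_eq hyU, hfx, hH]

end Transport

end IsBranchSystem

/-! ### Fixed points of disk automorphisms -/

theorem apply_eq_iff {a b : ℂ} (h : Complex.normSq a - Complex.normSq b = 1) (z : ClosedDisc) :
    (discAut a b h : Equiv.Perm ClosedDisc) z = z ↔
      conj b * (z : ℂ) ^ 2 + (conj a - a) * z - b = 0 := by
  rw [Subtype.ext_iff, discAut_apply, div_eq_iff (denom_ne_zero h (closedDisc_norm_le z))]
  constructor <;> intro h <;> linear_combination -h

theorem eq_one_of_fixed {m : DiscAut} {z w : ClosedDisc} (hz : ‖(z : ℂ)‖ < 1) (hzw : w ≠ z)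
    (h1 : (m : Equiv.Perm ClosedDisc) z = z) (h2 : (m : Equiv.Perm ClosedDisc) w = w) : m = 1 := by
  obtain ⟨a, b, h, rfl⟩ := exists_coeff m
  rw [apply_eq_iff] at h1 h2
  have hne : (w : ℂ) - z ≠ 0 := sub_ne_zero.2 fun h => hzw (Subtype.ext h)
  have e1 : conj b * (w + z) + (conj a - a) = 0 := by
    apply mul_left_cancel₀ hne
    linear_combination h2 - h1
  have e2 : b = -(z * w * conj b) := by linear_combination z * e1 - h1
  have hb : b = 0 := by
    by_contra hb
    have h3 : ‖b‖ = ‖(z : ℂ)‖ * ‖(w : ℂ)‖ * ‖b‖ := by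
      conv_lhs => rw [e2]
      rw [norm_neg, norm_mul, norm_mul, RCLike.norm_conj]
    have h4 := closedDisc_norm_le w
    have h5 : 0 < ‖b‖ := norm_pos_iff.2 hb
    have h6 : ‖(z : ℂ)‖ * ‖(w : ℂ)‖ < 1 := by nlinarith [norm_nonneg (z : ℂ), norm_nonneg (w : ℂ)]
    nlinarith
  have ha : conj a = a := by
    rw [hb] at e1
    simpa [sub_eq_zero] using e1
  have ha0 : a ≠ 0 := by
    rintro rfl
    rw [hb] at h
    simp at h
  refine discAut_ext fun p => ?_
  rw [discAut_apply, hb, ha]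
  simp [ha0]

/-- A disk automorphism without fixed points on the circle has one in the open disk, since the
fixed point equation is invariant under the reflection in the circle. -/
theorem exists_fixed_of_forall_ne {m : DiscAut} (hm : ∀ x, boundaryMap m x ≠ x) :
    ∃ z : ClosedDisc, ‖(z : ℂ)‖ < 1 ∧ (m : Equiv.Perm ClosedDisc) z = z := by
  obtain ⟨a, b, h, rfl⟩ := exists_coeff m
  by_cases hb : b = 0
  · refine ⟨discCenter, by simp [discCenter], ?_⟩
    rw [apply_eq_iff]
    simp [discCenter, hb]
  have hcb : conj b ≠ 0 := by simpa using hb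
  obtain ⟨s, hs⟩ := IsAlgClosed.exists_pow_nat_eq (discrim (conj b) (conj a - a) (-b)) two_pos
  obtain ⟨z, hz⟩ := exists_quadratic_eq_zero hcb ⟨s, by rw [← hs, sq]⟩
  have hz' : conj b * z ^ 2 + (conj a - a) * z - b = 0 := by linear_combination hz
  rcases lt_trichotomy ‖z‖ 1 with hlt | heq | hgt
  · refine ⟨⟨z, mem_closedBall_zero_iff.2 hlt.le⟩, hlt, ?_⟩
    rw [apply_eq_iff]
    exact hz'
  · refine absurd ?_ (hm ⟨z, mem_sphere_zero_iff_norm.2 heq⟩)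
    have := (apply_eq_iff h (circlePt ⟨z, mem_sphere_zero_iff_norm.2 heq⟩)).2 hz'
    exact Circle.ext (congrArg (Subtype.val : ClosedDisc → ℂ) this)
  · have hz0 : z ≠ 0 := norm_pos_iff.1 (one_pos.trans hgt)
    have hcz0 : conj z ≠ 0 := by simpa using hz0
    have hlt : ‖(conj z)⁻¹‖ < 1 := by
      rw [norm_inv, RCLike.norm_conj]
      exact inv_lt_one_of_one_lt₀ hgt
    refine ⟨⟨(conj z)⁻¹, mem_closedBall_zero_iff.2 hlt.le⟩, hlt, ?_⟩
    rw [apply_eq_iff]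
    have h1 := congrArg conj hz'
    simp only [map_sub, map_add, map_mul, map_pow, Complex.conj_conj, map_zero] at h1
    change conj b * (conj z)⁻¹ ^ 2 + (conj a - a) * (conj z)⁻¹ - b = 0
    field_simp
    linear_combination -h1

/-- A group of disk automorphisms acts freely on the open disk if it has the same boundary
dynamics as a closed surface group: an automorphism is elliptic if and only if it has no fixed
point on the circle, which is a topological condition there. -/
theorem free_of_boundary_conj {G Γ : Subgroup DiscAut} (hΓ : IsClosedSurfaceGroup Γ) {φ : G ≃* Γ}
    {H : Circle ≃ₜ Circle} (hH : ∀ (g : G) (x : Circle),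
      H (boundaryMap (g : DiscAut) x) = boundaryMap (φ g : DiscAut) (H x)) :
    ∀ γ ∈ G, ∀ z : ClosedDisc, ‖(z : ℂ)‖ < 1 → (γ : Equiv.Perm ClosedDisc) z = z → γ = 1 := by
  intro γ hγ z hz hfix
  by_contra hne
  have h1 : ∀ x, boundaryMap (φ ⟨γ, hγ⟩ : DiscAut) x ≠ x := by
    intro y hy
    obtain ⟨x, rfl⟩ := H.surjective y
    rw [← hH, H.injective.eq_iff] at hy
    refine hne (eq_one_of_fixed (w := circlePt x) hz ?_ hfix ?_)
    · intro h
      rw [← h] at hz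
      exact hz.ne (Circle.norm_coe x)
    · rw [← circlePt_boundaryMap]
      exact congrArg circlePt hy
  obtain ⟨w, hw, hw'⟩ := exists_fixed_of_forall_ne h1
  have h2 := hΓ.free _ (φ ⟨γ, hγ⟩).2 w hw hw'
  have h3 : φ ⟨γ, hγ⟩ = 1 := Subtype.ext h2
  rw [map_eq_one_iff _ φ.injective] at h3
  exact hne (congrArg Subtype.val h3)

/-! ### Normal form of disk automorphisms -/

theorem normSq_sub_normSq_normalForm (t : ℝ) {p : ℂ} (hp : ‖p‖ < 1) :
    Complex.normSq ((1 / √(1 - ‖p‖ ^ 2) : ℝ) * Circle.exp (t / 2)) -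
      Complex.normSq ((1 / √(1 - ‖p‖ ^ 2) : ℝ) * (p * Circle.exp (-(t / 2)))) = 1 := by
  have h1 : 0 < 1 - ‖p‖ ^ 2 := by nlinarith [norm_nonneg p]
  rw [Complex.normSq_mul, Complex.normSq_mul, Complex.normSq_mul, Circle.normSq_coe,
    Circle.normSq_coe, Complex.normSq_ofReal, Complex.normSq_eq_norm_sq p, div_mul_div_comm,
    Real.mul_self_sqrt h1.le]
  field_simp

open Classical in
/-- The disk automorphism `z ↦ (e^{it} z + p) / (1 + conj p e^{it} z)`, where `|p| < 1`; it maps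
`0` to `p`, with derivative of argument `t`. (The value for `|p| ≥ 1` is the identity.) -/
noncomputable def diskIso (t : ℝ) (p : ℂ) : DiscAut :=
  if hp : ‖p‖ < 1 then discAut _ _ (normSq_sub_normSq_normalForm t hp) else 1

theorem diskIso_denom_ne_zero (t : ℝ) {p z : ℂ} (hp : ‖p‖ < 1) (hz : ‖z‖ ≤ 1) :
    1 + conj p * Circle.exp t * z ≠ 0 := by
  intro h
  have h1 : ‖conj p * Circle.exp t * z‖ = 1 := by
    rw [eq_neg_of_add_eq_zero_right h, norm_neg, norm_one]
  rw [norm_mul, norm_mul, Circle.norm_coe, RCLike.norm_conj] at h1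
  nlinarith [norm_nonneg p, norm_nonneg z]

theorem diskIso_apply (t : ℝ) {p : ℂ} (hp : ‖p‖ < 1) (z : ClosedDisc) :
    ((diskIso t p : Equiv.Perm ClosedDisc) z : ℂ) =
      (Circle.exp t * z + p) / (1 + conj p * Circle.exp t * z) := by
  have h1 : 0 < 1 - ‖p‖ ^ 2 := by nlinarith [norm_nonneg p]
  have hs : ((1 / √(1 - ‖p‖ ^ 2) : ℝ) : ℂ) ≠ 0 := by
    exact_mod_cast (one_div_pos.2 (Real.sqrt_pos.2 h1)).ne'
  rw [diskIso, dif_pos hp, discAut_apply,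
    div_eq_div_iff (denom_ne_zero (normSq_sub_normSq_normalForm t hp) (closedDisc_norm_le z))
      (diskIso_denom_ne_zero t hp (closedDisc_norm_le z))]
  have e1 : (Circle.exp t : ℂ) = Circle.exp (t / 2) * Circle.exp (t / 2) := by
    rw [← Circle.coe_mul, ← Circle.exp_add, add_halves]
  have e2 : conj (Circle.exp (t / 2) : ℂ) = Circle.exp (-(t / 2)) := by
    rw [← Circle.coe_inv_eq_conj, Circle.exp_neg]
  have e3 : conj (Circle.exp (-(t / 2)) : ℂ) = Circle.exp (t / 2) := by
    rw [← e2, Complex.conj_conj]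
  have e4 : (Circle.exp (t / 2) : ℂ) * Circle.exp (-(t / 2)) = 1 := by
    rw [← e2]; exact circle_mul_conj _
  simp only [map_mul, Complex.conj_ofReal, e2, e3, e1]
  generalize ((1 / √(1 - ‖p‖ ^ 2) : ℝ) : ℂ) = s at *
  generalize (Circle.exp (t / 2) : ℂ) = u at *
  generalize (Circle.exp (-(t / 2)) : ℂ) = v at *
  linear_combination (-(s * u * z * (1 - p * conj p))) * e4

theorem diskIso_zero_apply (t : ℝ) (z : ClosedDisc) :
    ((diskIso t 0 : Equiv.Perm ClosedDisc) z : ℂ) = Circle.exp t * z := by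
  rw [diskIso_apply t (by simp)]; simp

theorem diskIso_zero_add (s t : ℝ) : diskIso (s + t) 0 = diskIso s 0 * diskIso t 0 := by
  refine discAut_ext fun z => ?_
  change _ = ((diskIso s 0 : Equiv.Perm ClosedDisc) ((diskIso t 0 : Equiv.Perm ClosedDisc) z) : ℂ)
  rw [diskIso_zero_apply, diskIso_zero_apply, diskIso_zero_apply, Circle.exp_add, Circle.coe_mul,
    mul_assoc]

/-- Rotations, as a homomorphism. -/
noncomputable def rotHom : Multiplicative ℝ →* DiscAut where
  toFun t := diskIso t.toAdd 0
  map_one' := discAut_ext fun z => by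
    rw [toAdd_one, diskIso_zero_apply, Circle.exp_zero]; simp
  map_mul' s t := by rw [toAdd_mul, diskIso_zero_add]

theorem diskIso_zero_zpow (t : ℝ) (k : ℤ) : diskIso t 0 ^ k = diskIso (k * t) 0 := by
  have := map_zpow rotHom (Multiplicative.ofAdd t) k
  rw [← ofAdd_zsmul] at this
  simpa [rotHom] using this.symm

theorem boundaryMap_diskIso_zero (t : ℝ) (x : Circle) :
    boundaryMap (diskIso t 0) x = Circle.exp t * x :=
  Circle.ext (diskIso_zero_apply t (circlePt x))

theorem diskIso_two_pi : diskIso (2 * π) 0 = 1 :=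
  discAut_ext fun z => by rw [diskIso_zero_apply]; simp

/-! ### Geodesics under disk automorphisms -/

/-- The equation of a geodesic, pulled back by a disk automorphism. -/
theorem SatisfiesGeodesicEq.transform {c : ℂ} {d : ℝ} {a b : ℂ}
    (h : Complex.normSq a - Complex.normSq b = 1) {w : ClosedDisc} 
    (hz : SatisfiesGeodesicEq c d ((discAut a b h : Equiv.Perm ClosedDisc) w)) :
    SatisfiesGeodesicEq (c * conj a ^ 2 + conj c * b ^ 2 - 2 * d * conj a * b)
      (d * (Complex.normSq a + Complex.normSq b) - 2 * (conj c * a * b).re) w := by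
  have hd := denom_ne_zero h (closedDisc_norm_le w)
  have hd' := (Complex.normSq_pos.2 hd).ne'
  unfold SatisfiesGeodesicEq at *
  rw [discAut_apply, ← Complex.normSq_eq_norm_sq] at hz
  have e1 : conj c * ((a * w + b) / (conj b * w + conj a)) =
      (conj c * (a * w + b) * conj (conj b * w + conj a)) *
        ((Complex.normSq (conj b * w + conj a))⁻¹ : ℝ) := by
    rw [div_eq_mul_inv, Complex.inv_def]; ring
  rw [e1, Complex.re_mul_ofReal, map_div₀, ← mul_left_inj' hd', mul_assoc, add_mul, one_mul,
    div_mul_cancel₀ _ hd', mul_assoc, inv_mul_cancel_right₀ hd'] at hz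
  rw [← Complex.normSq_eq_norm_sq, ← sub_eq_zero] at *
  rw [← hz]
  simp [Complex.normSq_apply, pow_two]
  ring

theorem onGeodesic_of_apply {m : DiscAut} {p q z : ClosedDisc}
    (h : OnGeodesic ((m : Equiv.Perm ClosedDisc) p) ((m : Equiv.Perm ClosedDisc) q)
      ((m : Equiv.Perm ClosedDisc) z)) : OnGeodesic p q z := by
  obtain ⟨a, b, hab, rfl⟩ := exists_coeff m
  obtain ⟨c, d, h1, h2, h3, h4⟩ := h
  refine ⟨_, _, ?_, h2.transform, h3.transform, h4.transform⟩
  rw [← sq_lt_sq₀ (abs_nonneg _) (norm_nonneg _), sq_abs, ← Complex.normSq_eq_norm_sq] at *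
  have : Complex.normSq (c * conj a ^ 2 + conj c * b ^ 2 - 2 * d * conj a * b) -
      (d * (Complex.normSq a + Complex.normSq b) - 2 * (conj c * a * b).re) ^ 2 =
      (Complex.normSq c - d ^ 2) * (Complex.normSq a - Complex.normSq b) ^ 2 := by
    simp [Complex.normSq_apply, pow_two]
    ring
  rw [hab] at this
  nlinarith

theorem onGeodesic_apply_iff (m : DiscAut) (p q z : ClosedDisc) :
    OnGeodesic ((m : Equiv.Perm ClosedDisc) p) ((m : Equiv.Perm ClosedDisc) q)
      ((m : Equiv.Perm ClosedDisc) z) ↔ OnGeodesic p q z := by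
  refine ⟨onGeodesic_of_apply, fun h => onGeodesic_of_apply (m := m⁻¹) ?_⟩
  have e : ∀ w, ((m⁻¹ : DiscAut) : Equiv.Perm ClosedDisc) ((m : Equiv.Perm ClosedDisc) w) = w :=
    fun w => (m : Equiv.Perm ClosedDisc).symm_apply_apply w
  rwa [e, e, e]

theorem onGeodesic_zero_real_iff {s : ℝ} (hs : s ≠ 0) {z : ℂ} :
    OnGeodesic 0 s z ↔ z.im = 0 := by
  constructor
  · rintro ⟨c, d, hd, h1, h2, h3⟩
    have hd0 : d = 0 := by simpa [SatisfiesGeodesicEq] using h1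
    subst hd0
    simp only [SatisfiesGeodesicEq, zero_mul, Complex.mul_re, Complex.conj_re, Complex.conj_im,
      Complex.ofReal_re, Complex.ofReal_im] at h2 h3
    have hc : c.re = 0 := by
      have : c.re * s = 0 := by linarith
      exact (mul_eq_zero.1 this).resolve_right hs
    have hci : c.im ≠ 0 := by
      intro h
      have : c = 0 := Complex.ext hc h
      simp [this] at hd
    rw [hc] at h3
    have : c.im * z.im = 0 := by linarith
    exact (mul_eq_zero.1 this).resolve_left hci
  · intro h
    refine ⟨Complex.I, 0, by simp, ?_, ?_, ?_⟩ <;> simp [SatisfiesGeodesicEq, h]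

/-! ### The triangle group of the regular polygon -/

/-- Half the angle under which a side of the regular `4g`-gon is seen from its centre. -/
noncomputable def sideAngle (g : ℕ) : ℝ := π / (4 * g)

/-- The distance of the vertices of the regular `4g`-gon from the centre. -/
noncomputable def vertexRadius (g : ℕ) : ℝ := √(cos (π / (2 * g)))

/-- The image of `0` under the half-turn exchanging two adjacent vertices of the regular `4g`-gon
has this distance from `0`; it is also the distance from `0` of a vertex adjacent to `0` in a
copy of the polygon with a vertex at `0`. -/
noncomputable def sideRadius (g : ℕ) : ℝ := vertexRadius g / cos (sideAngle g)

/-- The rotation of the polygon by one side. -/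
noncomputable def rot (g : ℕ) : DiscAut := diskIso (2 * sideAngle g) 0

/-- The half-turn about the midpoint of a side, for the copy of the polygon with one vertex of
this side at `0` and the other on the positive real axis. -/
noncomputable def halfTurn (g : ℕ) : DiscAut := diskIso π (sideRadius g)

/-- The automorphism mapping `0` to vertex `0` of the polygon, and the positive real axis to the
ray through vertex `1`. -/
noncomputable def baseFrame (g : ℕ) : DiscAut := diskIso (π - sideAngle g) (vertexRadius g)

/-- The automorphism mapping `0` to vertex `k` of the polygon, and the positive real axis to the
ray through vertex `k + 1`. -/
noncomputable def frame (g : ℕ) (k : ℤ) : DiscAut := rot g ^ k * baseFrame g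

variable {g : ℕ}

theorem sideAngle_pos (hg : 2 ≤ g) : 0 < sideAngle g := by
  have : (0 : ℝ) < g := by exact_mod_cast (by omega : 0 < g)
  exact div_pos pi_pos (by positivity)

theorem sideAngle_mul (hg : 2 ≤ g) : 4 * g * sideAngle g = π := by
  have : (0 : ℝ) < g := by exact_mod_cast (by omega : 0 < g)
  rw [sideAngle]; field_simp

theorem sideAngle_le (hg : 2 ≤ g) : sideAngle g ≤ π / 8 := by
  have : (2 : ℝ) ≤ g := by exact_mod_cast hg
  exact div_le_div_of_nonneg_left pi_pos.le (by norm_num) (by linarith)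

theorem pi_div_two_mul (hg : 2 ≤ g) : π / (2 * g) = 2 * sideAngle g := by
  have : (0 : ℝ) < g := by exact_mod_cast (by omega : 0 < g)
  rw [sideAngle]; field_simp; norm_num

theorem cos_two_sideAngle_gt (hg : 2 ≤ g) : 7 / 10 < cos (2 * sideAngle g) := by
  have h1 : cos (π / 4) ≤ cos (2 * sideAngle g) :=
    cos_le_cos_of_nonneg_of_le_pi (by linarith [sideAngle_pos hg]) (by linarith [pi_pos])
      (by linarith [sideAngle_le hg])
  rw [cos_pi_div_four] at h1
  have h2 : (14 / 10 : ℝ) < √2 := by rw [Real.lt_sqrt] <;> norm_num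
  linarith

theorem vertexRadius_sq (hg : 2 ≤ g) : vertexRadius g ^ 2 = cos (2 * sideAngle g) := by
  rw [vertexRadius, pi_div_two_mul hg, Real.sq_sqrt]
  linarith [cos_two_sideAngle_gt hg]

theorem vertexRadius_pos (hg : 2 ≤ g) : 0 < vertexRadius g := by
  rw [vertexRadius, pi_div_two_mul hg]
  exact Real.sqrt_pos.2 (by linarith [cos_two_sideAngle_gt hg])

theorem cos_sideAngle_pos (hg : 2 ≤ g) : 0 < cos (sideAngle g) :=
  cos_pos_of_mem_Ioo ⟨by linarith [sideAngle_pos hg, pi_pos], by linarith [sideAngle_le hg, pi_pos]⟩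

theorem sin_sideAngle_pos (hg : 2 ≤ g) : 0 < sin (sideAngle g) :=
  sin_pos_of_pos_of_lt_pi (sideAngle_pos hg) (by linarith [sideAngle_le hg, pi_pos])

theorem vertexRadius_lt_one (hg : 2 ≤ g) : vertexRadius g < 1 := by
  have h1 := vertexRadius_sq hg
  rw [cos_two_mul'] at h1
  have h2 := sin_sideAngle_pos hg
  nlinarith [sin_sq_add_cos_sq (sideAngle g), vertexRadius_pos hg]

theorem norm_vertexRadius (hg : 2 ≤ g) : ‖(vertexRadius g : ℂ)‖ < 1 := by
  rw [Complex.norm_real, Real.norm_of_nonneg (vertexRadius_pos hg).le]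
  exact vertexRadius_lt_one hg

theorem sideRadius_mul_cos (hg : 2 ≤ g) :
    sideRadius g * cos (sideAngle g) = vertexRadius g :=
  div_mul_cancel₀ _ (cos_sideAngle_pos hg).ne'

theorem sideRadius_pos (hg : 2 ≤ g) : 0 < sideRadius g :=
  div_pos (vertexRadius_pos hg) (cos_sideAngle_pos hg)

theorem sideRadius_sq_mul (hg : 2 ≤ g) : sideRadius g ^ 2 * cos (sideAngle g) ^ 2 =
    cos (sideAngle g) ^ 2 - sin (sideAngle g) ^ 2 := by
  rw [← mul_pow, sideRadius_mul_cos hg, vertexRadius_sq hg, cos_two_mul']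

theorem sideRadius_lt_one (hg : 2 ≤ g) : sideRadius g < 1 := by
  have h1 := sideRadius_sq_mul hg
  have h2 := sin_sideAngle_pos hg
  have h3 := cos_sideAngle_pos hg
  by_contra h
  rw [not_lt] at h
  nlinarith [mul_le_mul_of_nonneg_right (pow_le_pow_left₀ zero_le_one h 2)
    (sq_nonneg (cos (sideAngle g)))]

theorem norm_sideRadius (hg : 2 ≤ g) : ‖(sideRadius g : ℂ)‖ < 1 := by
  rw [Complex.norm_real, Real.norm_of_nonneg (sideRadius_pos hg).le]
  exact sideRadius_lt_one hg

theorem exp_sideAngle (g : ℕ) : (Circle.exp (sideAngle g) : ℂ) =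
    cos (sideAngle g) + sin (sideAngle g) * Complex.I := by
  rw [Circle.coe_exp, Complex.exp_mul_I]; push_cast; rfl

theorem exp_neg_sideAngle (g : ℕ) : (Circle.exp (-sideAngle g) : ℂ) =
    cos (sideAngle g) - sin (sideAngle g) * Complex.I := by
  rw [Circle.coe_exp, Complex.exp_mul_I]; push_cast; simp [sub_eq_add_neg]

theorem exp_two_sideAngle (g : ℕ) : (Circle.exp (2 * sideAngle g) : ℂ) =
    (Circle.exp (sideAngle g) : ℂ) ^ 2 := by
  rw [two_mul, Circle.exp_add, sq]; rfl

theorem exp_sideAngle_mul (g : ℕ) :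
    (Circle.exp (sideAngle g) : ℂ) * Circle.exp (-sideAngle g) = 1 := by
  rw [← Circle.coe_mul, ← Circle.exp_add]; simp

theorem circle_exp_pi : Circle.exp π = -1 := by ext; simp

theorem exp_pi_sub (g : ℕ) : (Circle.exp (π - sideAngle g) : ℂ) = -Circle.exp (-sideAngle g) := by
  rw [sub_eq_add_neg, Circle.exp_add, circle_exp_pi]; simp

theorem exp_add_exp_neg_mul (hg : 2 ≤ g) : (sideRadius g : ℂ) *
    (Circle.exp (sideAngle g) + Circle.exp (-sideAngle g)) = 2 * vertexRadius g := by
  rw [exp_sideAngle, exp_neg_sideAngle, ← sideRadius_mul_cos hg]; push_cast; ring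

theorem two_vertexRadius_sq (hg : 2 ≤ g) : 2 * (vertexRadius g : ℂ) ^ 2 =
    (Circle.exp (sideAngle g) : ℂ) ^ 2 + (Circle.exp (-sideAngle g) : ℂ) ^ 2 := by
  have : (vertexRadius g : ℂ) ^ 2 = cos (sideAngle g) ^ 2 - sin (sideAngle g) ^ 2 := by
    rw [← Complex.ofReal_pow, vertexRadius_sq hg, cos_two_mul']; push_cast; rfl
  rw [exp_sideAngle, exp_neg_sideAngle, this]
  linear_combination (-2 * (sin (sideAngle g) : ℂ) ^ 2) * Complex.I_sq

theorem baseFrame_apply (hg : 2 ≤ g) (z : ClosedDisc) :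
    ((baseFrame g : Equiv.Perm ClosedDisc) z : ℂ) =
      (vertexRadius g - Circle.exp (-sideAngle g) * z) /
        (1 - vertexRadius g * Circle.exp (-sideAngle g) * z) := by
  rw [baseFrame, diskIso_apply _ (norm_vertexRadius hg), exp_pi_sub, Complex.conj_ofReal]
  congr 1 <;> ring

theorem baseFrame_denom_ne_zero (hg : 2 ≤ g) (z : ClosedDisc) :
    1 - (vertexRadius g : ℂ) * Circle.exp (-sideAngle g) * z ≠ 0 := by
  have := diskIso_denom_ne_zero (π - sideAngle g) (norm_vertexRadius hg) (closedDisc_norm_le z)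
  rwa [exp_pi_sub, Complex.conj_ofReal, mul_neg, neg_mul, ← sub_eq_add_neg] at this

theorem halfTurn_apply (hg : 2 ≤ g) (z : ClosedDisc) :
    ((halfTurn g : Equiv.Perm ClosedDisc) z : ℂ) =
      (sideRadius g - z) / (1 - sideRadius g * z) := by
  rw [halfTurn, diskIso_apply _ (norm_sideRadius hg), circle_exp_pi, Complex.conj_ofReal]
  congr 1 <;> simp <;> ring

theorem halfTurn_denom_ne_zero (hg : 2 ≤ g) (z : ClosedDisc) :
    1 - (sideRadius g : ℂ) * z ≠ 0 := by
  have := diskIso_denom_ne_zero π (norm_sideRadius hg) (closedDisc_norm_le z)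
  rw [circle_exp_pi, Complex.conj_ofReal] at this
  simpa [sub_eq_add_neg] using this

theorem rot_apply (g : ℕ) (z : ClosedDisc) : ((rot g : Equiv.Perm ClosedDisc) z : ℂ) =
    Circle.exp (2 * sideAngle g) * z := diskIso_zero_apply _ _

theorem coe_mul_apply (m n : DiscAut) (z : ClosedDisc) :
    ((m * n : DiscAut) : Equiv.Perm ClosedDisc) z =
      (m : Equiv.Perm ClosedDisc) ((n : Equiv.Perm ClosedDisc) z) := rfl

theorem halfTurn_mul_self (hg : 2 ≤ g) : halfTurn g * halfTurn g = 1 := by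
  refine discAut_ext fun z => ?_
  have d1 := halfTurn_denom_ne_zero hg z
  have d2 := halfTurn_denom_ne_zero hg ((halfTurn g : Equiv.Perm ClosedDisc) z)
  have e := (eq_div_iff d1).1 (halfTurn_apply hg z)
  rw [coe_mul_apply, halfTurn_apply hg, div_eq_iff d2]
  change _ = (z : ℂ) * _
  linear_combination -e

/-- The relation of the triangle group: rotation about the centre, half-turn about the midpoint of
a side, and rotation about a vertex. -/
theorem baseFrame_mul_halfTurn (hg : 2 ≤ g) :
    baseFrame g * halfTurn g = rot g * baseFrame g * rot g := by
  refine discAut_ext fun z => ?_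
  have d1 := halfTurn_denom_ne_zero hg z
  have d2 := baseFrame_denom_ne_zero hg ((halfTurn g : Equiv.Perm ClosedDisc) z)
  have d3 := baseFrame_denom_ne_zero hg ((rot g : Equiv.Perm ClosedDisc) z)
  have e := (eq_div_iff d1).1 (halfTurn_apply hg z)
  simp only [coe_mul_apply]
  rw [baseFrame_apply hg, rot_apply, baseFrame_apply hg, ← mul_div_assoc, div_eq_div_iff d2 d3]
  rw [rot_apply] at *
  have r1 := exp_add_exp_neg_mul hg
  have r2 := two_vertexRadius_sq hg
  have r3 := exp_sideAngle_mul g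
  rw [exp_two_sideAngle] at *
  apply mul_left_cancel₀ d1
  generalize ((halfTurn g : Equiv.Perm ClosedDisc) z : ℂ) = z' at *
  generalize (Circle.exp (sideAngle g) : ℂ) = ε at *
  generalize (Circle.exp (-sideAngle g) : ℂ) = ε' at *
  generalize (vertexRadius g : ℂ) = R at *
  generalize (sideRadius g : ℂ) = ρ at *
  generalize (z : ℂ) = z at *
  have hε : ε' * ε ^ 2 = ε := by linear_combination ε * r3
  have i2 : ε ^ 3 - R ^ 2 * ε = -(ε' - ε * R ^ 2) := by
    linear_combination -ε * r2 - ε' * r3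
  have i1 : R * (1 - ε ^ 2) = ρ * (ε' - ε * R ^ 2) := by
    have : 2 * (R * (1 - ε ^ 2)) = 2 * (ρ * (ε' - ε * R ^ 2)) := by
      linear_combination (-(1 - ε ^ 2)) * r1 + ρ * ε * r2 + ρ * (ε' - ε) * r3
    exact mul_left_cancel₀ two_ne_zero this
  rw [show ε' * (ε ^ 2 * z) = ε * z by linear_combination z * hε,
    show R * ε' * (ε ^ 2 * z) = R * (ε * z) by linear_combination R * z * hε]
  linear_combination (-(ε' - ε * R ^ 2) + R * (1 - ε ^ 2) * z) * e + (1 - z ^ 2) * i1 +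
    (z - ρ * z ^ 2) * i2 + (1 - ρ * z) * R * (R - ε * z) * z' * hε + (1 - ρ * z) * R * z * z' * r3

theorem rot_pow (hg : 2 ≤ g) : rot g ^ (4 * g) = 1 := by
  have := diskIso_zero_zpow (2 * sideAngle g) (4 * g : ℕ)
  rw [zpow_natCast] at this
  rw [rot, this, show ((4 * g : ℕ) : ℤ) * (2 * sideAngle g) = 2 * (4 * g * sideAngle g) by
    push_cast; ring, sideAngle_mul hg, diskIso_two_pi]

/-! ### The net of the standard group -/

theorem smul_eq (m : DiscAut) (z : ClosedDisc) : m • z = (m : Equiv.Perm ClosedDisc) z := rfl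

/-- The frame of the next vertex: move along the side, then turn by the angle of the polygon. -/
theorem frame_succ (hg : 2 ≤ g) (k : ℤ) :
    frame g (k + 1) = frame g k * halfTurn g * (rot g)⁻¹ := by
  rw [frame, frame, mul_assoc (rot g ^ k), baseFrame_mul_halfTurn hg]
  group

theorem halfTurn_inv (hg : 2 ≤ g) : (halfTurn g)⁻¹ = halfTurn g :=
  inv_eq_of_mul_eq_one_right (halfTurn_mul_self hg)

theorem frame_pred (hg : 2 ≤ g) (k : ℤ) :
    frame g (k - 1) = frame g k * rot g * halfTurn g := by
  have := frame_succ hg (k - 1)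
  rw [sub_add_cancel] at this
  rw [this, inv_mul_cancel_right, mul_assoc, halfTurn_mul_self hg, mul_one]

theorem rot_zpow_mul (hg : 2 ≤ g) (n : ℤ) : rot g ^ (4 * g * n : ℤ) = 1 := by
  rw [zpow_mul, show (4 * g : ℤ) = ((4 * g : ℕ) : ℤ) by push_cast; rfl, zpow_natCast, rot_pow hg,
    one_zpow]

theorem frame_add_mul (hg : 2 ≤ g) (k n : ℤ) : frame g (k + 4 * g * n) = frame g k := by
  rw [frame, zpow_add, rot_zpow_mul hg, mul_one, frame]

theorem rot_zpow_smul_center (g : ℕ) (k : ℤ) : rot g ^ k • discCenter = discCenter := by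
  refine Subtype.ext ?_
  rw [rot, diskIso_zero_zpow, smul_eq, diskIso_zero_apply]
  simp [discCenter]

theorem rot_smul_center (g : ℕ) : rot g • discCenter = discCenter := by
  simpa using rot_zpow_smul_center g 1

theorem vertex_eq (hg : 2 ≤ g) (k : ℤ) : vertex g k = frame g k • discCenter := by
  refine Subtype.ext ?_
  rw [frame, mul_smul, rot, diskIso_zero_zpow, smul_eq, diskIso_zero_apply, smul_eq,
    baseFrame_apply hg]
  have : 2 * π * k / (4 * g) = k * (2 * sideAngle g) := by rw [sideAngle]; ring
  simp only [vertex, this, discCenter, vertexRadius]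
  simp [mul_comm]

theorem vertex_succ (hg : 2 ≤ g) (k : ℤ) :
    vertex g (k + 1) = frame g k • halfTurn g • discCenter := by
  rw [vertex_eq hg, frame_succ hg, mul_smul, mul_smul, inv_smul_eq_iff.2 (rot_smul_center g).symm]

theorem vertex_pred (hg : 2 ≤ g) (k : ℤ) :
    vertex g (k - 1) = frame g k • rot g • halfTurn g • discCenter := by
  rw [vertex_eq hg, frame_pred hg, mul_smul, mul_smul]

theorem pairedSide_pairedSide (k : ℤ) : pairedSide (pairedSide k) = k := by
  unfold pairedSide; split_ifs <;> omega

theorem pairedSide_add_mul (k n : ℤ) : pairedSide (k + 4 * g * n) = pairedSide k + 4 * g * n := by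
  have h : (k + 4 * g * n) % 4 = k % 4 := by
    rw [mul_assoc]; omega
  unfold pairedSide
  rw [h]
  split_ifs <;> ring

/-- The side pairing of side `k`. -/
noncomputable def sidePairing (g : ℕ) (k : ℤ) : DiscAut :=
  frame g (pairedSide k) * halfTurn g * (frame g k)⁻¹

theorem norm_smul_center_lt (m : DiscAut) : ‖((m • discCenter : ClosedDisc) : ℂ)‖ < 1 :=
  norm_apply_center_lt m

theorem halfTurn_smul_center (hg : 2 ≤ g) :
    ((halfTurn g • discCenter : ClosedDisc) : ℂ) = sideRadius g := by
  rw [smul_eq, halfTurn_apply hg]; simp [discCenter]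

theorem halfTurn_smul_center_ne (hg : 2 ≤ g) : halfTurn g • discCenter ≠ discCenter := by
  intro h
  have h1 := halfTurn_smul_center hg
  rw [h] at h1
  have : (sideRadius g : ℂ) = 0 := h1.symm
  exact (sideRadius_pos hg).ne' (by exact_mod_cast this)

theorem isSidePairing_iff (hg : 2 ≤ g) {k : ℤ} {γ : DiscAut} :
    IsSidePairing g k γ ↔ γ = sidePairing g k := by
  have hex : sidePairing g k • vertex g k = vertex g (pairedSide k + 1) ∧
      sidePairing g k • vertex g (k + 1) = vertex g (pairedSide k) := by
    rw [vertex_eq hg k, vertex_succ hg, vertex_succ hg k, vertex_eq hg, sidePairing]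
    simp only [mul_smul, inv_smul_smul]
    refine ⟨trivial, ?_⟩
    rw [← mul_smul (halfTurn g), halfTurn_mul_self hg, one_smul]
  constructor
  · rintro ⟨h1, h2⟩
    have h1' : γ • vertex g k = vertex g (pairedSide k + 1) := h1
    have h2' : γ • vertex g (k + 1) = vertex g (pairedSide k) := h2
    refine (inv_mul_eq_one.1 (eq_one_of_fixed (z := vertex g k) (w := vertex g (k + 1))
      ?_ ?_ ?_ ?_)).symm
    · rw [vertex_eq hg]; exact norm_smul_center_lt _
    · rw [vertex_succ hg, vertex_eq hg]
      exact fun h => halfTurn_smul_center_ne hg (smul_left_cancel _ h)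
    · change ((sidePairing g k)⁻¹ * γ) • vertex g k = vertex g k
      rw [mul_smul, h1', inv_smul_eq_iff, hex.1]
    · change ((sidePairing g k)⁻¹ * γ) • vertex g (k + 1) = vertex g (k + 1)
      rw [mul_smul, h2', inv_smul_eq_iff, hex.2]
  · rintro rfl
    exact hex

theorem sidePairing_mem (hg : 2 ≤ g) (k : ℤ) : sidePairing g k ∈ standardGroup g :=
  Subgroup.subset_closure ⟨k, (isSidePairing_iff hg).2 rfl⟩

theorem sidePairing_mul_frame (g : ℕ) (k : ℤ) :
    sidePairing g k * frame g k = frame g (pairedSide k) * halfTurn g := by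
  rw [sidePairing, inv_mul_cancel_right]

/-- The frames of the net: automorphisms mapping `0` to a vertex of the net and the positive
real axis to a ray through an edge at this vertex. -/
def netFrames (g : ℕ) : Set DiscAut := {M | ∃ γ ∈ standardGroup g, ∃ j : ℤ, M = γ * frame g j}

theorem frame_mem_netFrames (k : ℤ) : frame g k ∈ netFrames g :=
  ⟨1, one_mem _, k, (one_mul _).symm⟩

theorem mul_mem_netFrames {γ M : DiscAut} (hγ : γ ∈ standardGroup g) (hM : M ∈ netFrames g) :
    γ * M ∈ netFrames g := by
  obtain ⟨γ', hγ', j, rfl⟩ := hM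
  exact ⟨γ * γ', mul_mem hγ hγ', j, (mul_assoc _ _ _).symm⟩

theorem frame_mul_halfTurn (g : ℕ) (k : ℤ) :
    frame g k * halfTurn g = sidePairing g (pairedSide k) * frame g (pairedSide k) := by
  rw [sidePairing_mul_frame, pairedSide_pairedSide]

theorem mul_halfTurn_mem_netFrames (hg : 2 ≤ g) {M : DiscAut} (hM : M ∈ netFrames g) :
    M * halfTurn g ∈ netFrames g := by
  obtain ⟨γ, hγ, j, rfl⟩ := hM
  rw [mul_assoc, frame_mul_halfTurn]
  exact mul_mem_netFrames hγ (mul_mem_netFrames (sidePairing_mem hg _) (frame_mem_netFrames _))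

theorem frame_mul_rot (hg : 2 ≤ g) (k : ℤ) :
    frame g k * rot g = frame g (k - 1) * halfTurn g := by
  rw [frame_pred hg, mul_assoc _ (halfTurn g), halfTurn_mul_self hg, mul_one]

theorem mul_rot_mem_netFrames (hg : 2 ≤ g) {M : DiscAut} (hM : M ∈ netFrames g) :
    M * rot g ∈ netFrames g := by
  obtain ⟨γ, hγ, j, rfl⟩ := hM
  rw [mul_assoc, frame_mul_rot hg]
  exact mul_mem_netFrames hγ (mul_halfTurn_mem_netFrames hg (frame_mem_netFrames _))

theorem mul_rot_zpow_mem_netFrames (hg : 2 ≤ g) {M : DiscAut} (hM : M ∈ netFrames g) (n : ℤ) :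
    M * rot g ^ n ∈ netFrames g := by
  have hnat : ∀ n : ℕ, M * rot g ^ n ∈ netFrames g := by
    intro n
    induction n with
    | zero => simpa using hM
    | succ n ih => rw [pow_succ, ← mul_assoc]; exact mul_rot_mem_netFrames hg ih
  have hg' : (0 : ℤ) < 4 * g := by omega
  have h1 : rot g ^ n = rot g ^ (n % (4 * g)).toNat := by
    rw [← zpow_natCast, Int.toNat_of_nonneg (Int.emod_nonneg _ hg'.ne')]
    conv_lhs => rw [← Int.emod_add_mul_ediv n (4 * g), zpow_add, rot_zpow_mul hg, mul_one]
  rw [h1]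
  exact hnat _

/-- All corners of the polygon meet at each vertex of the net: the corners `j` and `l` are related
if a translate of the polygon with corner `l` at vertex `j` arises by rotating about vertex `j`. -/
theorem exists_mul_frame_mul_rot (hg : 2 ≤ g) (j l : ℤ) :
    ∃ γ ∈ standardGroup g, ∃ i : ℤ, frame g l = γ * frame g j * rot g ^ i := by
  let Rel : ℤ → ℤ → Prop := fun j l =>
    ∃ γ ∈ standardGroup g, ∃ i : ℤ, frame g l = γ * frame g j * rot g ^ i
  have hsymm : ∀ {j l}, Rel j l → Rel l j := by
    rintro j l ⟨γ, hγ, i, h⟩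
    exact ⟨γ⁻¹, inv_mem hγ, -i, by rw [h]; group⟩
  have htrans : ∀ {j l m}, Rel j l → Rel l m → Rel j m := by
    rintro j l m ⟨γ, hγ, i, h⟩ ⟨γ', hγ', i', h'⟩
    exact ⟨γ' * γ, mul_mem hγ' hγ, i + i', by rw [h', h]; group⟩
  have hstep : ∀ j, Rel j (pairedSide (j - 1)) := by
    intro j
    refine ⟨(sidePairing g (pairedSide (j - 1)))⁻¹, inv_mem (sidePairing_mem hg _), 1, ?_⟩
    rw [zpow_one, mul_assoc, frame_mul_rot hg, frame_mul_halfTurn, inv_mul_cancel_left]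
  have h1 : ∀ j : ℤ, j % 4 = 1 → Rel j (j + 1) := fun j hj => by
    have := hstep j
    rwa [pairedSide, if_pos (by omega), show j - 1 + 2 = j + 1 by ring] at this
  have h2 : ∀ j : ℤ, j % 4 = 2 → Rel j (j + 1) := fun j hj => by
    have := hstep j
    rwa [pairedSide, if_pos (by omega), show j - 1 + 2 = j + 1 by ring] at this
  have h3 : ∀ j : ℤ, j % 4 = 3 → Rel j (j - 3) := fun j hj => by
    have := hstep j
    rwa [pairedSide, if_neg (by omega), show j - 1 - 2 = j - 3 by ring] at this
  have h4 : ∀ j : ℤ, j % 4 = 0 → Rel j (j - 3) := fun j hj => by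
    have := hstep j
    rwa [pairedSide, if_neg (by omega), show j - 1 - 2 = j - 3 by ring] at this
  have hrefl : ∀ j, Rel j j := fun j => ⟨1, one_mem _, 0, by simp⟩
  have h12 : ∀ m : ℤ, Rel (4 * m + 1) (4 * m + 2) := fun m => by
    have := h1 (4 * m + 1) (by omega)
    rwa [add_assoc] at this
  have h13 : ∀ m : ℤ, Rel (4 * m + 1) (4 * m + 3) := fun m =>
    htrans (h12 m) (by have := h2 (4 * m + 2) (by omega); rwa [add_assoc] at this)
  have h14 : ∀ m : ℤ, Rel (4 * m + 1) (4 * m) := fun m =>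
    htrans (h13 m) (by have := h3 (4 * m + 3) (by omega); rwa [add_sub_cancel_right] at this)
  have h15 : ∀ m : ℤ, Rel (4 * m + 1) (4 * (m - 1) + 1) := fun m =>
    htrans (h14 m) (by
      have := h4 (4 * m) (by omega); rwa [show 4 * m - 3 = 4 * (m - 1) + 1 by ring] at this)
  have hall : ∀ m : ℤ, Rel (4 * m + 1) 1 := by
    intro m
    induction m using Int.induction_on with
    | zero => exact hrefl 1
    | succ m ih =>
      have := h15 (m + 1)
      rw [add_sub_cancel_right] at this
      exact htrans this ih
    | pred m ih => exact htrans (hsymm (h15 (-m))) ih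
  have hone : ∀ j, Rel j 1 := by
    intro j
    obtain ⟨m, hm⟩ : ∃ m, j = 4 * m ∨ j = 4 * m + 1 ∨ j = 4 * m + 2 ∨ j = 4 * m + 3 :=
      ⟨j / 4, by omega⟩
    rcases hm with rfl | rfl | rfl | rfl
    · exact htrans (hsymm (h14 m)) (hall m)
    · exact hall m
    · exact htrans (hsymm (h12 m)) (hall m)
    · exact htrans (hsymm (h13 m)) (hall m)
  exact htrans (hone j) (hsymm (hone l))

/-- The group `G` acts freely on the open disk. -/
def ActsFreely (G : Subgroup DiscAut) : Prop :=
  ∀ γ ∈ G, ∀ z : ClosedDisc, ‖(z : ℂ)‖ < 1 → γ • z = z → γ = 1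

/-- Two frames of the net with the same origin differ by a rotation. -/
theorem eq_mul_rot_of_smul_center_eq (hg : 2 ≤ g) (hfree : ActsFreely (standardGroup g))
    {M M' : DiscAut} (hM : M ∈ netFrames g) (hM' : M' ∈ netFrames g)
    (h : M • discCenter = M' • discCenter) : ∃ i : ℤ, M' = M * rot g ^ i := by
  obtain ⟨γ, hγ, j, rfl⟩ := hM
  obtain ⟨γ', hγ', l, rfl⟩ := hM'
  obtain ⟨β, hβ, i, hi⟩ := exists_mul_frame_mul_rot hg j l
  refine ⟨i, ?_⟩
  have h1 : frame g l • discCenter = (β * frame g j) • discCenter := by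
    rw [hi, mul_smul _ (rot g ^ i), rot_zpow_smul_center]
  have h2 : γ⁻¹ * γ' * β = 1 := by
    refine hfree _ (mul_mem (mul_mem (inv_mem hγ) hγ') hβ) (frame g j • discCenter)
      (norm_smul_center_lt _) ?_
    rw [mul_smul, ← mul_smul β, ← h1, mul_smul, ← mul_smul γ', ← h, mul_smul, inv_smul_smul]
  rw [hi, ← mul_assoc, ← mul_assoc, show γ' * β = γ by
    rw [mul_assoc, inv_mul_eq_one] at h2; exact h2.symm]

theorem netAdj_iff (hg : 2 ≤ g) {p q : ClosedDisc} : NetAdj g p q ↔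
    ∃ M ∈ netFrames g, p = M • discCenter ∧ q = M • halfTurn g • discCenter := by
  constructor
  · rintro ⟨γ, hγ, k, ⟨hp, hq⟩ | ⟨hq, hp⟩⟩
    · refine ⟨γ * frame g k, ⟨γ, hγ, k, rfl⟩, ?_, ?_⟩
      · rw [hp, vertex_eq hg, mul_smul]; rfl
      · rw [hq, vertex_succ hg, mul_smul]; rfl
    · refine ⟨γ * frame g k * halfTurn g,
        mul_halfTurn_mem_netFrames hg ⟨γ, hγ, k, rfl⟩, ?_, ?_⟩
      · rw [hp, vertex_succ hg, mul_smul, mul_smul]; rfl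
      · rw [hq, vertex_eq hg, mul_smul, mul_smul, ← mul_smul (halfTurn g),
          halfTurn_mul_self hg, one_smul]
        rfl
  · rintro ⟨_, ⟨γ, hγ, k, rfl⟩, hp, hq⟩
    refine ⟨γ, hγ, k, Or.inl ⟨?_, ?_⟩⟩
    · rw [hp, vertex_eq hg, mul_smul]; rfl
    · rw [hq, vertex_succ hg, mul_smul]; rfl

theorem NetAdj.symm {p q : ClosedDisc} (h : NetAdj g p q) : NetAdj g q p := by
  obtain ⟨γ, hγ, k, h⟩ := h
  exact ⟨γ, hγ, k, h.symm⟩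

/-- The neighbours of a vertex of the net. -/
theorem netAdj_smul_center_iff (hg : 2 ≤ g) (hfree : ActsFreely (standardGroup g))
    {M : DiscAut} (hM : M ∈ netFrames g) {q : ClosedDisc} :
    NetAdj g (M • discCenter) q ↔ ∃ i : ℤ, q = (M * rot g ^ i * halfTurn g) • discCenter := by
  rw [netAdj_iff hg]
  constructor
  · rintro ⟨M', hM', hp, rfl⟩
    obtain ⟨i, rfl⟩ := eq_mul_rot_of_smul_center_eq hg hfree hM hM' hp
    exact ⟨i, by rw [mul_smul _ (halfTurn g)]⟩
  · rintro ⟨i, rfl⟩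
    refine ⟨M * rot g ^ i, mul_rot_zpow_mem_netFrames hg hM i, ?_, by rw [mul_smul _ (halfTurn g)]⟩
    rw [mul_smul, rot_zpow_smul_center]

/-! ### Half planes bounded by the sides -/

/-- In the coordinate of a base frame, the half plane on the inner side of side `0` is the upper
half plane. -/
theorem exists_pos_mul_im_baseFrame (hg : 2 ≤ g) (w : ClosedDisc) : ∃ K > 0,
    sideRadius g * (1 + ‖((baseFrame g • w : ClosedDisc) : ℂ)‖ ^ 2) -
      2 * (Circle.exp (-sideAngle g) * ((baseFrame g • w : ClosedDisc) : ℂ)).re =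
      K * (w : ℂ).im := by
  have d := baseFrame_denom_ne_zero hg w
  have hd := Complex.normSq_pos.2 d
  have hs := sin_sideAngle_pos hg
  have hc := cos_sideAngle_pos hg
  have h1 : cos (sideAngle g) ^ 2 + sin (sideAngle g) ^ 2 = 1 := cos_sq_add_sin_sq _
  have h2 := sideRadius_mul_cos hg
  have h3 : vertexRadius g ^ 2 = cos (sideAngle g) ^ 2 - sin (sideAngle g) ^ 2 := by
    rw [vertexRadius_sq hg, cos_two_mul']
  refine ⟨4 * sin (sideAngle g) ^ 3 / (cos (sideAngle g) *
    Complex.normSq (1 - (vertexRadius g : ℂ) * Circle.exp (-sideAngle g) * w)), by positivity, ?_⟩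
  rw [smul_eq, baseFrame_apply hg, ← Complex.normSq_eq_norm_sq]
  have e1 : (Circle.exp (-sideAngle g) : ℂ) * ((vertexRadius g - Circle.exp (-sideAngle g) * w) /
        (1 - vertexRadius g * Circle.exp (-sideAngle g) * w)) =
      (Circle.exp (-sideAngle g) * (vertexRadius g - Circle.exp (-sideAngle g) * w) *
        conj (1 - vertexRadius g * Circle.exp (-sideAngle g) * w)) *
        ((Complex.normSq (1 - vertexRadius g * Circle.exp (-sideAngle g) * w))⁻¹ : ℝ) := by
    rw [div_eq_mul_inv, Complex.inv_def]; ring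
  rw [e1, Complex.re_mul_ofReal, map_div₀]
  have e2 : cos (sideAngle g) * (sideRadius g *
      (Complex.normSq (1 - (vertexRadius g : ℂ) * Circle.exp (-sideAngle g) * w) +
        Complex.normSq ((vertexRadius g : ℂ) - Circle.exp (-sideAngle g) * w)) -
      2 * ((Circle.exp (-sideAngle g) : ℂ) *
        ((vertexRadius g : ℂ) - (Circle.exp (-sideAngle g) : ℂ) * w) *
        conj (1 - (vertexRadius g : ℂ) * (Circle.exp (-sideAngle g) : ℂ) * w)).re) =
      4 * sin (sideAngle g) ^ 3 * (w : ℂ).im := by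
    rw [exp_neg_sideAngle]
    generalize cos (sideAngle g) = c at *
    generalize sin (sideAngle g) = s at *
    generalize vertexRadius g = R at *
    generalize sideRadius g = ρ at *
    have f1 : Complex.normSq (1 - R * (c - s * Complex.I) * w) +
        Complex.normSq (R - (c - s * Complex.I) * w) =
        (1 + R ^ 2) * (1 + ((w : ℂ).re ^ 2 + (w : ℂ).im ^ 2)) -
          4 * R * (c * (w : ℂ).re + s * (w : ℂ).im) := by
      simp [Complex.normSq_apply]
      linear_combination (1 + R ^ 2) * ((w : ℂ).re ^ 2 + (w : ℂ).im ^ 2) * h1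
    have f2 : ((c - s * Complex.I) * (R - (c - s * Complex.I) * w) *
        conj (1 - R * (c - s * Complex.I) * w)).re =
        R * c * (1 + ((w : ℂ).re ^ 2 + (w : ℂ).im ^ 2)) -
          (R ^ 2 + (c ^ 2 - s ^ 2)) * (w : ℂ).re - 2 * s * c * (w : ℂ).im := by
      simp
      linear_combination (R * c * ((w : ℂ).re ^ 2 + (w : ℂ).im ^ 2) - R ^ 2 * (w : ℂ).re) * h1
    rw [f1, f2]
    generalize (w : ℂ).re = X at *
    generalize (w : ℂ).im = Y at *
    linear_combination ((1 + R ^ 2) * (1 + (X ^ 2 + Y ^ 2)) - 4 * R * (c * X + s * Y)) * h2 +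
      (R * (1 + (X ^ 2 + Y ^ 2)) - 2 * c * X - 4 * s * Y) * h3 -
      R * (1 + (X ^ 2 + Y ^ 2)) * h1
  have hd' := hd.ne'
  generalize ((Circle.exp (-sideAngle g) : ℂ) *
    ((vertexRadius g : ℂ) - (Circle.exp (-sideAngle g) : ℂ) * w) *
    conj (1 - (vertexRadius g : ℂ) * (Circle.exp (-sideAngle g) : ℂ) * w)).re = q at *
  generalize Complex.normSq (1 - (vertexRadius g : ℂ) * Circle.exp (-sideAngle g) * w) = n at *
  generalize Complex.normSq ((vertexRadius g : ℂ) - Circle.exp (-sideAngle g) * w) = n' at *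
  rw [div_mul_eq_mul_div, eq_div_iff (by positivity), ← e2]
  field_simp

theorem rot_zpow_apply (k : ℤ) (z : ClosedDisc) : ((rot g ^ k • z : ClosedDisc) : ℂ) =
    Circle.exp (k * (2 * sideAngle g)) * z := by
  rw [rot, diskIso_zero_zpow, smul_eq, diskIso_zero_apply]

theorem boundaryMap_rot_zpow (k : ℤ) (x : Circle) : boundaryMap (rot g ^ k) x =
    Circle.exp (k * (2 * sideAngle g)) * x := by
  rw [rot, diskIso_zero_zpow, boundaryMap_diskIso_zero]

/-- In the coordinate of the frame of a side, the half plane on the inner side of this side is the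
upper half plane. -/
theorem exists_pos_mul_im_frame (hg : 2 ≤ g) (k : ℤ) (w : ClosedDisc) : ∃ K > 0,
    sideRadius g * (1 + ‖((frame g k • w : ClosedDisc) : ℂ)‖ ^ 2) -
      2 * (Circle.exp (-((2 * k + 1) * sideAngle g)) * ((frame g k • w : ClosedDisc) : ℂ)).re =
      K * (w : ℂ).im := by
  obtain ⟨K, hK, h⟩ := exists_pos_mul_im_baseFrame hg w
  refine ⟨K, hK, ?_⟩
  rw [← h, frame, mul_smul, rot_zpow_apply, norm_mul, Circle.norm_coe, one_mul, ← mul_assoc,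
    ← Circle.coe_mul, ← Circle.exp_add]
  congr 6
  ring_nf

/-- No vertex of the polygon reaches further in the direction of the midpoint of a side than the
endpoints of this side. -/
theorem cos_odd_mul_le (hg : 2 ≤ g) (n : ℤ) :
    cos ((2 * n - 1) * sideAngle g) ≤ cos (sideAngle g) := by
  have hθ := sideAngle_pos hg
  have hN := sideAngle_mul hg
  have hg' : (0 : ℤ) < 4 * g := by omega
  obtain ⟨m, q, hm0, hm, rfl⟩ : ∃ m q : ℤ, 0 ≤ m ∧ m < 4 * g ∧ n = m + 4 * g * q :=
    ⟨n % (4 * g), n / (4 * g), Int.emod_nonneg _ hg'.ne', Int.emod_lt_of_pos _ hg',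
      (Int.emod_add_mul_ediv n (4 * g)).symm⟩
  have e : (2 * ((m + 4 * g * q : ℤ) : ℝ) - 1) * sideAngle g =
      (2 * m - 1) * sideAngle g + q * (2 * π) := by
    push_cast
    linear_combination (2 * (q : ℝ)) * hN
  rw [e, cos_add_int_mul_two_pi]
  rcases hm0.eq_or_lt with rfl | hm1
  · rw [show (2 * ((0 : ℤ) : ℝ) - 1) * sideAngle g = -sideAngle g by push_cast; ring, cos_neg]
  · have h1 : (1 : ℝ) ≤ m := by exact_mod_cast hm1
    have h2 : (m : ℝ) ≤ 4 * g - 1 := by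
      have : m ≤ 4 * g - 1 := by omega
      exact_mod_cast this
    have h3 : sideAngle g ≤ (2 * m - 1) * sideAngle g := by nlinarith
    have h4 : (2 * m - 1) * sideAngle g ≤ 2 * π - sideAngle g := by nlinarith
    rcases le_total ((2 * m - 1) * sideAngle g) π with h | h
    · exact cos_le_cos_of_nonneg_of_le_pi hθ.le h h3
    · rw [← cos_two_pi_sub]
      exact cos_le_cos_of_nonneg_of_le_pi hθ.le (by linarith) (by linarith)

theorem vertex_coe (g : ℕ) (k : ℤ) : (vertex g k : ℂ) =
    vertexRadius g * Circle.exp (2 * k * sideAngle g) := by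
  have : 2 * π * k / (4 * g) = 2 * k * sideAngle g := by rw [sideAngle]; ring
  simp only [vertex, this, vertexRadius]

theorem one_add_vertexRadius_sq (hg : 2 ≤ g) :
    1 + vertexRadius g ^ 2 = 2 * cos (sideAngle g) ^ 2 := by
  rw [vertexRadius_sq hg, cos_two_mul]; ring

/-- The polygon lies on the inner side of each of its sides. -/
theorem im_frame_inv_vertex_nonneg (hg : 2 ≤ g) (k j : ℤ) :
    0 ≤ (((frame g k)⁻¹ • vertex g j : ClosedDisc) : ℂ).im := by
  obtain ⟨K, hK, h⟩ := exists_pos_mul_im_frame hg k ((frame g k)⁻¹ • vertex g j)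
  rw [smul_inv_smul, vertex_coe, norm_mul, Circle.norm_coe, mul_one, Complex.norm_real,
    Real.norm_of_nonneg (vertexRadius_pos hg).le, mul_left_comm, ← Circle.coe_mul,
    ← Circle.exp_add, Complex.re_ofReal_mul, Circle.coe_exp, Complex.exp_ofReal_mul_I_re,
    show -((2 * (k : ℝ) + 1) * sideAngle g) + 2 * j * sideAngle g =
      (2 * ((j - k : ℤ) : ℝ) - 1) * sideAngle g by push_cast; ring,
    one_add_vertexRadius_sq hg] at h
  have h1 := cos_odd_mul_le hg (j - k)
  have h2 := mul_le_mul_of_nonneg_left h1 (vertexRadius_pos hg).le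
  have h3 : 0 ≤ K * (((frame g k)⁻¹ • vertex g j : ClosedDisc) : ℂ).im := by
    rw [← h, ← sideRadius_mul_cos hg] at *
    nlinarith
  exact nonneg_of_mul_nonneg_right h3 hK

theorem exists_pos_mul_im_halfTurn (hg : 2 ≤ g) (z : ClosedDisc) :
    ∃ K > 0, ((halfTurn g • z : ClosedDisc) : ℂ).im = -(K * (z : ℂ).im) := by
  have d := Complex.normSq_pos.2 (halfTurn_denom_ne_zero hg z)
  have h1 := sideRadius_pos hg
  have h2 := sideRadius_lt_one hg
  have h3 : 0 < 1 - sideRadius g ^ 2 := by nlinarith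
  refine ⟨(1 - sideRadius g ^ 2) / Complex.normSq (1 - (sideRadius g : ℂ) * z), by positivity, ?_⟩
  rw [smul_eq, halfTurn_apply hg, Complex.div_im]
  field_simp
  simp
  ring

theorem circlePt_boundaryMap_smul (m : DiscAut) (x : Circle) :
    circlePt (boundaryMap m x) = m • circlePt x := circlePt_boundaryMap m x

theorem exists_pos_mul_im_boundary (hg : 2 ≤ g) (k : ℤ) (x : Circle) : ∃ K > 0,
    2 * (sideRadius g - ((Circle.exp (-((2 * k + 1) * sideAngle g)) : ℂ) * x).re) =
      K * (boundaryMap (frame g k)⁻¹ x : ℂ).im := by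
  have hx : ((frame g k • circlePt (boundaryMap (frame g k)⁻¹ x) : ClosedDisc) : ℂ) = x := by
    rw [← circlePt_boundaryMap_smul, boundaryMap_apply_inv]; rfl
  obtain ⟨K, hK, h⟩ := exists_pos_mul_im_frame hg k (circlePt (boundaryMap (frame g k)⁻¹ x))
  rw [hx, Circle.norm_coe] at h
  refine ⟨K, hK, Eq.trans ?_ h⟩
  ring

/-- The arc `J_s` is the lower half circle in the coordinate of the frame of `s`. -/
theorem mem_sideArc_iff (hg : 2 ≤ g) (k : ℤ) (x : Circle) :
    x ∈ sideArc g k ↔ (boundaryMap (frame g k)⁻¹ x : ℂ).im ≤ 0 := by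
  obtain ⟨K, hK, h'⟩ := exists_pos_mul_im_boundary hg k x
  have hiff : (boundaryMap (frame g k)⁻¹ x : ℂ).im ≤ 0 ↔
      sideRadius g ≤ ((Circle.exp (-((2 * k + 1) * sideAngle g)) : ℂ) * x).re := by
    constructor
    · intro h2
      nlinarith
    · intro h2
      by_contra h3
      nlinarith [mul_pos hK (not_le.1 h3)]
  rw [hiff]
  have hs := sin_sideAngle_pos hg
  have hc := cos_sideAngle_pos hg
  have hR := vertexRadius_pos hg
  have hRc := sideRadius_mul_cos hg
  have ev : ∀ c : ℂ, ∀ j : ℤ, (conj c * (vertex g j : ℂ)).re = vertexRadius g *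
      (conj c * Circle.exp ((2 * k + 1) * sideAngle g) *
        Circle.exp ((2 * (j - k) - 1) * sideAngle g)).re := by
    intro c j
    have e : (Circle.exp (2 * j * sideAngle g) : ℂ) = (Circle.exp ((2 * k + 1) * sideAngle g) : ℂ) *
        Circle.exp ((2 * (j - k) - 1) * sideAngle g) := by
      rw [← Circle.coe_mul, ← Circle.exp_add]
      congr 2; ring
    rw [vertex_coe, mul_left_comm, Complex.re_ofReal_mul, e, mul_assoc]
  have e0 : (2 * ((k : ℝ) - k) - 1) * sideAngle g = -sideAngle g := by ring
  have e1 : (2 * (((k + 1 : ℤ) : ℝ) - k) - 1) * sideAngle g = sideAngle g := by push_cast; ring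
  have hnorm : ∀ j, ‖(vertex g j : ℂ)‖ = vertexRadius g := by
    intro j
    rw [vertex_coe, norm_mul, Circle.norm_coe, mul_one, Complex.norm_real,
      Real.norm_of_nonneg hR.le]
  have hu : conj (Circle.exp ((2 * k + 1) * sideAngle g) : ℂ) =
      Circle.exp (-((2 * k + 1) * sideAngle g)) := by
    rw [← Circle.coe_inv_eq_conj, Circle.exp_neg]
  constructor
  · rintro ⟨c₀, d, hd, hdc, h1, h2, h3⟩
    unfold SatisfiesGeodesicEq at h1 h2
    rw [ev, e0, hnorm, one_add_vertexRadius_sq hg, exp_neg_sideAngle] at h1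
    rw [ev, e1, hnorm, one_add_vertexRadius_sq hg, exp_sideAngle] at h2
    have hc' : conj c₀ = conj c₀ * Circle.exp ((2 * k + 1) * sideAngle g) *
        Circle.exp (-((2 * k + 1) * sideAngle g)) := by
      rw [mul_assoc, ← Circle.coe_mul, ← Circle.exp_add]; simp
    rw [hc', mul_assoc] at h3
    generalize conj c₀ * (Circle.exp ((2 * k + 1) * sideAngle g) : ℂ) = q at *
    generalize cos (sideAngle g) = c at *
    generalize sin (sideAngle g) = s at *
    simp at h1 h2
    have hq : q.im = 0 := by
      have : vertexRadius g * s * q.im = 0 := by linarith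
      exact (mul_eq_zero.1 this).resolve_left (by positivity)
    have hdq : d = sideRadius g * q.re := by
      rw [hq] at h1
      have : 2 * c ^ 2 * d = 2 * c ^ 2 * (sideRadius g * q.re) := by
        linear_combination h1 - 2 * q.re * c * hRc
      exact mul_left_cancel₀ (by positivity) this
    have hqpos : 0 < q.re := by
      have := sideRadius_pos hg
      by_contra hcon
      nlinarith
    rw [Complex.mul_re, hq, zero_mul, sub_zero, hdq] at h3
    nlinarith
  · intro h1
    refine ⟨Circle.exp ((2 * k + 1) * sideAngle g), sideRadius g, sideRadius_pos hg, ?_, ?_, ?_, ?_⟩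
    · rw [Circle.norm_coe]; exact sideRadius_lt_one hg
    · unfold SatisfiesGeodesicEq
      rw [ev, e0, hnorm, one_add_vertexRadius_sq hg, exp_neg_sideAngle, hu, ← Circle.coe_mul,
        ← Circle.exp_add, ← sideRadius_mul_cos hg, neg_add_cancel, Circle.exp_zero]
      generalize cos (sideAngle g) = c at *
      generalize sin (sideAngle g) = s at *
      simp; ring
    · unfold SatisfiesGeodesicEq
      rw [ev, e1, hnorm, one_add_vertexRadius_sq hg, exp_sideAngle, hu, ← Circle.coe_mul,
        ← Circle.exp_add, ← sideRadius_mul_cos hg, neg_add_cancel, Circle.exp_zero]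
      generalize cos (sideAngle g) = c at *
      generalize sin (sideAngle g) = s at *
      simp; ring
    · rw [hu]; exact h1

/-! ### The half-turn on the boundary circle -/

theorem boundaryMap_halfTurn_coe (hg : 2 ≤ g) (x : Circle) : (boundaryMap (halfTurn g) x : ℂ) =
    (sideRadius g - x) / (1 - sideRadius g * x) := halfTurn_apply hg (circlePt x)

/-- The half-turn multiplies half-angle cotangents by this number (up to sign). -/
noncomputable def turnRatio (g : ℕ) : ℝ := (1 - sideRadius g) / (1 + sideRadius g)

theorem turnRatio_pos (hg : 2 ≤ g) : 0 < turnRatio g :=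
  div_pos (by linarith [sideRadius_lt_one hg]) (by linarith [sideRadius_pos hg])

theorem turnRatio_lt_one (hg : 2 ≤ g) : turnRatio g < 1 := by
  have := sideRadius_pos hg
  rw [turnRatio, div_lt_one (by linarith)]
  linarith

theorem exp_two_arctan_mul (v : ℝ) :
    (Circle.exp (2 * arctan v) : ℂ) * (1 - v * Complex.I) = 1 + v * Complex.I := by
  have h1 : (0 : ℝ) < √(1 + v ^ 2) := Real.sqrt_pos.2 (by positivity)
  have h2 : √(1 + v ^ 2) * √(1 + v ^ 2) = 1 + v ^ 2 := Real.mul_self_sqrt (by positivity)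
  have h3 : sin (arctan v) = v * cos (arctan v) := by
    rw [sin_arctan, cos_arctan]; ring
  have h4 : cos (arctan v) ^ 2 * (1 + v ^ 2) = 1 := by
    rw [cos_sq_arctan]; field_simp
  have h5 : (Circle.exp (2 * arctan v) : ℂ) =
      (cos (arctan v) * (1 + v * Complex.I)) * (cos (arctan v) * (1 + v * Complex.I)) := by
    have : (Circle.exp (arctan v) : ℂ) = cos (arctan v) * (1 + v * Complex.I) := by
      rw [Circle.coe_exp, Complex.exp_mul_I, ← Complex.ofReal_cos, ← Complex.ofReal_sin, h3]
      push_cast; ring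
    rw [two_mul, Circle.exp_add, Circle.coe_mul, this]
  have h6 : ((cos (arctan v) : ℂ)) ^ 2 * (1 + (v : ℂ) ^ 2) = 1 := by exact_mod_cast h4
  rw [h5]
  linear_combination (1 + v * Complex.I) * h6 -
    (cos (arctan v) : ℂ) ^ 2 * v ^ 2 * (1 + v * Complex.I) * Complex.I_sq

/-- The half-turn on the circle, in terms of the cotangent `v` of half the argument. -/
theorem boundaryMap_halfTurn_exp (hg : 2 ≤ g) {t v : ℝ} (hs : sin (t / 2) ≠ 0)
    (hv : v * sin (t / 2) = cos (t / 2)) :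
    boundaryMap (halfTurn g) (Circle.exp t) = Circle.exp (-(2 * arctan (turnRatio g * v))) := by
  have hρ := sideRadius_pos hg
  have d1 : (1 : ℂ) - (turnRatio g * v : ℝ) * Complex.I ≠ 0 := fun h => by
    have := congrArg Complex.re h; simp at this
  have d2 : (1 : ℂ) + (turnRatio g * v : ℝ) * Complex.I ≠ 0 := fun h => by
    have := congrArg Complex.re h; simp at this
  have e1 := exp_two_arctan_mul (turnRatio g * v)
  have d3 : (1 : ℂ) - sideRadius g * (Circle.exp t : ℂ) ≠ 0 :=
    halfTurn_denom_ne_zero hg (circlePt (Circle.exp t))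
  have ht : (Circle.exp t : ℂ) = (cos (t / 2) + sin (t / 2) * Complex.I) ^ 2 := by
    have : (Circle.exp (t / 2) : ℂ) = cos (t / 2) + sin (t / 2) * Complex.I := by
      rw [Circle.coe_exp, Complex.exp_mul_I]; push_cast; rfl
    rw [← this, sq, ← Circle.coe_mul, ← Circle.exp_add, add_halves]
  have h1 : ((cos (t / 2) : ℂ)) ^ 2 + (sin (t / 2) : ℂ) ^ 2 = 1 := by
    exact_mod_cast cos_sq_add_sin_sq (t / 2)
  have hκ : (turnRatio g : ℂ) * (1 + sideRadius g) = 1 - sideRadius g := by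
    have : turnRatio g * (1 + sideRadius g) = 1 - sideRadius g :=
      div_mul_cancel₀ _ (by linarith)
    exact_mod_cast this
  have hv' : (v : ℂ) * sin (t / 2) = cos (t / 2) := by exact_mod_cast hv
  have hs' : (sin (t / 2) : ℂ) ≠ 0 := by exact_mod_cast hs
  have e2 : (Circle.exp (-(2 * arctan (turnRatio g * v))) : ℂ) *
      (Circle.exp (2 * arctan (turnRatio g * v)) : ℂ) = 1 := by
    rw [← Circle.coe_mul, ← Circle.exp_add]; simp
  have hρ' : (1 + sideRadius g : ℂ) ≠ 0 := by
    have : (1 + sideRadius g) ≠ 0 := by linarith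
    exact_mod_cast this
  ext
  rw [boundaryMap_halfTurn_coe hg, div_eq_iff d3]
  have e3 : (Circle.exp (-(2 * arctan (turnRatio g * v))) : ℂ) =
      (1 - (turnRatio g * v : ℝ) * Complex.I) / (1 + (turnRatio g * v : ℝ) * Complex.I) := by
    rw [eq_div_iff d2, ← e1]
    linear_combination (1 - (turnRatio g * v : ℝ) * Complex.I) * e2
  rw [e3, div_mul_eq_mul_div, eq_div_iff d2, ht]
  rw [Complex.ofReal_mul]
  clear e1 e2 e3 d1 d2 d3 ht
  generalize (cos (t / 2) : ℂ) = c at *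
  generalize (sin (t / 2) : ℂ) = s at *
  generalize (sideRadius g : ℂ) = ρ at *
  generalize (turnRatio g : ℂ) = κ at *
  generalize (v : ℂ) = v at *
  apply mul_left_cancel₀ (mul_ne_zero hs' hρ')
  have hκv : κ * v * s * (1 + ρ) = (1 - ρ) * c := by
    linear_combination (1 - ρ) * hv' + v * s * hκ
  linear_combination Complex.I * ((ρ - (c + s * Complex.I) ^ 2) +
    (1 - ρ * (c + s * Complex.I) ^ 2)) * hκv +
    ((1 - ρ) * ((1 + ρ) * s) - (1 + ρ) * Complex.I * ((1 - ρ) * c)) * h1 +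
    (-2 * (1 - ρ ^ 2) * c ^ 2 * s - s ^ 2 * ((1 - ρ) * ((1 + ρ) * s) +
      (1 + ρ) * (Complex.I * ((1 - ρ) * c)))) * Complex.I_sq

/-- The argument of the image of `exp (-2θ)` under the half-turn, `θ` the side angle. -/
noncomputable def turnAngle (g : ℕ) : ℝ :=
  2 * arctan (turnRatio g * (cos (sideAngle g) / sin (sideAngle g)))

theorem turnAngle_pos (hg : 2 ≤ g) : 0 < turnAngle g := by
  have := turnRatio_pos hg
  have := cos_sideAngle_pos hg
  have := sin_sideAngle_pos hg
  exact mul_pos two_pos (arctan_pos.2 (by positivity))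

/-- The turn angle is at most half the angle between consecutive directions of edges at `0`. -/
theorem turnAngle_le (hg : 2 ≤ g) : turnAngle g ≤ sideAngle g := by
  have hθ := sideAngle_pos hg
  have hθ' := sideAngle_le hg
  have hpi := pi_pos
  have hc := cos_sideAngle_pos hg
  have hs := sin_sideAngle_pos hg
  have hρ := sideRadius_pos hg
  have h2 := sideRadius_sq_mul hg
  have h3 := cos_two_sideAngle_gt hg
  rw [cos_two_mul'] at h3
  have h4 := cos_sq_add_sin_sq (sideAngle g)
  have hc2 : 0 < cos (sideAngle g / 2) := cos_pos_of_mem_Ioo ⟨by linarith, by linarith⟩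
  have hs2 : 0 < sin (sideAngle g / 2) := sin_pos_of_pos_of_lt_pi (by linarith) (by linarith)
  have e1 : sin (sideAngle g) = 2 * sin (sideAngle g / 2) * cos (sideAngle g / 2) := by
    rw [← sin_two_mul]; congr 1; ring
  have e2 : 2 * cos (sideAngle g / 2) ^ 2 = 1 + cos (sideAngle g) := by
    rw [cos_sq, mul_div_cancel₀ _ (two_ne_zero' ℝ)]; ring
  -- the inequality is `tan θ / (1 + ρ) ^ 2 ≤ tan (θ / 2)`, as `ρ ^ 2 = 1 - tan θ ^ 2`
  have key : turnRatio g * (cos (sideAngle g) / sin (sideAngle g)) ≤ tan (sideAngle g / 2) := by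
    have hcg : 9 / 10 ≤ cos (sideAngle g) := by nlinarith
    have hρ8 : 8 / 10 ≤ sideRadius g := by nlinarith
    rw [turnRatio, tan_eq_sin_div_cos, div_mul_div_comm, div_le_div_iff₀ (by positivity) hc2]
    have e3 : (1 - sideRadius g) * (1 + sideRadius g) * cos (sideAngle g) ^ 2 =
        sin (sideAngle g) ^ 2 := by linear_combination -h2
    have h5 : 2 * cos (sideAngle g / 2) ^ 2 ≤ (1 + sideRadius g) ^ 2 * cos (sideAngle g) := by
      rw [e2]; nlinarith
    have h6 : 0 < (1 + sideRadius g) * cos (sideAngle g) := by positivity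
    refine le_of_mul_le_mul_right ?_ h6
    have e4 : (1 - sideRadius g) * cos (sideAngle g) * cos (sideAngle g / 2) *
        ((1 + sideRadius g) * cos (sideAngle g)) =
        sin (sideAngle g) * sin (sideAngle g / 2) * (2 * cos (sideAngle g / 2) ^ 2) := by
      calc _ = (1 - sideRadius g) * (1 + sideRadius g) * cos (sideAngle g) ^ 2 *
            cos (sideAngle g / 2) := by ring
        _ = _ := by rw [e3]; nth_rewrite 1 [sq, e1]; ring
    rw [e4]
    calc _ ≤ sin (sideAngle g) * sin (sideAngle g / 2) *
          ((1 + sideRadius g) ^ 2 * cos (sideAngle g)) :=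
          mul_le_mul_of_nonneg_left h5 (by positivity)
      _ = _ := by ring
  have h7 := arctan_mono key
  rw [arctan_tan (by linarith) (by linarith)] at h7
  rw [turnAngle]
  linarith

theorem boundaryMap_halfTurn_neg_two (hg : 2 ≤ g) :
    boundaryMap (halfTurn g) (Circle.exp (-(2 * sideAngle g))) = Circle.exp (turnAngle g) := by
  have hs := sin_sideAngle_pos hg
  have e : -(2 * sideAngle g) / 2 = -sideAngle g := by ring
  rw [boundaryMap_halfTurn_exp hg (v := -(cos (sideAngle g) / sin (sideAngle g)))]
  · rw [mul_neg, arctan_neg, mul_neg, neg_neg, turnAngle]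
  · rw [e, sin_neg]; linarith
  · rw [e, sin_neg, cos_neg]; field_simp

/-- The half-turn maps all directions of edges at `0`, except that of the edge it exchanges
itself with, close to `1`. -/
theorem exists_boundaryMap_halfTurn_eq (hg : 2 ≤ g) {t : ℝ} (h1 : 2 * sideAngle g ≤ t)
    (h2 : t ≤ 2 * π - 2 * sideAngle g) : ∃ s ∈ Icc (-turnAngle g) (turnAngle g),
    boundaryMap (halfTurn g) (Circle.exp t) = Circle.exp s := by
  have hθ := sideAngle_pos hg
  have hκ := turnRatio_pos hg
  have hs := sin_sideAngle_pos hg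
  have hst : 0 < sin (t / 2) := sin_pos_of_pos_of_lt_pi (by linarith) (by linarith)
  have h3 : 0 ≤ sin (t / 2 - sideAngle g) :=
    sin_nonneg_of_nonneg_of_le_pi (by linarith) (by linarith)
  have h4 : 0 ≤ sin (t / 2 + sideAngle g) :=
    sin_nonneg_of_nonneg_of_le_pi (by linarith) (by linarith)
  rw [sin_sub] at h3
  rw [sin_add] at h4
  have h5 : cos (t / 2) / sin (t / 2) ≤ cos (sideAngle g) / sin (sideAngle g) := by
    rw [div_le_div_iff₀ hst hs]; linarith
  have h6 : -(cos (sideAngle g) / sin (sideAngle g)) ≤ cos (t / 2) / sin (t / 2) := by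
    rw [← neg_div, div_le_div_iff₀ hs hst]; linarith
  refine ⟨_, ⟨?_, ?_⟩, boundaryMap_halfTurn_exp hg hst.ne' (div_mul_cancel₀ _ hst.ne')⟩
  · have := arctan_mono (mul_le_mul_of_nonneg_left h5 hκ.le)
    rw [turnAngle]; linarith
  · have := arctan_mono (mul_le_mul_of_nonneg_left h6 hκ.le)
    rw [mul_neg, arctan_neg] at this
    rw [turnAngle]; linarith

/-- The half-turn maps a point at angle `x` from `-1` to a point at a smaller angle from `1`,
because `turnRatio g < 1`. -/
theorem exists_boundaryMap_halfTurn_pi_add (hg : 2 ≤ g) {x : ℝ} (h0 : 0 < x) (h1 : x < π) :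
    ∃ y ∈ Ioo 0 x, boundaryMap (halfTurn g) (Circle.exp (π + x)) = Circle.exp y ∧
      boundaryMap (halfTurn g) (Circle.exp (π - x)) = Circle.exp (-y) := by
  have hκ := turnRatio_pos hg
  have hκ1 := turnRatio_lt_one hg
  have hc : 0 < cos (x / 2) := cos_pos_of_mem_Ioo ⟨by linarith, by linarith⟩
  have ht : 0 < tan (x / 2) := tan_pos_of_pos_of_lt_pi_div_two (by linarith) (by linarith)
  have e1 : (π + x) / 2 = x / 2 + π / 2 := by ring
  have e2 : (π - x) / 2 = π / 2 - x / 2 := by ring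
  refine ⟨2 * arctan (turnRatio g * tan (x / 2)), ⟨?_, ?_⟩, ?_, ?_⟩
  · exact mul_pos two_pos (arctan_pos.2 (by positivity))
  · have := arctan_strictMono (mul_lt_of_lt_one_left ht hκ1)
    rw [arctan_tan (by linarith) (by linarith)] at this
    linarith
  · rw [boundaryMap_halfTurn_exp hg (v := -tan (x / 2))]
    · rw [mul_neg, arctan_neg, mul_neg, neg_neg]
    · rw [e1, sin_add_pi_div_two]; exact hc.ne'
    · rw [e1, sin_add_pi_div_two, cos_add_pi_div_two, neg_mul, tan_mul_cos hc.ne']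
  · rw [boundaryMap_halfTurn_exp hg (v := tan (x / 2))]
    · rw [e2, sin_pi_div_two_sub]; exact hc.ne'
    · rw [e2, sin_pi_div_two_sub, cos_pi_div_two_sub, tan_mul_cos hc.ne']

/-! ### The cut points -/

theorem onGeodesic_smul_iff (hg : 2 ≤ g) (M : DiscAut) (z : ClosedDisc) :
    OnGeodesic (M • discCenter : ClosedDisc) (M • halfTurn g • discCenter : ClosedDisc) z ↔
      ((M⁻¹ • z : ClosedDisc) : ℂ).im = 0 := by
  have h := onGeodesic_apply_iff M discCenter (halfTurn g • discCenter) (M⁻¹ • z)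
  rw [halfTurn_smul_center hg, ← smul_eq, ← smul_eq, ← smul_eq, smul_inv_smul] at h
  rw [h]
  exact onGeodesic_zero_real_iff (sideRadius_pos hg).ne'

theorem mul_two_sideAngle (hg : 2 ≤ g) : (2 * g : ℝ) * (2 * sideAngle g) = π := by
  rw [← sideAngle_mul hg]; ring

theorem boundaryMap_rot_half (hg : 2 ≤ g) (x : Circle) :
    boundaryMap (rot g ^ (2 * g : ℤ)) x = -x := by
  rw [boundaryMap_rot_zpow]
  push_cast
  rw [mul_two_sideAngle hg, circle_exp_pi, neg_one_mul]

theorem boundaryMap_halfTurn_one (hg : 2 ≤ g) : boundaryMap (halfTurn g) 1 = -1 := by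
  have h : (1 : ℂ) - sideRadius g * ((1 : Circle) : ℂ) ≠ 0 :=
    halfTurn_denom_ne_zero hg (circlePt 1)
  ext
  rw [boundaryMap_halfTurn_coe hg, div_eq_iff h]
  change ((sideRadius g : ℂ) - (1 : ℂ)) = (-1 : ℂ) * (1 - sideRadius g * (1 : ℂ))
  ring

theorem boundaryMap_halfTurn_neg_one (hg : 2 ≤ g) : boundaryMap (halfTurn g) (-1) = 1 := by
  rw [← boundaryMap_halfTurn_one hg, ← boundaryMap_mul, halfTurn_mul_self hg, boundaryMap_one]

theorem circle_im_eq_zero_iff (x : Circle) : (x : ℂ).im = 0 ↔ x = 1 ∨ x = -1 := by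
  constructor
  · intro h
    have h1 : (x : ℂ).re * (x : ℂ).re + (x : ℂ).im * (x : ℂ).im = 1 := by
      rw [← Complex.normSq_apply, Circle.normSq_coe]
    rw [h] at h1
    have h2 : ((x : ℂ).re - 1) * ((x : ℂ).re + 1) = 0 := by linarith
    rcases mul_eq_zero.1 h2 with h3 | h3
    · left; ext; exact Complex.ext (by simp; linarith) (by simpa using h)
    · right; ext; exact Complex.ext (by simp; linarith) (by simpa using h)
  · rintro (rfl | rfl) <;> simp

theorem onGeodesic_boundary_iff (hg : 2 ≤ g) (M : DiscAut) (x : Circle) :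
    OnGeodesic (M • discCenter : ClosedDisc) (M • halfTurn g • discCenter : ClosedDisc) x ↔
      x = boundaryMap M 1 ∨ x = boundaryMap M (-1) := by
  have h := onGeodesic_smul_iff hg M (circlePt x)
  rw [← circlePt_boundaryMap_smul] at h
  refine h.trans ((circle_im_eq_zero_iff _).trans ?_)
  rw [boundaryMap_inv_eq_iff, boundaryMap_inv_eq_iff]

theorem geodesicEnds_smul_center (hg : 2 ≤ g) (hfree : ActsFreely (standardGroup g))
    {M : DiscAut} (hM : M ∈ netFrames g) :
    geodesicEnds g (M • discCenter) = {x | ∃ i : ℤ, x = boundaryMap (M * rot g ^ i) 1} := by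
  have key : ∀ (i : ℤ) (x : Circle), OnGeodesic (M • discCenter : ClosedDisc)
      ((M * rot g ^ i * halfTurn g) • discCenter : ClosedDisc) x ↔
      x = boundaryMap (M * rot g ^ i) 1 ∨ x = boundaryMap (M * rot g ^ (i + 2 * g)) 1 := by
    intro i x
    have h := onGeodesic_boundary_iff hg (M * rot g ^ i) x
    rw [mul_smul M, rot_zpow_smul_center, ← mul_smul] at h
    rw [h, zpow_add, ← mul_assoc, boundaryMap_mul _ (rot g ^ (2 * g : ℤ)),
      boundaryMap_rot_half hg]
  ext x
  constructor
  · rintro ⟨q, hq, hx⟩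
    obtain ⟨i, rfl⟩ := (netAdj_smul_center_iff hg hfree hM).1 hq
    rcases (key i x).1 hx with h | h
    · exact ⟨i, h⟩
    · exact ⟨_, h⟩
  · rintro ⟨i, hi⟩
    exact ⟨_, (netAdj_smul_center_iff hg hfree hM).2 ⟨i, rfl⟩, (key i x).2 (Or.inl hi)⟩

theorem im_rot_zpow_smul_halfTurn (hg : 2 ≤ g) (n : ℤ) :
    ((rot g ^ n • halfTurn g • discCenter : ClosedDisc) : ℂ).im =
      sideRadius g * sin (n * (2 * sideAngle g)) := by
  rw [rot_zpow_apply, halfTurn_smul_center hg, mul_comm, Complex.im_ofReal_mul, Circle.coe_exp,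
    Complex.exp_ofReal_mul_I_im]

/-- The ends of the edges at a vertex of the polygon which are vertices of the polygon themselves
are confined to the angle of the polygon at this vertex. -/
theorem sin_of_smul_eq_vertex (hg : 2 ≤ g) {l n j : ℤ}
    (h : (frame g l * rot g ^ n * halfTurn g) • discCenter = vertex g j) :
    0 ≤ sin (n * (2 * sideAngle g)) ∧ sin ((n - 1) * (2 * sideAngle g)) ≤ 0 := by
  have h1 := im_frame_inv_vertex_nonneg hg l j
  have h2 := im_frame_inv_vertex_nonneg hg (l - 1) j
  have hρ := sideRadius_pos hg
  rw [← h] at h1 h2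
  rw [mul_smul, mul_smul, inv_smul_smul, im_rot_zpow_smul_halfTurn hg] at h1
  rw [frame_pred hg, ← mul_smul, show (frame g l * rot g * halfTurn g)⁻¹ *
      (frame g l * rot g ^ n * halfTurn g) = (halfTurn g)⁻¹ * rot g ^ (n - 1) * halfTurn g by group,
    halfTurn_inv hg, mul_smul, mul_smul] at h2
  obtain ⟨K, hK, h3⟩ := exists_pos_mul_im_halfTurn hg (rot g ^ (n - 1) • halfTurn g • discCenter)
  rw [h3, im_rot_zpow_smul_halfTurn hg, ← mul_assoc] at h2
  push_cast at h2
  exact ⟨nonneg_of_mul_nonneg_right h1 hρ, by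
    by_contra h4
    have := mul_pos (mul_pos hK hρ) (not_le.1 h4)
    linarith⟩

theorem sin_two_sideAngle_pos (hg : 2 ≤ g) : 0 < sin (2 * sideAngle g) :=
  sin_pos_of_pos_of_lt_pi (by linarith [sideAngle_pos hg])
    (by linarith [sideAngle_le hg, pi_pos])

/-- The set `W` consists of the endpoints at infinity of all geodesics of the net through the
neighbours of the vertices of the polygon. -/
theorem mem_cutPoints_iff (hg : 2 ≤ g) (hfree : ActsFreely (standardGroup g)) (x : Circle) :
    x ∈ cutPoints g ↔ ∃ k i m : ℤ,
      x = boundaryMap (frame g k * rot g ^ i * halfTurn g * rot g ^ m) 1 := by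
  have hF : ∀ k i : ℤ, frame g k * rot g ^ i * halfTurn g ∈ netFrames g := fun k i =>
    mul_halfTurn_mem_netFrames hg (mul_rot_zpow_mem_netFrames hg (frame_mem_netFrames k) i)
  have hadj : ∀ k i : ℤ, NetAdj g ((frame g k * rot g ^ i * halfTurn g) • discCenter)
      (vertex g k) := fun k i => by
    rw [vertex_eq hg]
    exact ((netAdj_smul_center_iff hg hfree (frame_mem_netFrames k)).2 ⟨i, rfl⟩).symm
  have hmem : ∀ k i m : ℤ,
      (∀ j, (frame g k * rot g ^ i * halfTurn g) • discCenter ≠ vertex g j) →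
      boundaryMap (frame g k * rot g ^ i * halfTurn g * rot g ^ m) 1 ∈ cutPoints g := by
    intro k i m h
    refine mem_iUnion₂.2 ⟨_, ⟨h, k, hadj k i⟩, ?_⟩
    rw [geodesicEnds_smul_center hg hfree (hF k i)]
    exact ⟨m, rfl⟩
  constructor
  · intro hx
    obtain ⟨p, ⟨-, k, hk⟩, hx⟩ := mem_iUnion₂.1 hx
    have hk' := hk.symm
    rw [vertex_eq hg, netAdj_smul_center_iff hg hfree (frame_mem_netFrames k)] at hk'
    obtain ⟨i, rfl⟩ := hk'
    rw [geodesicEnds_smul_center hg hfree (hF k i)] at hx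
    obtain ⟨m, hm⟩ := hx
    exact ⟨k, i, m, hm⟩
  · rintro ⟨k, i, m, rfl⟩
    by_cases h : ∀ j, (frame g k * rot g ^ i * halfTurn g) • discCenter ≠ vertex g j
    · exact hmem k i m h
    · push Not at h
      obtain ⟨l, hl⟩ := h
      rw [vertex_eq hg] at hl
      obtain ⟨n₀, hn₀⟩ := eq_mul_rot_of_smul_center_eq hg hfree (frame_mem_netFrames l) (hF k i)
        hl.symm
      rw [hn₀, mul_assoc, ← zpow_add]
      -- The geodesic through vertex `l` in the direction of the cut point contains two neighbours
      -- of this vertex, and at least one of them is not a vertex of the polygon.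
      generalize n₀ + m = n
      by_cases h1 : ∀ j, (frame g l * rot g ^ n * halfTurn g) • discCenter ≠ vertex g j
      · have := hmem l n (2 * g) h1
        rwa [boundaryMap_mul _ (rot g ^ (2 * g : ℤ)), boundaryMap_rot_half hg, boundaryMap_mul,
          boundaryMap_halfTurn_neg_one hg] at this
      · have h2 : ∀ j, (frame g l * rot g ^ (n + 2 * g) * halfTurn g) • discCenter ≠
            vertex g j := by
          intro j h2
          push Not at h1
          obtain ⟨j', h1⟩ := h1
          have s1 := sin_of_smul_eq_vertex hg h1
          have s2 := sin_of_smul_eq_vertex hg h2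
          have a1 : ((n + 2 * g : ℤ) : ℝ) * (2 * sideAngle g) = n * (2 * sideAngle g) + π := by
            push_cast; linear_combination mul_two_sideAngle hg
          have a2 : (((n + 2 * g : ℤ) : ℝ) - 1) * (2 * sideAngle g) =
              (n - 1) * (2 * sideAngle g) + π := by
            push_cast; linear_combination mul_two_sideAngle hg
          rw [a1, a2, sin_add_pi, sin_add_pi] at s2
          have z1 : sin (n * (2 * sideAngle g)) = 0 := by linarith
          have z2 : sin ((n - 1) * (2 * sideAngle g)) = 0 := by linarith
          have z3 : sin (2 * sideAngle g) = 0 := by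
            rw [show 2 * sideAngle g = n * (2 * sideAngle g) - (n - 1) * (2 * sideAngle g) by ring,
              sin_sub, z1, z2]
            ring
          exact (sin_two_sideAngle_pos hg).ne' z3
        have := hmem l (n + 2 * g) 0 h2
        rwa [zpow_zero, mul_one, boundaryMap_mul, boundaryMap_halfTurn_one hg, zpow_add,
          ← mul_assoc, boundaryMap_mul, boundaryMap_rot_half hg, neg_neg] at this

theorem cutPoints_finite (hg : 2 ≤ g) (hfree : ActsFreely (standardGroup g)) :
    (cutPoints g).Finite := by
  have hfin : (range fun n : ℤ => rot g ^ n).Finite := by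
    have : IsOfFinOrder (rot g) :=
      isOfFinOrder_iff_pow_eq_one.2 ⟨4 * g, by omega, rot_pow hg⟩
    exact this.finite_zpowers
  refine (((hfin.prod hfin).prod hfin).image fun q : (DiscAut × DiscAut) × DiscAut =>
    boundaryMap (q.1.1 * baseFrame g * q.1.2 * halfTurn g * q.2) 1).subset ?_
  intro x hx
  obtain ⟨k, i, m, rfl⟩ := (mem_cutPoints_iff hg hfree x).1 hx
  exact ⟨((_, _), _), ⟨⟨⟨k, rfl⟩, ⟨i, rfl⟩⟩, ⟨m, rfl⟩⟩, rfl⟩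

/-! ### The endpoints of the branches -/

/-- The point `w(v)`, for vertex `v` number `k`, where two branches of the map meet. -/
noncomputable def branchPoint (g : ℕ) (k : ℤ) : Circle :=
  boundaryMap (frame g k * rot g ^ (2 * g : ℤ) * halfTurn g * (rot g)⁻¹) 1

theorem branchPoint_eq (k : ℤ) :
    branchPoint g k = Circle.exp (k * (2 * sideAngle g)) * branchPoint g 0 := by
  simp only [branchPoint, frame, zpow_zero, one_mul, mul_assoc]
  rw [boundaryMap_mul, boundaryMap_rot_zpow]

theorem im_boundaryMap_rot_inv (g : ℕ) :
    (boundaryMap (rot g)⁻¹ 1 : ℂ).im = -sin (2 * sideAngle g) := by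
  rw [← zpow_neg_one, boundaryMap_rot_zpow, mul_one, Circle.coe_exp, Complex.exp_ofReal_mul_I_im]
  simp [sin_neg]

theorem exists_pos_mul_im_boundaryMap_halfTurn (hg : 2 ≤ g) (x : Circle) :
    ∃ K > 0, (boundaryMap (halfTurn g) x : ℂ).im = -(K * (x : ℂ).im) :=
  exists_pos_mul_im_halfTurn hg (circlePt x)

/-- The translate of the polygon in the definition of the clockwise end has its corner at vertex `k`
opposite to that of the polygon, so the clockwise end is the branch point. -/
theorem isClockwiseEnd_iff (hg : 2 ≤ g) (hfree : ActsFreely (standardGroup g)) (k : ℤ)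
    (x : Circle) : IsClockwiseEnd g k x ↔ x = branchPoint g k := by
  have hθ := sin_two_sideAngle_pos hg
  have hρ := sideRadius_pos hg
  have hvk : vertex g (k + 1) = frame g k • halfTurn g • discCenter := vertex_succ hg k
  constructor
  · rintro ⟨γ, hγ, hγ1, j, h1, -, h3, h4, h5⟩
    have hF : γ * frame g j ∈ netFrames g := ⟨γ, hγ, j, rfl⟩
    obtain ⟨i, hi⟩ := eq_mul_rot_of_smul_center_eq hg hfree (frame_mem_netFrames k) hF (by
      rw [← vertex_eq hg, mul_smul, ← vertex_eq hg]; exact h1.symm)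
    have e1 : ∀ l : ℤ, (γ : Equiv.Perm ClosedDisc) (vertex g l) = γ • vertex g l := fun _ => rfl
    rw [e1, hvk, vertex_succ hg, vertex_eq hg, ← mul_smul γ, hi, onGeodesic_smul_iff hg,
      mul_smul, inv_smul_smul, im_rot_zpow_smul_halfTurn hg, mul_eq_zero,
      or_iff_right hρ.ne'] at h3
    -- an edge of the translate at vertex `k` lies on the geodesic through side `k`, so the corner
    -- of the translate is that of the polygon or opposite to it
    have hri : rot g ^ i = 1 ∨ rot g ^ i = rot g ^ (2 * g : ℤ) := by
      obtain ⟨n, hn⟩ := sin_eq_zero_iff.1 h3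
      have hn' : i = 2 * g * n := by
        have : (i : ℝ) = 2 * g * n := by
          have h6 : (2 * sideAngle g) * i = (2 * sideAngle g) * (2 * g * n) := by
            linear_combination -hn + n * -mul_two_sideAngle hg
          exact mul_left_cancel₀ (by linarith [sideAngle_pos hg]) h6
        exact_mod_cast this
      rcases Int.even_or_odd' n with ⟨m, rfl | rfl⟩
      · left
        rw [hn', show (2 * g * (2 * m) : ℤ) = 4 * g * m by ring, rot_zpow_mul hg]
      · right
        rw [hn', show (2 * g * (2 * m + 1) : ℤ) = 4 * g * m + 2 * g by ring, zpow_add,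
          rot_zpow_mul hg, one_mul]
    have hri' : rot g ^ i = rot g ^ (2 * g : ℤ) := by
      refine hri.resolve_left fun h6 => hγ1 ?_
      have h7 : γ = rot g ^ (k - j) := by
        rw [h6, mul_one, frame, frame, ← mul_assoc] at hi
        rw [zpow_sub, ← mul_right_cancel hi, mul_inv_cancel_right]
      exact hfree γ hγ discCenter (by simp [discCenter]) (by rw [h7, rot_zpow_smul_center])
    have e2 : γ * frame g (j + 1) =
        frame g k * rot g ^ (2 * g : ℤ) * halfTurn g * (rot g)⁻¹ := by
      rw [frame_succ hg, ← mul_assoc, ← mul_assoc, hi, hri']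
    have e3 : γ • vertex g (j + 1) = (γ * frame g (j + 1)) • discCenter := by
      rw [mul_smul, vertex_eq hg]
    have e4 : γ • vertex g (j + 2) = (γ * frame g (j + 1)) • halfTurn g • discCenter := by
      rw [mul_smul, ← vertex_succ hg, add_assoc, one_add_one_eq_two]
    rw [e1, e1, e3, e4, e2, onGeodesic_boundary_iff hg] at h4
    -- the other endpoint of the geodesic lies on the wrong side of the geodesic through side `k`
    refine h4.resolve_right fun h6 => ?_
    have h7 := (mem_sideArc_iff hg k x).1 (interior_subset h5).2
    rw [h6, ← boundaryMap_mul, show (frame g k)⁻¹ * (frame g k * rot g ^ (2 * g : ℤ) *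
      halfTurn g * (rot g)⁻¹) = rot g ^ (2 * g : ℤ) * halfTurn g * (rot g)⁻¹ by group,
      boundaryMap_mul, boundaryMap_mul, boundaryMap_rot_half hg] at h7
    obtain ⟨K, hK, h8⟩ := exists_pos_mul_im_boundaryMap_halfTurn hg (boundaryMap (rot g)⁻¹ (-1))
    have h9 : (boundaryMap (rot g)⁻¹ (-1) : ℂ).im = sin (2 * sideAngle g) := by
      rw [← neg_neg (sin _), ← im_boundaryMap_rot_inv g, ← zpow_neg_one, boundaryMap_rot_zpow,
        boundaryMap_rot_zpow]
      simp
    have h10 : 0 ≤ (boundaryMap (halfTurn g) (boundaryMap (rot g)⁻¹ (-1)) : ℂ).im := by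
      have : -(boundaryMap (halfTurn g) (boundaryMap (rot g)⁻¹ (-1)) : ℂ).im ≤ 0 := h7
      linarith
    rw [h8, h9] at h10
    nlinarith [mul_pos hK hθ]
  · rintro rfl
    obtain ⟨γ, hγ, j, hj⟩ : frame g k * rot g ^ (2 * g : ℤ) ∈ netFrames g :=
      mul_rot_zpow_mem_netFrames hg (frame_mem_netFrames k) _
    have e1 : ∀ l : ℤ, (γ : Equiv.Perm ClosedDisc) (vertex g l) = γ • vertex g l := fun _ => rfl
    have hj1 : γ • vertex g (j + 1) =
        (frame g k * rot g ^ (2 * g : ℤ) * halfTurn g) • discCenter := by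
      rw [vertex_succ hg, ← mul_smul, ← mul_smul, hj]
    have e2 : γ * frame g (j + 1) =
        frame g k * rot g ^ (2 * g : ℤ) * halfTurn g * (rot g)⁻¹ := by
      rw [frame_succ hg, ← mul_assoc, ← mul_assoc, hj]
    have hsin : sin ((2 * g : ℤ) * (2 * sideAngle g)) = 0 := by
      push_cast; rw [mul_two_sideAngle hg, sin_pi]
    refine ⟨γ, hγ, ?_, j, ?_, ?_, ?_, ?_, ?_⟩
    · rintro rfl
      rw [one_smul] at hj1
      have := (sin_of_smul_eq_vertex hg hj1.symm).2
      push_cast at this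
      rw [sub_mul, mul_two_sideAngle hg, one_mul, sin_pi_sub] at this
      linarith
    · rw [e1, vertex_eq hg, vertex_eq hg, ← mul_smul, ← hj, mul_smul, rot_zpow_smul_center]
    · have h1 := vertex_succ hg (k - 1)
      rw [sub_add_cancel] at h1
      rw [e1, h1, vertex_eq hg, vertex_pred hg, onGeodesic_smul_iff hg, ← mul_smul γ, ← hj,
        frame_pred hg]
      obtain ⟨K, -, hK⟩ := exists_pos_mul_im_halfTurn hg
        (rot g ^ (2 * g : ℤ) • halfTurn g • discCenter)
      have h2 : (frame g k * rot g * halfTurn g)⁻¹ • (frame g k * rot g ^ (2 * g : ℤ)) • rot g •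
          halfTurn g • discCenter = halfTurn g • rot g ^ (2 * g : ℤ) • halfTurn g • discCenter := by
        simp only [← mul_smul]
        congr 1
        rw [mul_inv_rev, halfTurn_inv hg]
        group
      rw [h2, hK, im_rot_zpow_smul_halfTurn hg, hsin]
      ring
    · rw [e1, hvk, vertex_eq hg, onGeodesic_smul_iff hg, hj1, mul_smul, mul_smul, inv_smul_smul,
        im_rot_zpow_smul_halfTurn hg, hsin, mul_zero]
    · have e3 : γ • vertex g (j + 1) = (γ * frame g (j + 1)) • discCenter := by
        rw [mul_smul, vertex_eq hg]
      have e4 : γ • vertex g (j + 2) = (γ * frame g (j + 1)) • halfTurn g • discCenter := by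
        rw [mul_smul, ← vertex_succ hg, add_assoc, one_add_one_eq_two]
      rw [e1, e1, e3, e4, e2, onGeodesic_boundary_iff hg]
      exact Or.inl rfl
    · have hopen : IsOpen {x : Circle | (boundaryMap (frame g (k - 1))⁻¹ x : ℂ).im < 0 ∧
          (boundaryMap (frame g k)⁻¹ x : ℂ).im < 0} := by
        have hc : ∀ m : DiscAut, Continuous fun x : Circle => (boundaryMap m x : ℂ).im :=
          fun m => Complex.continuous_im.comp
            (continuous_subtype_val.comp (continuous_boundaryMap m))
        exact (isOpen_lt (hc _) continuous_const).inter (isOpen_lt (hc _) continuous_const)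
      refine interior_maximal (fun x (hx : _ ∧ _) => mem_inter ((mem_sideArc_iff hg _ x).2 hx.1.le)
        ((mem_sideArc_iff hg _ x).2 hx.2.le)) hopen ?_
      have h2 : (boundaryMap (frame g k)⁻¹ (branchPoint g k)) =
          -boundaryMap (halfTurn g) (boundaryMap (rot g)⁻¹ 1) := by
        rw [branchPoint, ← boundaryMap_mul, ← boundaryMap_rot_half hg, ← boundaryMap_mul,
          ← boundaryMap_mul]
        congr 1; group
      have h3 : (boundaryMap (frame g (k - 1))⁻¹ (branchPoint g k)) = boundaryMap (halfTurn g)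
          (-boundaryMap ((rot g)⁻¹ * halfTurn g * (rot g)⁻¹) 1) := by
        rw [branchPoint, ← boundaryMap_mul, ← boundaryMap_rot_half hg, ← boundaryMap_mul,
          ← boundaryMap_mul, frame_pred hg, mul_inv_rev, halfTurn_inv hg]
        congr 1; group
      obtain ⟨K, hK, h4⟩ := exists_pos_mul_im_boundaryMap_halfTurn hg (boundaryMap (rot g)⁻¹ 1)
      obtain ⟨K', hK', h5⟩ := exists_pos_mul_im_boundaryMap_halfTurn hg
        (-boundaryMap ((rot g)⁻¹ * halfTurn g * (rot g)⁻¹) 1)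
      constructor
      · have h6 : boundaryMap ((rot g)⁻¹ * halfTurn g * (rot g)⁻¹) 1 =
            Circle.exp (-(2 * sideAngle g - turnAngle g)) := by
          have h7 : ∀ x, boundaryMap (rot g)⁻¹ x = Circle.exp (-(2 * sideAngle g)) * x := by
            intro x
            rw [← zpow_neg_one, boundaryMap_rot_zpow]
            push_cast; rw [neg_one_mul]
          rw [boundaryMap_mul, boundaryMap_mul, h7 1, mul_one, boundaryMap_halfTurn_neg_two hg, h7,
            ← Circle.exp_add]
          congr 1; ring
        have h8 : 0 < sin (2 * sideAngle g - turnAngle g) :=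
          sin_pos_of_pos_of_lt_pi (by linarith [turnAngle_le hg, sideAngle_pos hg])
            (by linarith [turnAngle_pos hg, sideAngle_le hg, pi_pos])
        rw [h3, h5, h6]
        change -(K' * (-(Circle.exp (-(2 * sideAngle g - turnAngle g)) : ℂ)).im) < 0
        rw [Complex.neg_im, Circle.coe_exp, Complex.exp_ofReal_mul_I_im, sin_neg, neg_neg]
        nlinarith [mul_pos hK' h8]
      · rw [h2]
        change (-(boundaryMap (halfTurn g) (boundaryMap (rot g)⁻¹ 1) : ℂ)).im < 0
        rw [Complex.neg_im, h4, im_boundaryMap_rot_inv g]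
        nlinarith [mul_pos hK hθ]

/-! ### The expanding arcs of the side pairings -/

theorem baseFrame_conj_halfTurn_center (hg : 2 ≤ g) :
    ((baseFrame g • halfTurn g • (baseFrame g)⁻¹ • discCenter : ClosedDisc) : ℂ) =
      sideRadius g * Circle.exp (sideAngle g) := by
  set z := (baseFrame g)⁻¹ • discCenter with hz
  have h0 : ((baseFrame g • z : ClosedDisc) : ℂ) = 0 := by
    rw [hz, smul_inv_smul]; rfl
  rw [smul_eq, baseFrame_apply hg, div_eq_zero_iff,
    or_iff_left (baseFrame_denom_ne_zero hg z), sub_eq_zero] at h0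
  have r1 := exp_add_exp_neg_mul hg
  have r2 := two_vertexRadius_sq hg
  have r3 := exp_sideAngle_mul g
  have d1 := halfTurn_denom_ne_zero hg z
  have e := (eq_div_iff d1).1 (halfTurn_apply hg z)
  have d2 := baseFrame_denom_ne_zero hg (halfTurn g • z)
  rw [smul_eq, baseFrame_apply hg, div_eq_iff d2, smul_eq]
  apply mul_left_cancel₀ d1
  have hz' : (z : ℂ) = vertexRadius g * Circle.exp (sideAngle g) := by
    linear_combination (-(Circle.exp (sideAngle g) : ℂ)) * h0 - (z : ℂ) * r3
  generalize ((halfTurn g : Equiv.Perm ClosedDisc) z : ℂ) = z' at *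
  generalize (Circle.exp (sideAngle g) : ℂ) = ε at *
  generalize (Circle.exp (-sideAngle g) : ℂ) = ε' at *
  generalize (vertexRadius g : ℂ) = R at *
  generalize (sideRadius g : ℂ) = ρ at *
  generalize (z : ℂ) = z at *
  subst hz'
  linear_combination (-ε' + ρ * ε * R * ε') * e + (R + ρ * R * (ρ - R * ε) - ρ ^ 2 * R) * r3 +
    (ρ * R * ε - 1) * r1

theorem sidePairing_inv_smul_center (hg : 2 ≤ g) (k : ℤ) :
    (((sidePairing g k)⁻¹ • discCenter : ClosedDisc) : ℂ) =
      sideRadius g * Circle.exp ((2 * k + 1) * sideAngle g) := by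
  have h : (sidePairing g k)⁻¹ • discCenter = rot g ^ k • baseFrame g • halfTurn g •
      (baseFrame g)⁻¹ • discCenter := by
    rw [sidePairing, mul_inv_rev, inv_inv, mul_inv_rev, halfTurn_inv hg, frame, frame,
      mul_inv_rev (rot g ^ pairedSide k), ← zpow_neg]
    simp only [mul_smul, rot_zpow_smul_center]
  rw [h, rot_zpow_apply, baseFrame_conj_halfTurn_center hg, mul_left_comm, ← Circle.coe_mul,
    ← Circle.exp_add]
  congr 3
  ring

/-- The side pairing expands strictly outside the geodesic through its side, which is part of its
isometric circle. -/
theorem one_lt_dil_sidePairing (hg : 2 ≤ g) {k : ℤ} {x : Circle}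
    (h : (boundaryMap (frame g k)⁻¹ x : ℂ).im < 0) : 1 < dil (sidePairing g k) x := by
  obtain ⟨K, hK, h1⟩ := exists_pos_mul_im_boundary hg k x
  have hρ := sideRadius_pos hg
  have hρ1 := sideRadius_lt_one hg
  have h2 : sideRadius g < ((Circle.exp (-((2 * k + 1) * sideAngle g)) : ℂ) * x).re := by
    nlinarith [mul_neg_of_pos_of_neg hK h]
  have hc : (((sidePairing g k)⁻¹ : DiscAut) : Equiv.Perm ClosedDisc) discCenter =
      (sidePairing g k)⁻¹ • discCenter := rfl
  have h3 : ‖(x : ℂ) - sideRadius g * Circle.exp ((2 * k + 1) * sideAngle g)‖ ^ 2 =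
      1 + sideRadius g ^ 2 -
        2 * sideRadius g * ((Circle.exp (-((2 * k + 1) * sideAngle g)) : ℂ) * x).re := by
    have h4 : (x : ℂ) - sideRadius g * Circle.exp ((2 * k + 1) * sideAngle g) =
        Circle.exp ((2 * k + 1) * sideAngle g) *
          ((Circle.exp (-((2 * k + 1) * sideAngle g)) : ℂ) * x - sideRadius g) := by
      have : (Circle.exp ((2 * k + 1) * sideAngle g) : ℂ) *
          Circle.exp (-((2 * k + 1) * sideAngle g)) = 1 := by
        rw [← Circle.coe_mul, ← Circle.exp_add]; simp
      linear_combination (-(x : ℂ)) * this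
    have h5 : Complex.normSq ((Circle.exp (-((2 * k + 1) * sideAngle g)) : ℂ) * x) = 1 := by
      rw [Complex.normSq_eq_norm_sq, norm_mul, Circle.norm_coe, Circle.norm_coe]; norm_num
    rw [h4, norm_mul, Circle.norm_coe, one_mul, ← Complex.normSq_eq_norm_sq]
    generalize (Circle.exp (-((2 * k + 1) * sideAngle g)) : ℂ) * x = w at *
    rw [Complex.normSq_apply] at *
    simp only [Complex.sub_re, Complex.sub_im, Complex.ofReal_re, Complex.ofReal_im]
    linear_combination h5
  have h6 : ‖(sideRadius g : ℂ) * Circle.exp ((2 * k + 1) * sideAngle g)‖ = sideRadius g := by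
    rw [norm_mul, Circle.norm_coe, mul_one, Complex.norm_real, Real.norm_of_nonneg hρ.le]
  have h7 : 0 < ‖(x : ℂ) - sideRadius g * Circle.exp ((2 * k + 1) * sideAngle g)‖ ^ 2 := by
    refine pow_pos (norm_pos_iff.2 fun h8 => ?_) 2
    rw [← sub_eq_zero.1 h8, Circle.norm_coe] at h6
    exact hρ1.ne' h6
  rw [← inv_inv (sidePairing g k), dil_inv_eq, hc, sidePairing_inv_smul_center hg, h6,
    one_lt_div h7, h3]
  nlinarith

/-! ### The branch arcs -/

theorem branchPoint_eq_frame_mul (k : ℤ) : branchPoint g k =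
    boundaryMap (frame g k * (rot g ^ (2 * g : ℤ) * halfTurn g * (rot g)⁻¹)) 1 := by
  rw [branchPoint]; simp only [mul_assoc]

theorem boundaryMap_turn (hg : 2 ≤ g) :
    boundaryMap (rot g ^ (2 * g : ℤ) * halfTurn g * (rot g)⁻¹) 1 =
      Circle.exp (π + turnAngle g) := by
  have h7 : boundaryMap (rot g)⁻¹ 1 = Circle.exp (-(2 * sideAngle g)) := by
    rw [← zpow_neg_one, boundaryMap_rot_zpow]
    push_cast; rw [neg_one_mul, mul_one]
  rw [boundaryMap_mul, boundaryMap_mul, h7, boundaryMap_halfTurn_neg_two hg,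
    boundaryMap_rot_half hg, Circle.exp_add, circle_exp_pi, neg_one_mul]

theorem frame_inv_branchPoint (hg : 2 ≤ g) (k : ℤ) :
    boundaryMap (frame g k)⁻¹ (branchPoint g k) = Circle.exp (π + turnAngle g) := by
  rw [branchPoint_eq_frame_mul, boundaryMap_mul, boundaryMap_inv_apply, boundaryMap_turn hg]

theorem frame_inv_branchPoint_succ (hg : 2 ≤ g) (k : ℤ) :
    ∃ y ∈ Ioo 0 (2 * sideAngle g - turnAngle g),
      boundaryMap (frame g k)⁻¹ (branchPoint g (k + 1)) = Circle.exp (-y) := by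
  obtain ⟨y, hy, -, h⟩ := exists_boundaryMap_halfTurn_pi_add hg
    (x := 2 * sideAngle g - turnAngle g) (by linarith [turnAngle_le hg, sideAngle_pos hg])
    (by linarith [turnAngle_pos hg, sideAngle_le hg, pi_pos])
  refine ⟨y, hy, ?_⟩
  rw [branchPoint_eq_frame_mul, boundaryMap_mul, boundaryMap_turn hg, frame_succ hg,
    boundaryMap_mul, boundaryMap_mul, boundaryMap_inv_apply, ← h, ← zpow_neg_one,
    boundaryMap_rot_zpow, ← Circle.exp_add]
  congr 2
  push_cast; ring

theorem frame_inv_branchPoint_pred (hg : 2 ≤ g) (k : ℤ) :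
    ∃ y ∈ Ioo 0 (turnAngle g),
      boundaryMap (frame g k)⁻¹ (branchPoint g (k - 1)) = Circle.exp (2 * sideAngle g + y) := by
  obtain ⟨y, hy, h, -⟩ := exists_boundaryMap_halfTurn_pi_add hg
    (x := turnAngle g) (turnAngle_pos hg) (by linarith [turnAngle_le hg, sideAngle_le hg, pi_pos])
  refine ⟨y, hy, ?_⟩
  rw [branchPoint_eq_frame_mul, boundaryMap_mul, boundaryMap_turn hg, frame_pred hg,
    boundaryMap_mul, boundaryMap_mul, boundaryMap_inv_apply, h, ← zpow_one (rot g),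
    boundaryMap_rot_zpow, ← Circle.exp_add]
  congr 1
  push_cast; ring

/-- An argument of the branch point number `0`, within `π` of the direction `θ` of the midpoint of
side `0`. -/
noncomputable def branchAngle (g : ℕ) : ℝ :=
  sideAngle g + Complex.arg (branchPoint g 0 * Circle.exp (-sideAngle g) : Circle)

theorem exp_branchAngle (g : ℕ) : Circle.exp (branchAngle g) = branchPoint g 0 := by
  rw [branchAngle, Circle.exp_add, Circle.exp_arg, mul_left_comm, ← Circle.exp_add]
  simp

theorem exp_branchAngle_add (k : ℤ) :
    Circle.exp (branchAngle g + k * (2 * sideAngle g)) = branchPoint g k := by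
  rw [branchPoint_eq, Circle.exp_add, exp_branchAngle, mul_comm]

/-- The closed branch arc of side `k` lies strictly outside the geodesic through this side. It
suffices to check its two endpoints, as the arc is shorter than a half circle. -/
theorem im_frame_inv_neg (hg : 2 ≤ g) (k : ℤ) {s : ℝ} (hs : s ∈ Icc 0 (2 * sideAngle g)) :
    (boundaryMap (frame g k)⁻¹ (Circle.exp (branchAngle g + k * (2 * sideAngle g) + s)) : ℂ).im <
      0 := by
  have hθ := sideAngle_pos hg
  have hθ' := sideAngle_le hg
  have hδ := turnAngle_pos hg
  have hδ' := turnAngle_le hg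
  have hpi := pi_pos
  have hρ := sideRadius_pos hg
  have key : ∀ s : ℝ, (boundaryMap (frame g k)⁻¹
      (Circle.exp (branchAngle g + k * (2 * sideAngle g) + s)) : ℂ).im < 0 ↔
      sideRadius g < cos (branchAngle g - sideAngle g + s) := by
    intro s
    obtain ⟨K, hK, h⟩ := exists_pos_mul_im_boundary hg k
      (Circle.exp (branchAngle g + k * (2 * sideAngle g) + s))
    rw [← Circle.coe_mul, ← Circle.exp_add, Circle.coe_exp, Complex.exp_ofReal_mul_I_re,
      show -((2 * (k : ℝ) + 1) * sideAngle g) + (branchAngle g + k * (2 * sideAngle g) + s) =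
        branchAngle g - sideAngle g + s by ring] at h
    constructor
    · intro h1
      nlinarith [mul_neg_of_pos_of_neg hK h1]
    · intro h1
      by_contra h2
      nlinarith [mul_nonneg hK.le (not_lt.1 h2)]
  have e0 := (key 0).1 (by
    rw [add_zero, exp_branchAngle_add, frame_inv_branchPoint hg, Circle.coe_exp,
      Complex.exp_ofReal_mul_I_im, add_comm, sin_add_pi]
    linarith [sin_pos_of_pos_of_lt_pi hδ (by linarith)])
  have e1 := (key (2 * sideAngle g)).1 (by
    obtain ⟨y, hy, h⟩ := frame_inv_branchPoint_succ hg k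
    rw [show branchAngle g + k * (2 * sideAngle g) + 2 * sideAngle g =
      branchAngle g + (k + 1 : ℤ) * (2 * sideAngle g) by push_cast; ring, exp_branchAngle_add, h,
      Circle.coe_exp, Complex.exp_ofReal_mul_I_im, sin_neg]
    linarith [sin_pos_of_pos_of_lt_pi hy.1 (by linarith [hy.2])])
  rw [key]
  have hψ : branchAngle g - sideAngle g =
      Complex.arg (branchPoint g 0 * Circle.exp (-sideAngle g) : Circle) := by
    rw [branchAngle]; ring
  have h1 := Complex.neg_pi_lt_arg (branchPoint g 0 * Circle.exp (-sideAngle g) : Circle)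
  have h2 := Complex.arg_le_pi (branchPoint g 0 * Circle.exp (-sideAngle g) : Circle)
  rw [← hψ] at h1 h2
  generalize branchAngle g - sideAngle g = ψ at *
  rw [add_zero] at e0
  have h3 : -(π / 2) ≤ ψ := by
    by_contra h4
    have := cos_nonpos_of_pi_div_two_le_of_le (x := -ψ) (by linarith) (by linarith)
    rw [cos_neg] at this
    linarith
  have h4 : ψ ≤ π / 2 := by
    by_contra h4
    have := cos_nonpos_of_pi_div_two_le_of_le (x := ψ) (by linarith) (by linarith)
    linarith
  have h5 : ψ + 2 * sideAngle g ≤ π / 2 := by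
    by_contra h4
    have := cos_nonpos_of_pi_div_two_le_of_le (x := ψ + 2 * sideAngle g) (by linarith)
      (by linarith)
    linarith
  refine (lt_min e0 e1).trans_le (strictConcaveOn_cos_Icc.concaveOn.ge_on_segment
    ⟨h3, h4⟩ ⟨by linarith, h5⟩ ?_)
  rw [segment_eq_Icc (by linarith)]
  exact ⟨by linarith [hs.1], by linarith [hs.2]⟩

/-! ### The branches of the standard map -/

theorem exp_ne_exp {a b : ℝ} (h1 : a < b) (h2 : b < a + 2 * π) :
    Circle.exp b ≠ Circle.exp a := fun h =>
  h1.ne' (Circle.exp_injOn_Ico (a := a) (b := a + 2 * π) (by simp) ⟨h1.le, h2⟩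
    ⟨le_rfl, by linarith⟩ h)

theorem mem_branchArc_iff (hg : 2 ≤ g) (hfree : ActsFreely (standardGroup g)) (k : ℤ)
    (x : Circle) : x ∈ branchArc g k ↔ ∃ s ∈ Ico 0 (2 * sideAngle g),
      x = Circle.exp (branchAngle g + k * (2 * sideAngle g) + s) := by
  have hθ := sideAngle_pos hg
  have hθ' := sideAngle_le hg
  have e : branchPoint g (k + 1) = branchPoint g k * Circle.exp (2 * sideAngle g) := by
    rw [← exp_branchAngle_add, ← exp_branchAngle_add, ← Circle.exp_add]
    congr 1; push_cast; ring
  have h2 : ∀ s, Circle.exp (branchAngle g + k * (2 * sideAngle g) + s) =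
      branchPoint g k * Circle.exp s := fun s => by
    rw [Circle.exp_add _ s, exp_branchAngle_add]
  simp only [h2]
  constructor
  · rintro ⟨a, b, ha, hb, s, t, hs, hst, ht, rfl, hbt⟩
    rw [isClockwiseEnd_iff hg hfree] at ha hb
    subst ha hb
    refine ⟨s, ⟨hs, ?_⟩, rfl⟩
    have h3 : Circle.exp t = Circle.exp (2 * sideAngle g) := by
      rw [e] at hbt; exact (mul_left_cancel hbt).symm
    have h4 := Circle.exp_injOn_Ico (a := 0) (b := 2 * π) (by simp) ⟨by linarith, ht⟩
      ⟨by linarith, by linarith [pi_pos]⟩ h3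
    rwa [← h4]
  · rintro ⟨s, hs, rfl⟩
    exact ⟨_, _, (isClockwiseEnd_iff hg hfree _ _).2 rfl, (isClockwiseEnd_iff hg hfree _ _).2 rfl,
      s, 2 * sideAngle g, hs.1, hs.2, by linarith [pi_pos], rfl, e⟩

theorem sidePairing_add_mul (hg : 2 ≤ g) (k n : ℤ) :
    sidePairing g (k + 4 * g * n) = sidePairing g k := by
  rw [sidePairing, sidePairing, pairedSide_add_mul, frame_add_mul hg, frame_add_mul hg]

theorem four_mul_two_sideAngle (hg : 2 ≤ g) : (4 * g : ℝ) * (2 * sideAngle g) = 2 * π := by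
  rw [← sideAngle_mul hg]; ring

/-- Comparing two arguments of a point of the circle, given relative to different sides. -/
theorem exists_eq_of_exp_eq (hg : 2 ≤ g) {k l : ℤ} {s t c : ℝ}
    (h : Circle.exp (c + k * (2 * sideAngle g) + s) = Circle.exp (c + l * (2 * sideAngle g) + t)) :
    ∃ n : ℤ, ((k - (l + 4 * g * n) : ℤ) : ℝ) * (2 * sideAngle g) = t - s := by
  obtain ⟨n, hn⟩ := Circle.exp_eq_exp.1 h
  refine ⟨n, ?_⟩
  push_cast
  linear_combination hn - n * four_mul_two_sideAngle hg

theorem standardMap_exp (hg : 2 ≤ g) (hfree : ActsFreely (standardGroup g)) (k : ℤ) {s : ℝ}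
    (hs : s ∈ Ico 0 (2 * sideAngle g)) :
    standardMap g (Circle.exp (branchAngle g + k * (2 * sideAngle g) + s)) =
      boundaryMap (sidePairing g k)
        (Circle.exp (branchAngle g + k * (2 * sideAngle g) + s)) := by
  have hθ := sideAngle_pos hg
  have hex : ∃ γ : DiscAut, ∃ l : ℤ, IsSidePairing g l γ ∧
      Circle.exp (branchAngle g + k * (2 * sideAngle g) + s) ∈ branchArc g l :=
    ⟨_, k, (isSidePairing_iff hg).2 rfl, (mem_branchArc_iff hg hfree _ _).2 ⟨s, hs, rfl⟩⟩
  obtain ⟨l, h1, h2⟩ := hex.choose_spec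
  rw [standardMap, dif_pos hex, (isSidePairing_iff hg).1 h1]
  obtain ⟨t, ht, h3⟩ := (mem_branchArc_iff hg hfree _ _).1 h2
  obtain ⟨n, hn⟩ := exists_eq_of_exp_eq hg h3
  have h4 : k = l + 4 * g * n := by
    have a1 : ((k - (l + 4 * g * n) : ℤ) : ℝ) < 1 := by
      by_contra h5
      nlinarith [ht.2, hs.1, not_lt.1 h5]
    have a2 : (-1 : ℝ) < ((k - (l + 4 * g * n) : ℤ) : ℝ) := by
      by_contra h5
      nlinarith [ht.1, hs.2, not_lt.1 h5]
    have a1' : k - (l + 4 * g * n) < 1 := by exact_mod_cast a1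
    have a2' : -1 < k - (l + 4 * g * n) := by exact_mod_cast a2
    linarith
  rw [h4, sidePairing_add_mul hg]

theorem exists_side_of_circle (hg : 2 ≤ g) (x : Circle) : ∃ k : Fin (4 * g),
    ∃ s ∈ Ico 0 (2 * sideAngle g),
      x = Circle.exp (branchAngle g + ((k : ℕ) : ℤ) * (2 * sideAngle g) + s) := by
  have hθ := sideAngle_pos hg
  have hα : 0 < 2 * sideAngle g := by linarith
  obtain ⟨u, rfl⟩ := Circle.exp_surjective x
  obtain ⟨v, hv, hu⟩ : ∃ v ∈ Ico 0 (2 * π), Circle.exp u = Circle.exp (branchAngle g + v) := by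
    refine ⟨toIcoMod two_pi_pos 0 (u - branchAngle g), ?_, ?_⟩
    · simpa using toIcoMod_mem_Ico two_pi_pos 0 (u - branchAngle g)
    · rw [Circle.exp_eq_exp]
      refine ⟨toIcoDiv two_pi_pos 0 (u - branchAngle g), ?_⟩
      have := toIcoMod_add_toIcoDiv_zsmul two_pi_pos 0 (u - branchAngle g)
      rw [zsmul_eq_mul] at this
      linarith
  have h1 : 0 ≤ v / (2 * sideAngle g) := div_nonneg hv.1 hα.le
  have h2 := Nat.floor_le h1
  have h3 := Nat.lt_floor_add_one (v / (2 * sideAngle g))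
  rw [le_div_iff₀ hα] at h2
  rw [div_lt_iff₀ hα] at h3
  refine ⟨⟨⌊v / (2 * sideAngle g)⌋₊, ?_⟩, v - ⌊v / (2 * sideAngle g)⌋₊ * (2 * sideAngle g),
    ⟨by linarith, by linarith⟩, ?_⟩
  · rw [Nat.floor_lt h1, div_lt_iff₀ hα]
    push_cast
    rw [four_mul_two_sideAngle hg]
    exact hv.2
  · rw [hu]
    congr 1
    push_cast; ring

theorem branchPoint_mem_cutPoints (hg : 2 ≤ g) (hfree : ActsFreely (standardGroup g)) (k : ℤ) :
    branchPoint g k ∈ cutPoints g :=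
  (mem_cutPoints_iff hg hfree _).2 ⟨k, 2 * g, -1, by rw [branchPoint, zpow_neg_one]⟩

/-! ### The cut points in a branch arc -/

theorem exists_rot_zpow_eq (hg : 2 ≤ g) (i : ℤ) :
    ∃ j : ℤ, 0 ≤ j ∧ j < 4 * g ∧ rot g ^ i = rot g ^ j := by
  have hg' : (0 : ℤ) < 4 * g := by omega
  refine ⟨i % (4 * g), Int.emod_nonneg _ hg'.ne', Int.emod_lt_of_pos _ hg', ?_⟩
  conv_lhs => rw [← Int.emod_add_mul_ediv i (4 * g), zpow_add, rot_zpow_mul hg, mul_one]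

/-- `x` is an endpoint of a geodesic through a neighbour of vertex `k`, and it lies in the direction
of vertex `k` when seen from `0`: in the coordinate of the frame of this vertex, in which the two
sides at the vertex have directions `0` and `2θ`, `θ` the side angle, the argument of `x` is at
least `4θ - δ` and at most `2π - 2θ + δ`, where `δ ≤ θ` is the turn angle. -/
def IsOuterCutPoint (g : ℕ) (k : ℤ) (x : Circle) : Prop :=
  (∃ i m : ℤ, x = boundaryMap (frame g k * rot g ^ i * halfTurn g * rot g ^ m) 1) ∧
    ∃ t ∈ Icc (2 * (2 * sideAngle g) - turnAngle g) (2 * π - 2 * sideAngle g + turnAngle g),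
      boundaryMap (frame g k)⁻¹ x = Circle.exp t

/-- Only the directions close to the two sides at vertex `k` are excluded. -/
theorem isOuterCutPoint_of_exp (hg : 2 ≤ g) {k n : ℤ} (h2 : 2 ≤ n) (hn : n < 4 * g) {x : Circle}
    (hx : ∃ i m : ℤ, x = boundaryMap (frame g k * rot g ^ i * halfTurn g * rot g ^ m) 1) {s : ℝ}
    (hs : s ∈ Icc (-turnAngle g) (turnAngle g))
    (h : boundaryMap (frame g k)⁻¹ x = Circle.exp (n * (2 * sideAngle g) + s)) :
    IsOuterCutPoint g k x := by
  have hθ := sideAngle_pos hg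
  refine ⟨hx, _, ⟨?_, ?_⟩, h⟩
  · have : (2 : ℝ) ≤ n := by exact_mod_cast h2
    nlinarith [hs.1]
  · have : (n : ℝ) ≤ 4 * g - 1 := by
      have : n ≤ 4 * g - 1 := by omega
      exact_mod_cast this
    have h3 := mul_le_mul_of_nonneg_right this (by linarith : 0 ≤ 2 * sideAngle g)
    rw [sub_mul, four_mul_two_sideAngle hg] at h3
    linarith [hs.2]

theorem boundaryMap_mul_rot_eq (hg : 2 ≤ g) (M : DiscAut) (n : ℤ) : boundaryMap (M * rot g ^ n) 1 =
    boundaryMap (M * rot g ^ (n - 2 * g) * halfTurn g * rot g ^ (0 : ℤ)) 1 := by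
  have : rot g ^ n = rot g ^ (n - 2 * g) * rot g ^ (2 * g : ℤ) := by rw [← zpow_add]; congr 1; ring
  rw [zpow_zero, mul_one, boundaryMap_mul _ (halfTurn g), boundaryMap_halfTurn_one hg, this,
    ← mul_assoc, boundaryMap_mul, boundaryMap_rot_half hg]

theorem boundaryMap_mul_halfTurn_rot_half (hg : 2 ≤ g) (M : DiscAut) :
    boundaryMap (M * halfTurn g * rot g ^ (2 * g : ℤ)) 1 = boundaryMap M 1 := by
  rw [boundaryMap_mul, boundaryMap_rot_half hg, boundaryMap_mul, boundaryMap_halfTurn_neg_one hg]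

/-- The endpoints at infinity of the geodesics through the vertices of the polygon. -/
theorem exists_isOuterCutPoint_frame_mul_rot (hg : 2 ≤ g) (k n : ℤ) :
    ∃ l, IsOuterCutPoint g l (boundaryMap (frame g k * rot g ^ n) 1) := by
  have key : ∀ k n : ℤ, 2 ≤ n → n < 4 * g →
      IsOuterCutPoint g k (boundaryMap (frame g k * rot g ^ n) 1) := fun k n h2 hn =>
    isOuterCutPoint_of_exp hg h2 hn ⟨n - 2 * g, 0, boundaryMap_mul_rot_eq hg _ n⟩ (s := 0)
      ⟨by linarith [turnAngle_pos hg], (turnAngle_pos hg).le⟩ (by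
        rw [boundaryMap_mul, boundaryMap_inv_apply, boundaryMap_rot_zpow, mul_one, add_zero])
  obtain ⟨m, hm0, hm, e⟩ := exists_rot_zpow_eq hg n
  rw [e]
  obtain rfl | rfl | h2 : m = 0 ∨ m = 1 ∨ 2 ≤ m := by omega
  · refine ⟨k + 1, ?_⟩
    have := key (k + 1) (2 * g + 1) (by omega) (by omega)
    rwa [frame_succ hg, add_comm (2 * (g : ℤ)), zpow_add, zpow_one, ← mul_assoc,
      inv_mul_cancel_right, boundaryMap_mul_halfTurn_rot_half hg] at this
  · refine ⟨k - 1, ?_⟩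
    have := key (k - 1) (2 * g) (by omega) (by omega)
    rwa [frame_pred hg, boundaryMap_mul_halfTurn_rot_half hg, ← zpow_one (rot g), zpow_one] at this
  · exact ⟨k, key k m h2 hm⟩

/-- Every cut point lies in the direction of some vertex, relative to which it is given: if it is
close to a side at vertex `k`, it also arises from the vertex at the other end of this side. -/
theorem exists_isOuterCutPoint (hg : 2 ≤ g) (hfree : ActsFreely (standardGroup g)) {x : Circle}
    (hx : x ∈ cutPoints g) : ∃ k, IsOuterCutPoint g k x := by
  have hδ := turnAngle_pos hg
  have hθ := sideAngle_pos hg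
  obtain ⟨k, i, m, rfl⟩ := (mem_cutPoints_iff hg hfree x).1 hx
  obtain ⟨m', hm0, hm, em⟩ := exists_rot_zpow_eq hg m
  obtain ⟨i', hi0, hi, ei⟩ := exists_rot_zpow_eq hg i
  rw [em, ei]
  rcases hm0.eq_or_lt with rfl | hm1
  · have := boundaryMap_mul_rot_eq hg (frame g k) (i' + 2 * g)
    rw [add_sub_cancel_right] at this
    rw [← this]
    exact exists_isOuterCutPoint_frame_mul_rot hg _ _
  · obtain rfl | rfl | h2 : i' = 0 ∨ i' = 1 ∨ 2 ≤ i' := by omega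
    · have e : frame g k * rot g ^ (0 : ℤ) * halfTurn g * rot g ^ m' =
          frame g (k + 1) * rot g ^ (1 + m') := by
        rw [frame_succ hg, zpow_add, zpow_one, zpow_zero, mul_one, ← mul_assoc,
          inv_mul_cancel_right]
      rw [e]
      exact exists_isOuterCutPoint_frame_mul_rot hg _ _
    · rw [zpow_one, ← frame_pred hg]
      exact exists_isOuterCutPoint_frame_mul_rot hg _ _
    · obtain ⟨s, hs, h⟩ := exists_boundaryMap_halfTurn_eq hg (t := m' * (2 * sideAngle g))
        (by
          have : (1 : ℝ) ≤ m' := by exact_mod_cast hm1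
          nlinarith)
        (by
          have : (m' : ℝ) ≤ 4 * g - 1 := by
            have : m' ≤ 4 * g - 1 := by omega
            exact_mod_cast this
          have h3 := mul_le_mul_of_nonneg_right this (by linarith : 0 ≤ 2 * sideAngle g)
          rwa [sub_mul, four_mul_two_sideAngle hg, one_mul] at h3)
      refine ⟨k, isOuterCutPoint_of_exp hg h2 hi ⟨i', m', rfl⟩ hs ?_⟩
      rw [boundaryMap_mul, boundaryMap_rot_zpow, mul_one, boundaryMap_mul, h, boundaryMap_mul,
        boundaryMap_inv_apply, boundaryMap_rot_zpow, ← Circle.exp_add]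

/-- The cut points in the direction of vertex `k` lie between the branch points `k - 1` and
`k + 1`. -/
theorem IsOuterCutPoint.exists_eq_exp (hg : 2 ≤ g) {k : ℤ} {x : Circle}
    (h : IsOuterCutPoint g k x) : ∃ s ∈ Ioo (-(2 * sideAngle g)) (2 * sideAngle g),
      x = Circle.exp (branchAngle g + k * (2 * sideAngle g) + s) := by
  have hδ := turnAngle_pos hg
  have hδ' := turnAngle_le hg
  have hθ := sideAngle_pos hg
  have hθ' := sideAngle_le hg
  have hpi := pi_pos
  obtain ⟨-, t, ht, hx⟩ := h
  set c := branchAngle g + k * (2 * sideAngle g) with hc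
  set I := Icc (2 * (2 * sideAngle g) - turnAngle g) (2 * π - 2 * sideAngle g + turnAngle g) with hI
  have e1 : Circle.exp (c + 2 * sideAngle g) = branchPoint g (k + 1) := by
    rw [← exp_branchAngle_add]; congr 1; push_cast; ring
  have e2 : Circle.exp (c - 2 * sideAngle g) = branchPoint g (k - 1) := by
    rw [← exp_branchAngle_add]; congr 1; push_cast; ring
  have hsub : (fun t => boundaryMap (frame g k) (Circle.exp t)) '' I ⊆
      Circle.exp '' Ioo (c - 2 * sideAngle g) (c + 2 * sideAngle g) := by
    -- the image of the interval is connected, contains branch point `k`, and omits the branch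
    -- points `k - 1` and `k + 1`
    refine subset_of_isPreconnected (isPreconnected_Icc.image _
      ((continuous_boundaryMap _).comp Circle.exp.continuous).continuousOn)
      (isOpen_exp_Ioo _ _) ⟨branchPoint g k, ⟨π + turnAngle g, ⟨by linarith, by linarith⟩, ?_⟩,
        ⟨c, ⟨by linarith, by linarith⟩, exp_branchAngle_add k⟩⟩ ?_
    · dsimp only
      rw [← frame_inv_branchPoint hg k, boundaryMap_apply_inv]
    · rintro _ ⟨u, hu, rfl⟩ hcl
      rw [closure_exp_Ioo (by linarith)] at hcl
      obtain ⟨v, hv, hvu⟩ := hcl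
      refine ⟨v, ⟨hv.1.lt_of_ne' fun h => ?_, hv.2.lt_of_ne fun h => ?_⟩, hvu⟩
      · rw [h, e2] at hvu
        obtain ⟨y, hy, h1⟩ := frame_inv_branchPoint_pred hg k
        rw [boundaryMap_inv_eq_iff, hvu] at h1
        exact exp_ne_exp (by linarith [hu.1, hy.2]) (by linarith [hu.2, hy.1])
          (boundaryMap_injective _ h1)
      · rw [h, e1] at hvu
        obtain ⟨y, hy, h1⟩ := frame_inv_branchPoint_succ hg k
        rw [boundaryMap_inv_eq_iff, hvu] at h1
        exact exp_ne_exp (by linarith [hu.1, hy.1]) (by linarith [hu.2, hy.2])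
          (boundaryMap_injective _ h1)
  obtain ⟨v, hv, hvx⟩ := hsub ⟨t, ht, rfl⟩
  dsimp only at hvx
  rw [← hx, boundaryMap_apply_inv] at hvx
  exact ⟨v - c, ⟨by linarith [hv.1], by linarith [hv.2]⟩, by rw [← hvx]; congr 1; ring⟩

/-- The Markov property. A cut point in the closed branch arc of side `j` is given relative to one
of the endpoints of this side, and the side pairing maps these to vertices of the polygon, and
their neighbours to neighbours of vertices. -/
theorem sidePairing_mem_cutPoints (hg : 2 ≤ g) (hfree : ActsFreely (standardGroup g)) (j : ℤ)
    {s : ℝ} (hs : s ∈ Icc 0 (2 * sideAngle g))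
    (hx : Circle.exp (branchAngle g + j * (2 * sideAngle g) + s) ∈ cutPoints g) :
    boundaryMap (sidePairing g j) (Circle.exp (branchAngle g + j * (2 * sideAngle g) + s)) ∈
      cutPoints g := by
  have hθ := sideAngle_pos hg
  obtain ⟨k, hk⟩ := exists_isOuterCutPoint hg hfree hx
  obtain ⟨t, ht, h1⟩ := hk.exists_eq_exp hg
  obtain ⟨n, hn⟩ := exists_eq_of_exp_eq hg h1
  -- vertex `k` is one of the endpoints of side `j`
  have h2 : j = k + 4 * g * n ∨ j + 1 = k + 4 * g * n := by
    have a1 : ((j - (k + 4 * g * n) : ℤ) : ℝ) < 1 := by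
      by_contra h5
      nlinarith [ht.2, hs.1, not_lt.1 h5]
    have a2 : (-2 : ℝ) < ((j - (k + 4 * g * n) : ℤ) : ℝ) := by
      by_contra h5
      nlinarith [ht.1, hs.2, not_lt.1 h5]
    have a1' : j - (k + 4 * g * n) < 1 := by exact_mod_cast a1
    have a2' : -2 < j - (k + 4 * g * n) := by exact_mod_cast a2
    omega
  obtain ⟨⟨i, m, h3⟩, -⟩ := hk
  rw [h3, ← boundaryMap_mul, mem_cutPoints_iff hg hfree]
  rw [← frame_add_mul hg k n]
  rcases h2 with h2 | h2
  · refine ⟨pairedSide j + 1, i + 1, m, ?_⟩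
    rw [← h2, sidePairing, frame_succ hg, add_comm, zpow_add]
    congr 1; group
  · refine ⟨pairedSide j, i - 1, m, ?_⟩
    have : frame g (j + 1) = frame g j * halfTurn g * (rot g)⁻¹ := frame_succ hg j
    rw [← h2, sidePairing, this, sub_eq_add_neg, add_comm, zpow_add]
    have e : frame g (pairedSide j) * halfTurn g * (frame g j)⁻¹ *
        (frame g j * halfTurn g * (rot g)⁻¹ * rot g ^ i * halfTurn g * rot g ^ m) =
        frame g (pairedSide j) * (halfTurn g * halfTurn g) * (rot g)⁻¹ * rot g ^ i * halfTurn g *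
          rot g ^ m := by group
    rw [e, halfTurn_mul_self hg, mul_one, zpow_neg_one]
    simp only [mul_assoc]

/-- The `4g` branches of the standard map are expanding and map cut points to cut points. -/
theorem isBranchSystem_standardMap (hg : 2 ≤ g) (hfree : ActsFreely (standardGroup g)) :
    IsBranchSystem (standardMap g) (cutPoints g)
      (fun k : Fin (4 * g) => Circle.exp ''
        Ioo (branchAngle g + ((k : ℕ) : ℤ) * (2 * sideAngle g))
          (branchAngle g + ((k : ℕ) : ℤ) * (2 * sideAngle g) + 2 * sideAngle g))
      (fun k => (⟨sidePairing g ((k : ℕ) : ℤ), sidePairing_mem hg _⟩ : standardGroup g)) := by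
  have hθ := sideAngle_pos hg
  have hθ' := sideAngle_le hg
  have hpi := pi_pos
  have hmem : ∀ (k : ℤ) (x : Circle), x ∈ Circle.exp ''
      Ioo (branchAngle g + k * (2 * sideAngle g))
        (branchAngle g + k * (2 * sideAngle g) + 2 * sideAngle g) → ∃ s ∈ Ioo 0 (2 * sideAngle g),
      x = Circle.exp (branchAngle g + k * (2 * sideAngle g) + s) := by
    rintro k _ ⟨u, hu, rfl⟩
    exact ⟨u - (branchAngle g + k * (2 * sideAngle g)), ⟨by linarith [hu.1], by linarith [hu.2]⟩,
      by rw [add_sub_cancel]⟩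
  have hmem' : ∀ (k : ℤ) (x : Circle), x ∈ closure (Circle.exp ''
      Ioo (branchAngle g + k * (2 * sideAngle g))
        (branchAngle g + k * (2 * sideAngle g) + 2 * sideAngle g)) →
      ∃ s ∈ Icc 0 (2 * sideAngle g),
        x = Circle.exp (branchAngle g + k * (2 * sideAngle g) + s) := by
    intro k x hx
    rw [closure_exp_Ioo (by linarith)] at hx
    obtain ⟨u, hu, rfl⟩ := hx
    exact ⟨u - (branchAngle g + k * (2 * sideAngle g)), ⟨by linarith [hu.1], by linarith [hu.2]⟩,
      by rw [add_sub_cancel]⟩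
  refine ⟨cutPoints_finite hg hfree, ?_, fun _ => isOpen_exp_Ioo _ _, ?_, ?_, ?_, ?_, ?_, ?_⟩
  · refine ⟨_, branchPoint_mem_cutPoints hg hfree 1, _, branchPoint_mem_cutPoints hg hfree 0, ?_⟩
    rw [← exp_branchAngle_add, ← exp_branchAngle_add]
    push_cast
    exact exp_ne_exp (by linarith) (by linarith)
  · intro k l hkl
    refine disjoint_left.2 fun x hk hl => hkl ?_
    obtain ⟨s, hs, rfl⟩ := hmem _ _ hk
    obtain ⟨t, ht, h⟩ := hmem _ _ hl
    obtain ⟨n, hn⟩ := exists_eq_of_exp_eq hg h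
    have a1 : ((((k : ℕ) : ℤ) - (((l : ℕ) : ℤ) + 4 * g * n) : ℤ) : ℝ) < 1 := by
      by_contra h5
      nlinarith [ht.2, hs.1, not_lt.1 h5]
    have a2 : (-1 : ℝ) < ((((k : ℕ) : ℤ) - (((l : ℕ) : ℤ) + 4 * g * n) : ℤ) : ℝ) := by
      by_contra h5
      nlinarith [ht.1, hs.2, not_lt.1 h5]
    have a1' : ((k : ℕ) : ℤ) - (((l : ℕ) : ℤ) + 4 * g * n) < 1 := by exact_mod_cast a1
    have a2' : -1 < ((k : ℕ) : ℤ) - (((l : ℕ) : ℤ) + 4 * g * n) := by exact_mod_cast a2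
    have h6 : ((k : ℕ) : ℤ) = ((l : ℕ) : ℤ) + 4 * g * n := by omega
    have h7 : ((k : ℕ) : ℤ) < 4 * g := by exact_mod_cast k.2
    have h8 : ((l : ℕ) : ℤ) < 4 * g := by exact_mod_cast l.2
    have h9 : (0 : ℤ) < 4 * g := by omega
    have h10 : n = 0 := by
      by_contra h11
      rcases lt_or_gt_of_ne h11 with h11 | h11 <;> nlinarith
    rw [h10, mul_zero, add_zero] at h6
    exact Fin.ext (by exact_mod_cast h6)
  · intro x hx
    obtain ⟨k, s, hs, rfl⟩ := exists_side_of_circle hg x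
    refine ⟨k, _, ⟨?_, ?_⟩, rfl⟩
    · refine lt_add_of_pos_right _ (hs.1.lt_of_ne fun h => hx ?_)
      rw [← h, add_zero, exp_branchAngle_add]
      exact branchPoint_mem_cutPoints hg hfree _
    · linarith [hs.2]
  · intro k x hx
    obtain ⟨s, hs, rfl⟩ := hmem _ _ hx
    exact standardMap_exp hg hfree _ ⟨hs.1.le, hs.2⟩
  · intro x
    obtain ⟨k, s, hs, rfl⟩ := exists_side_of_circle hg x
    refine ⟨k, ?_, standardMap_exp hg hfree _ hs⟩
    rw [closure_exp_Ioo (by linarith)]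
    exact ⟨_, ⟨by linarith [hs.1], by linarith [hs.2]⟩, rfl⟩
  · intro k x hxW hx
    obtain ⟨s, hs, rfl⟩ := hmem' _ _ hx
    exact sidePairing_mem_cutPoints hg hfree _ hs hxW
  · intro k x hx
    obtain ⟨s, hs, rfl⟩ := hmem' _ _ hx
    exact one_lt_dil_sidePairing hg (im_frame_inv_neg hg _ hs)

end BowenSeries

theorem mainTheorem7 (g : ℕ) (hg : 2 ≤ g)
    (Γ : Subgroup BowenSeries.DiscAut) (hΓ : BowenSeries.IsClosedSurfaceGroup Γ)
    (φ : BowenSeries.standardGroup g ≃* Γ)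
    (H : Circle ≃ₜ Circle) (hH : BowenSeries.IsBoundaryCorrespondence φ H) :
    BowenSeries.IsMarkovMap Γ (BowenSeries.surfaceMap g H) (BowenSeries.surfacePartition g H) ∧
    BowenSeries.IsExpanding Γ (BowenSeries.surfaceMap g H) (BowenSeries.surfacePartition g H) ∧
    BowenSeries.HasBoundedGeometry (BowenSeries.surfaceMap g H)
      (BowenSeries.surfacePartition g H) := by
  have S := BowenSeries.isBranchSystem_standardMap hg
    (BowenSeries.free_of_boundary_conj hΓ hH)
  exact ⟨S.isMarkovMap hH, S.isExpanding hΓ hH, S.hasBoundedGeometry hΓ hH⟩
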